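/- **Conventions.** Let $\mathbb H$ be the upper half plane. For a congruence subgroup $\Gamma\subset SL(2,\mathbb Z)$, let $N(\Gamma)$ be its normalizer in $SL(2,\mathbb R)$, and let $G$ be a group with $\Gamma\le G\le N(\Gamma)$. Let $\chi_1$ be a character of $\Gamma$ and $\chi_2$ a character of $G$ with $\chi_2|_\Gamma=\chi_1^2$. A *bimodular form* of weight $k$ on $(\Gamma,G)$ with characters $(\chi_1,\chi_2)$ is a holomorphic function $F:\mathbb H^2\to\mathbb C$ which is a modular form (holomorphic also at the cusps) of weight $k$ with character $\chi_1$ on $\Gamma$ in each of its two variables and satisfies $$F(\gamma\tau_1,\gamma\tau_2)=\chi_2(\gamma)(c\tau_1+d)^k(c\tau_2+d)^kF(\tau_1,\tau_2)\qquad\text{for all }\gamma=\begin{pmatrix}a&b\\c&d\end{pmatrix}\in G.$$ A *bimodular function* on $(\Gamma,G)$ is a meromorphic function $f$ on $\mathbb H^2$ such that, as identities of meromorphic functions, $f(\gamma\tau_1,\tau_2)=f(\tau_1,\gamma\tau_2)=f(\tau_1,\tau_2)$ for all $\gamma\in\Gamma$ and $f(\gamma\tau_1,\gamma\tau_2)=f(\tau_1,\tau_2)$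 for all $\gamma\in G$, and which is meromorphic at the cusps in each variable. The last condition means: for every $\gamma\in SL(2,\mathbb Z)$ and all $\tau_0$ in a dense subset of $\mathbb H$, there are a neighbourhood $N$ of $\tau_0$ and a real $C$ with $|f(\gamma\tau_1,\tau_2)|\le e^{C\operatorname{Im}\tau_1}$ for $\operatorname{Im}\tau_1\ge C$, $\tau_2\in N$ (off a nowhere dense set), and likewise with the two variables exchanged. **Notation.** With $q=e^{2\pi i\tau}$ put $$L(\tau)=\sum_{m,n\in\mathbb Z}q^{m^2+mn+n^2},\qquad a(\tau)=L(\tau),\qquad b(\tau)=\tfrac12\bigl(3L(3\tau)-L(\tau)\bigr),\qquad t(\tau)=\frac{b(\tau)}{a(\tau)},$$ and, with $t_1=t(\tau_1)$, $t_2=t(\tau_2)$, $$x=\left(\frac{t_1+t_2-2t_1^2t_2^2}{1+4t_1t_2(t_1+t_2)}\right)^3,\qquad y=\frac{t_1t_2(1-t_1^3)(1-t_2^3)}{(t_1+t_2-2t_1^2t_2^2)^2},$$ $$F(\tau_1,\tau_2)=\tfrac13\sqrt{1+4t_1t_2(t_1+t_2)}\;a(\tau_1)a(\tau_2),$$ where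 $F$ is defined locally, up to the choice of a branch of the square root. **Proposition.** 1. The functions $x$ and $y$ are bimodular functions on $(\Gamma_0(9),N(\Gamma_0(9)))$. 2. The function $F^2=\frac19\bigl(1+4t_1t_2(t_1+t_2)\bigr)a(\tau_1)^2a(\tau_2)^2$ (extended holomorphically to the zeros of $a(\tau_1)a(\tau_2)$) is a bimodular form of weight $2$ on $(\Gamma_0(9),N(\Gamma_0(9)))$ with trivial characters. 3. As a function of $x$ and $y$, $F$ satisfies, with $\theta_x=x\,\partial/\partial x$ and $\theta_y=y\,\partial/\partial y$, $$3\theta_x(3\theta_x-2\theta_y)F-x(3\theta_x+2y+1)(3\theta_x+2)F-6x(2\theta_x+1)\bigl((1-4y)\theta_y+9y\theta_x\bigr)F=0,$$ $$\theta_y^2F-y(2\theta_y-3\theta_x)(2\theta_y-3\theta_x+1)F=0.$$ Precisely, call a point of $\mathbb H^2$ regular if $a(\tau_1)$, $a(\tau_2)$, $1+4t_1t_2(t_1+t_2)$ and $t_1+t_2-2t_1^2t_2^2$ do not vanish there. First, a dense set of regular points have an open neighbourhood $U$, consisting of regular points, which $(x,y)$ maps bijectively onto an open set $V\subset\mathbb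 C^2$ and on which some branch of $F$ equals $\Phi(x,y)$ with $\Phi$ holomorphic on $V$. Second, whenever $U\subset\mathbb H^2$ is an open set of regular points, $V\subset\mathbb C^2$ is an open set with $(x,y)(U)\subset V$, and $\Phi$ is a holomorphic function on $V$ such that $\Phi(x,y)$ is a branch of $F$ on $U$, the function $\Phi$ satisfies both equations at all points of $(x,y)(U)$. -/

import Mathlib

open scoped UpperHalfPlane MatrixGroups ModularForm Topology

noncomputable section

namespace Bimodular

/-! ### Holomorphic and meromorphic functions of two variables in the upper half plane -/

/-- `f` is (jointly) holomorphic on the open subset `U` of `ℍ × ℍ`, seen as a subset of `ℂ × ℂ`. -/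
def HolomorphicOn (f : ℍ × ℍ → ℂ) (U : Set (ℍ × ℍ)) : Prop :=
  DifferentiableOn ℂ
    (fun z : ℂ × ℂ => f (UpperHalfPlane.ofComplex z.1, UpperHalfPlane.ofComplex z.2))
    ((fun p : ℍ × ℍ => ((p.1 : ℂ), (p.2 : ℂ))) '' U)

/-- `f` is a meromorphic function on `ℍ × ℍ`: locally it is a quotient of two holomorphic
functions, whose denominator vanishes on no nonempty open set. As usual, the values of `f` at the
zeros of the denominators do not matter. -/
def IsMeromorphic (f : ℍ × ℍ → ℂ) : Prop :=
  ∀ p : ℍ × ℍ, ∃ (U : Set (ℍ × ℍ)) (g h : ℍ × ℍ → ℂ), IsOpen U ∧ p ∈ U ∧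
    HolomorphicOn g U ∧ HolomorphicOn h U ∧ interior {q | q ∈ U ∧ h q = 0} = ∅ ∧
    ∀ q ∈ U, h q ≠ 0 → f q = g q / h q

/-- Equality of meromorphic functions: agreement on a dense open set. -/
def MeroEq (f g : ℍ × ℍ → ℂ) : Prop :=
  ∃ U : Set (ℍ × ℍ), IsOpen U ∧ Dense U ∧ ∀ p ∈ U, f p = g p

/-- The meromorphic function `f` is meromorphic at all cusps with respect to the first variable:
for every `γ ∈ SL(2, ℤ)` and for all `τ₀` in a dense set, `f (γ τ₁, τ₂)` grows at most
exponentially in `Im τ₁`, uniformly for `τ₂` near `τ₀` (and outside of a nowhere dense set,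
on which the values of `f` do not matter). -/
def MeromorphicAtCuspsFst (f : ℍ × ℍ → ℂ) : Prop :=
  ∀ γ : SL(2, ℤ), Dense {τ₀ : ℍ | ∃ N ∈ 𝓝 τ₀, ∃ (C : ℝ) (D : Set (ℍ × ℍ)),
    IsOpen D ∧ Dense D ∧ ∀ p ∈ D, p.2 ∈ N → C ≤ p.1.im →
      ‖f (γ • p.1, p.2)‖ ≤ Real.exp (C * p.1.im)}

/-! ### Bimodular forms and bimodular functions -/

/-- The image in `SL(2, ℝ)` of a subgroup of `SL(2, ℤ)`. -/
def toReal (Γ : Subgroup SL(2, ℤ)) : Subgroup SL(2, ℝ) :=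
  Γ.map (Matrix.SpecialLinearGroup.map (Int.castRingHom ℝ))

/-- The normalizer `N(Γ)` of `Γ` in `SL(2, ℝ)`. -/
def normalizerReal (Γ : Subgroup SL(2, ℤ)) : Subgroup SL(2, ℝ) :=
  Subgroup.normalizer (toReal Γ : Set SL(2, ℝ))

/-- The pairs `(Γ, G)` that are allowed: `Γ` is a congruence subgroup and `Γ ≤ G ≤ N(Γ)`. -/
def IsPair (Γ : Subgroup SL(2, ℤ)) (G : Subgroup SL(2, ℝ)) : Prop :=
  CongruenceSubgroup.IsCongruenceSubgroup Γ ∧ toReal Γ ≤ G ∧ G ≤ normalizerReal Γ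

/-- The factor of automorphy `c τ + d` of a real matrix with rows `(a, b)` and `(c, d)`. -/
def autFactor (γ : SL(2, ℝ)) (τ : ℍ) : ℂ := ((γ 1 0 : ℝ) : ℂ) * (τ : ℂ) + ((γ 1 1 : ℝ) : ℂ)

/-- `F` is a bimodular form of weight `k` on `(Γ, G)` with characters `(χ₁, χ₂)`. -/
structure IsBimodularForm (k : ℤ) (Γ : Subgroup SL(2, ℤ)) (G : Subgroup SL(2, ℝ))
    (χ₁ : Γ →* ℂˣ) (χ₂ : G →* ℂˣ) (F : ℍ × ℍ → ℂ) : Prop where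
  pair : IsPair Γ G
  compat : ∀ (γ : Γ) (g : G),
    (g : SL(2, ℝ)) = Matrix.SpecialLinearGroup.map (Int.castRingHom ℝ) (γ : SL(2, ℤ)) →
      χ₂ g = χ₁ γ ^ 2
  holo : HolomorphicOn F Set.univ
  law_fst : ∀ (γ : Γ) (τ₁ τ₂ : ℍ), F ((γ : SL(2, ℤ)) • τ₁, τ₂) =
    (χ₁ γ : ℂ) * autFactor (Matrix.SpecialLinearGroup.map (Int.castRingHom ℝ) γ) τ₁ ^ k *
      F (τ₁, τ₂)
  law_snd : ∀ (γ : Γ) (τ₁ τ₂ : ℍ), F (τ₁, (γ : SL(2, ℤ)) • τ₂) =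
    (χ₁ γ : ℂ) * autFactor (Matrix.SpecialLinearGroup.map (Int.castRingHom ℝ) γ) τ₂ ^ k *
      F (τ₁, τ₂)
  cusps_fst : ∀ (γ : SL(2, ℤ)) (τ₂ : ℍ),
    UpperHalfPlane.IsBoundedAtImInfty ((fun τ₁ : ℍ => F (τ₁, τ₂)) ∣[k] γ)
  cusps_snd : ∀ (γ : SL(2, ℤ)) (τ₁ : ℍ),
    UpperHalfPlane.IsBoundedAtImInfty ((fun τ₂ : ℍ => F (τ₁, τ₂)) ∣[k] γ)
  law_diag : ∀ (g : G) (τ₁ τ₂ : ℍ), F ((g : SL(2, ℝ)) • τ₁, (g : SL(2, ℝ)) • τ₂) =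
    (χ₂ g : ℂ) * autFactor g τ₁ ^ k * autFactor g τ₂ ^ k * F (τ₁, τ₂)

/-- `f` is a bimodular function on `(Γ, G)`: a meromorphic function on `ℍ × ℍ`, meromorphic at the
cusps in each variable, that satisfies the transformation laws of weight `0` with trivial
characters, as identities between meromorphic functions. -/
structure IsBimodularFunction (Γ : Subgroup SL(2, ℤ)) (G : Subgroup SL(2, ℝ))
    (f : ℍ × ℍ → ℂ) : Prop where
  pair : IsPair Γ G
  mero : IsMeromorphic f
  cusps_fst : MeromorphicAtCuspsFst f
  cusps_snd : MeromorphicAtCuspsFst (fun p => f p.swap)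
  law_fst : ∀ γ ∈ Γ, MeroEq (fun p => f (γ • p.1, p.2)) f
  law_snd : ∀ γ ∈ Γ, MeroEq (fun p => f (p.1, γ • p.2)) f
  law_diag : ∀ g ∈ G, MeroEq (fun p => f (g • p.1, g • p.2)) f

/-! ### The cubic theta functions and the functions `x`, `y`, `F` -/

/-- `L(τ) = ∑_{m, n ∈ ℤ} q ^ (m² + m n + n²)` with `q = exp (2 π i τ)`. -/
def L (τ : ℂ) : ℂ :=
  ∑' v : ℤ × ℤ, Complex.exp (2 * Real.pi * Complex.I * τ *
    ((v.1 : ℂ) ^ 2 + (v.1 : ℂ) * (v.2 : ℂ) + (v.2 : ℂ) ^ 2))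

/-- The cubic theta function `a(τ)`. -/
def thetaA (τ : ℍ) : ℂ := L τ

/-- The cubic theta function `b(τ)`. -/
def thetaB (τ : ℍ) : ℂ := (3 * L (3 * (τ : ℂ)) - L τ) / 2

/-- `t = b / a`. -/
def t (τ : ℍ) : ℂ := thetaB τ / thetaA τ

/-- `t₁ + t₂ - 2 t₁² t₂²`. -/
def numP (p : ℍ × ℍ) : ℂ := t p.1 + t p.2 - 2 * t p.1 ^ 2 * t p.2 ^ 2

/-- `1 + 4 t₁ t₂ (t₁ + t₂)`. -/
def denQ (p : ℍ × ℍ) : ℂ := 1 + 4 * t p.1 * t p.2 * (t p.1 + t p.2)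

/-- The function `x(τ₁, τ₂)`. -/
def x (p : ℍ × ℍ) : ℂ := (numP p / denQ p) ^ 3

/-- The function `y(τ₁, τ₂)`. -/
def y (p : ℍ × ℍ) : ℂ :=
  t p.1 * t p.2 * (1 - t p.1 ^ 3) * (1 - t p.2 ^ 3) / numP p ^ 2

/-- The value `(1/3) w a(τ₁) a(τ₂)` of `F`, where `w` is a value of the square root of
`1 + 4 t₁ t₂ (t₁ + t₂)`. -/
def valF (w : ℂ) (p : ℍ × ℍ) : ℂ := 1 / 3 * w * thetaA p.1 * thetaA p.2

/-- The dense open set of all `(τ₁, τ₂)` at which no denominator in the definitions of `t₁`, `t₂`,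
`x`, `y` vanishes. -/
def regularSet : Set (ℍ × ℍ) :=
  {p | thetaA p.1 ≠ 0 ∧ thetaA p.2 ≠ 0 ∧ denQ p ≠ 0 ∧ numP p ≠ 0}

/-! ### The system of partial differential equations -/

/-- `θ_x = x ∂/∂x`. -/
def thetaX (Φ : ℂ × ℂ → ℂ) : ℂ × ℂ → ℂ := fun z => z.1 * deriv (fun u => Φ (u, z.2)) z.1

/-- `θ_y = y ∂/∂y`. -/
def thetaY (Φ : ℂ × ℂ → ℂ) : ℂ × ℂ → ℂ := fun z => z.2 * deriv (fun v => Φ (z.1, v)) z.2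

/-- The first equation at the point `z = (x, y)`:
`3 θ_x (3 θ_x - 2 θ_y) Φ - x (3 θ_x + 2 y + 1) (3 θ_x + 2) Φ
  - 6 x (2 θ_x + 1) ((1 - 4 y) θ_y + 9 y θ_x) Φ = 0`. -/
def SatisfiesPDE₁ (Φ : ℂ × ℂ → ℂ) (z : ℂ × ℂ) : Prop :=
  let A : ℂ × ℂ → ℂ := fun w => 3 * thetaX Φ w - 2 * thetaY Φ w
  let B : ℂ × ℂ → ℂ := fun w => 3 * thetaX Φ w + 2 * Φ w
  let C : ℂ × ℂ → ℂ := fun w => (1 - 4 * w.2) * thetaY Φ w + 9 * w.2 * thetaX Φ w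
  3 * thetaX A z - z.1 * (3 * thetaX B z + (2 * z.2 + 1) * B z)
    - 6 * z.1 * (2 * thetaX C z + C z) = 0

/-- The second equation at the point `z = (x, y)`:
`θ_y² Φ - y (2 θ_y - 3 θ_x) (2 θ_y - 3 θ_x + 1) Φ = 0`. -/
def SatisfiesPDE₂ (Φ : ℂ × ℂ → ℂ) (z : ℂ × ℂ) : Prop :=
  let A : ℂ × ℂ → ℂ := fun w => 2 * thetaY Φ w - 3 * thetaX Φ w + Φ w
  thetaY (thetaY Φ) z - z.2 * (2 * thetaY A z - 3 * thetaX A z) = 0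

/-- The holomorphic function `Φ` on the open set `V ⊆ ℂ²` expresses, on the open set `U ⊆ ℍ × ℍ`,
the branch of `F` given by the branch `w` of the square root as a function of `x` and `y`. -/
structure IsLocalExpression (U : Set (ℍ × ℍ)) (V : Set (ℂ × ℂ)) (w : ℍ × ℍ → ℂ)
    (Φ : ℂ × ℂ → ℂ) : Prop where
  isOpen_left : IsOpen U
  regular : U ⊆ regularSet
  isOpen_right : IsOpen V
  mapsTo : Set.MapsTo (fun p => (x p, y p)) U V
  sqrt : ∀ p ∈ U, w p ^ 2 = denQ p
  holo : DifferentiableOn ℂ Φ V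
  eq : ∀ p ∈ U, Φ (x p, y p) = valF (w p) p

end Bimodular

end

/-! The proof rests on one vector-valued modular form. Let `thP z = L z` and `thC z = (L (z/3) - L
z) / 2`. Splitting the hexagonal lattice into Jacobi theta series gives an inversion formula for
`L`, and sorting its vectors by norm modulo 3 gives its behaviour under a cubic translation.
Together they show that `(thP, thC)` transforms in weight one under SL(2,ℤ) by explicit 2×2 matrices
`matT`, `matS`. At `3τ`, the combinations `thP + 2 thC` and `thP - thC` are a and b.

Modularity. Homogenised in (a, b), the functions D = 1 + 4t₁t₂(t₁+t₂), N = t₁+t₂-2t₁²t₂² and E =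
t(1-t³) become polynomials in two theta vectors. Under the diagonal action of SL(2,ℤ), D is fixed, N
is multiplied by a cube root of unity c, and E(t₁)E(t₂) by c² (`exists_transforms`). Hence x =
(N/D)³, y = E(t₁)E(t₂)/N² and F² = D a₁²a₂²/9 are invariant or of weight two. The action on the
theta vector is ±1 on matrices that are diagonal modulo 3 (`transforms_of_modThree`). Conjugation by
the scaling τ ↦ 3τ sends Γ₀(9) into these matrices and its normalizer into SL(2,ℤ)
(`exists_isScaled_of_normalizer`), which gives both the separate and the diagonal laws.

Differential equations. There are no level-one cusp forms of weight below 12, so the Wronskian of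
the pair and Ramanujan's equation follow from limits at i∞ (`wronskian_eq`, `ramanujan`). In terms
of the derivation D₀ = (μa²)⁻¹ d/dτ they say D₀t = t(1-t³) and D₀²a = 2t³(1-t³)a (`hasDerivAt_tC`,
`hasDerivAt_alC`). With τ₂ frozen, F is a constant times √D · a, so it satisfies a second-order
equation in τ₁. The chain rule rewrites it as a combination of the two partial differential
equations with coefficients rational in t₁, t₂ (`combination_of_curve`). Exchanging the variables
gives a second combination. The 2×2 determinant is a nonzero polynomial in t₁, t₂, so both equations
hold on a dense set, and everywhere by continuity (`IsLocalExpression.pde`). Another nonzero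
polynomial is the essential factor of the Jacobian of (x, y), and the inverse function theorem then
provides the local coordinates. -/

noncomputable section

namespace Bimodular

open Complex Filter

/-! ### The function `L` in terms of Jacobi theta functions -/

/-- `∑ exp (π i (n + 1/2) ^ 2 τ)`. -/
def shiftTheta (τ : ℂ) : ℂ := cexp (Real.pi * I * τ / 4) * jacobiTheta₂ (τ / 2) τ

lemma hasSum_of_eq {ι : Type*} {f g : ι → ℂ} {a : ℂ} (h : HasSum g a) (e : ∀ i, f i = g i) :
    HasSum f a := by
  rwa [show f = g from funext e]

lemma hasSum_mul_prod {f g : ℤ → ℂ} {a b : ℂ} (hf : HasSum f a) (hg : HasSum g b) :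
    HasSum (fun v : ℤ × ℤ => f v.1 * g v.2) (a * b) :=
  HasSum.mul hf hg (summable_mul_of_summable_norm hf.summable.norm hg.summable.norm)

lemma hasSum_shiftTheta {τ : ℂ} (hτ : 0 < τ.im) :
    HasSum (fun n : ℤ => cexp (Real.pi * I * ((n : ℂ) + 1 / 2) ^ 2 * τ)) (shiftTheta τ) := by
  refine hasSum_of_eq ((hasSum_jacobiTheta₂_term (τ / 2) hτ).mul_left (cexp (Real.pi * I * τ / 4)))
    fun n => ?_
  rw [jacobiTheta₂_term, ← Complex.exp_add]
  congr 1
  ring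

lemma hasSum_jacobiTheta₂_zero {τ : ℂ} (hτ : 0 < τ.im) :
    HasSum (fun n : ℤ => cexp (Real.pi * I * (n : ℂ) ^ 2 * τ)) (jacobiTheta₂ 0 τ) := by
  convert (hasSum_jacobiTheta₂_term 0 hτ) using 2 with n
  rw [jacobiTheta₂_term]
  congr 1
  ring

lemma hasSum_jacobiTheta₂_half {τ : ℂ} (hτ : 0 < τ.im) :
    HasSum (fun n : ℤ => cexp (Real.pi * I * n) * cexp (Real.pi * I * (n : ℂ) ^ 2 * τ))
      (jacobiTheta₂ (1 / 2) τ) := by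
  convert (hasSum_jacobiTheta₂_term (1 / 2) hτ) using 2 with n
  rw [jacobiTheta₂_term, ← Complex.exp_add]
  congr 1
  ring

lemma hasSum_int_of_even_odd {f : ℤ → ℂ} {a b : ℂ} (he : HasSum (fun n => f (2 * n)) a)
    (ho : HasSum (fun n => f (2 * n + 1)) b) : HasSum f (a + b) := by
  have hb : Function.Bijective (Sum.elim (fun n : ℤ => 2 * n) (fun n : ℤ => 2 * n + 1)) := by
    constructor
    · rintro (m | m) (n | n) h <;> simp only [Sum.elim_inl, Sum.elim_inr] at h <;>
        first | omega | (congr 1; omega)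
    · intro n
      rcases Int.even_or_odd' n with ⟨k, rfl | rfl⟩
      · exact ⟨Sum.inl k, rfl⟩
      · exact ⟨Sum.inr k, rfl⟩
  rw [← (Equiv.ofBijective _ hb).hasSum_iff]
  exact HasSum.sum he ho

lemma cexp_pi_I_even (n : ℤ) : cexp (Real.pi * I * ((2 * n : ℤ) : ℂ)) = 1 := by
  rw [Complex.exp_eq_one_iff]
  exact ⟨n, by push_cast; ring⟩

lemma cexp_pi_I_odd (n : ℤ) : cexp (Real.pi * I * ((2 * n + 1 : ℤ) : ℂ)) = -1 := by
  have : (Real.pi * I * ((2 * n + 1 : ℤ) : ℂ)) = Real.pi * I * ((2 * n : ℤ) : ℂ) + Real.pi * I := by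
    push_cast; ring
  rw [this, Complex.exp_add, cexp_pi_I_even, Complex.exp_pi_mul_I, one_mul]

lemma four_mul_im {τ : ℂ} (hτ : 0 < τ.im) : 0 < (4 * τ).im := by
  simpa using hτ

/-- The terms with n even and n odd. With its analogue for the half characteristic, this brings the
theta values produced by inversion, at `τ/2` and `3τ/2`, back to the arguments `2τ` and `6τ` at
which `L` is expanded. -/
lemma jacobiTheta₂_zero_split {τ : ℂ} (hτ : 0 < τ.im) :
    jacobiTheta₂ 0 τ = jacobiTheta₂ 0 (4 * τ) + shiftTheta (4 * τ) := by
  refine (hasSum_jacobiTheta₂_zero hτ).unique (hasSum_int_of_even_odd ?_ ?_)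
  · convert hasSum_jacobiTheta₂_zero (four_mul_im hτ) using 2 with n
    congr 1; push_cast; ring
  · convert hasSum_shiftTheta (four_mul_im hτ) using 2 with n
    congr 1; push_cast; ring

lemma jacobiTheta₂_half_split {τ : ℂ} (hτ : 0 < τ.im) :
    jacobiTheta₂ (1 / 2) τ = jacobiTheta₂ 0 (4 * τ) - shiftTheta (4 * τ) := by
  rw [sub_eq_add_neg]
  refine (hasSum_jacobiTheta₂_half hτ).unique (hasSum_int_of_even_odd ?_ ?_)
  · convert hasSum_jacobiTheta₂_zero (four_mul_im hτ) using 2 with n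
    rw [cexp_pi_I_even, one_mul]
    congr 1; push_cast; ring
  · refine hasSum_of_eq (hasSum_shiftTheta (four_mul_im hτ)).neg fun n => ?_
    rw [cexp_pi_I_odd, neg_one_mul]
    congr 2; push_cast; ring

/-- The term of the lattice sum `L`. -/
def latticeTerm (τ : ℂ) (v : ℤ × ℤ) : ℂ :=
  cexp (2 * Real.pi * I * τ * ((v.1 : ℂ) ^ 2 + (v.1 : ℂ) * (v.2 : ℂ) + (v.2 : ℂ) ^ 2))

/-- Completing the square according to the parity of n: m² + mn + n² equals p² + 3k² for n = 2k and
(p + 1/2)² + 3(k + 1/2)² for n = 2k + 1, where p = m + k. Each parity class is then a product of two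
one-dimensional theta series. -/
lemma hasSum_latticeTerm {τ : ℂ} (hτ : 0 < τ.im) :
    HasSum (latticeTerm τ) (jacobiTheta₂ 0 (2 * τ) * jacobiTheta₂ 0 (6 * τ) +
      shiftTheta (2 * τ) * shiftTheta (6 * τ)) := by
  have h2 : 0 < (2 * τ).im := by simpa using hτ
  have h6 : 0 < (6 * τ).im := by simpa using hτ
  have hb : Function.Bijective (Sum.elim (fun v : ℤ × ℤ => (v.1 - v.2, 2 * v.2))
      (fun v : ℤ × ℤ => (v.1 - v.2, 2 * v.2 + 1))) := by
    constructor
    · rintro (⟨m, m'⟩ | ⟨m, m'⟩) (⟨n, n'⟩ | ⟨n, n'⟩) h <;>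
        simp only [Sum.elim_inl, Sum.elim_inr, Prod.mk.injEq] at h <;>
        congr 2 <;> omega
    · rintro ⟨m, n⟩
      rcases Int.even_or_odd' n with ⟨k, rfl | rfl⟩
      · exact ⟨Sum.inl (m + k, k), by simp⟩
      · exact ⟨Sum.inr (m + k, k), by simp⟩
  rw [← (Equiv.ofBijective _ hb).hasSum_iff]
  refine HasSum.sum ?_ ?_
  · have hA := hasSum_jacobiTheta₂_zero h2
    have hB := hasSum_jacobiTheta₂_zero h6
    refine hasSum_of_eq (hasSum_mul_prod hA hB) fun v => ?_
    simp only [Function.comp_apply, Equiv.ofBijective_apply, Sum.elim_inl, latticeTerm]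
    rw [← Complex.exp_add]
    congr 1; push_cast; ring
  · have hA := hasSum_shiftTheta h2
    have hB := hasSum_shiftTheta h6
    refine hasSum_of_eq (hasSum_mul_prod hA hB) fun v => ?_
    simp only [Function.comp_apply, Equiv.ofBijective_apply, Sum.elim_inr, latticeTerm]
    rw [← Complex.exp_add]
    congr 1; push_cast; ring

lemma L_eq {τ : ℂ} (hτ : 0 < τ.im) : L τ = jacobiTheta₂ 0 (2 * τ) * jacobiTheta₂ 0 (6 * τ) +
    shiftTheta (2 * τ) * shiftTheta (6 * τ) := (hasSum_latticeTerm hτ).tsum_eq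

lemma differentiableAt_shiftTheta {τ : ℂ} (hτ : 0 < τ.im) : DifferentiableAt ℂ shiftTheta τ := by
  have h := (hasFDerivAt_jacobiTheta₂ (τ / 2) hτ).differentiableAt
  have h2 : DifferentiableAt ℂ (fun s : ℂ => (s / 2, s)) τ := by fun_prop
  have h3 : DifferentiableAt ℂ (fun s : ℂ => jacobiTheta₂ (s / 2) s) τ :=
    DifferentiableAt.comp (f := fun s : ℂ => (s / 2, s))
      (g := fun p : ℂ × ℂ => jacobiTheta₂ p.1 p.2) τ h h2
  unfold shiftTheta
  fun_prop

lemma differentiableAt_L {τ : ℂ} (hτ : 0 < τ.im) : DifferentiableAt ℂ L τ := by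
  have h2 : 0 < (2 * τ).im := by simpa using hτ
  have h6 : 0 < (6 * τ).im := by simpa using hτ
  have e : L =ᶠ[𝓝 τ] fun τ => jacobiTheta₂ 0 (2 * τ) * jacobiTheta₂ 0 (6 * τ) +
      shiftTheta (2 * τ) * shiftTheta (6 * τ) := by
    filter_upwards [(isOpen_lt continuous_const Complex.continuous_im).mem_nhds hτ] with s hs
    exact L_eq hs
  refine DifferentiableAt.congr_of_eventuallyEq ?_ e
  have d2 : DifferentiableAt ℂ (fun s : ℂ => 2 * s) τ := by fun_prop
  have d6 : DifferentiableAt ℂ (fun s : ℂ => 6 * s) τ := by fun_prop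
  exact (((differentiableAt_jacobiTheta₂_snd 0 h2).comp τ d2).mul
    ((differentiableAt_jacobiTheta₂_snd 0 h6).comp τ d6)).add
    (((differentiableAt_shiftTheta h2).comp τ d2).mul ((differentiableAt_shiftTheta h6).comp τ d6))

lemma neg_inv_im_pos {τ : ℂ} (hτ : 0 < τ.im) : 0 < (-1 / τ).im := by
  rw [neg_div, neg_im, one_div, inv_im]
  have : τ ≠ 0 := by rintro rfl; simp at hτ
  have := Complex.normSq_pos.mpr this
  rw [neg_div, neg_neg]
  positivity

lemma cpow_half_ne_zero {τ : ℂ} (hτ : 0 < τ.im) : (-I * τ) ^ (1 / 2 : ℂ) ≠ 0 := by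
  have : τ ≠ 0 := by rintro rfl; simp at hτ
  rw [Ne, Complex.cpow_eq_zero_iff]
  simp [this]

lemma jacobiTheta₂_zero_neg_inv {τ : ℂ} (hτ : 0 < τ.im) :
    jacobiTheta₂ 0 (-1 / τ) = (-I * τ) ^ (1 / 2 : ℂ) * jacobiTheta₂ 0 τ := by
  rw [jacobiTheta₂_functional_equation 0 τ]
  have := cpow_half_ne_zero hτ
  simp only [zero_div, ne_eq, OfNat.ofNat_ne_zero, not_false_eq_true, zero_pow, mul_zero,
    Complex.exp_zero, mul_one]
  rw [← mul_assoc, mul_one_div_cancel this, one_mul]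

lemma shiftTheta_neg_inv {τ : ℂ} (hτ : 0 < τ.im) :
    shiftTheta (-1 / τ) = (-I * τ) ^ (1 / 2 : ℂ) * jacobiTheta₂ (1 / 2) τ := by
  rw [jacobiTheta₂_functional_equation (1 / 2) τ, shiftTheta]
  have := cpow_half_ne_zero hτ
  have h0 : τ ≠ 0 := by rintro rfl; simp at hτ
  rw [show -1 / τ / 2 = -(1 / 2 / τ) by field_simp, jacobiTheta₂_neg_left,
    show (Real.pi : ℂ) * I * (-1 / τ) / 4 = -Real.pi * I * (1 / 2) ^ 2 / τ by field_simp; norm_num]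
  field_simp

/-- A positive real factor splits off the principal logarithm, so the two square-root factors from
the Jacobi inversion multiply without any branch ambiguity. -/
lemma three_mul_cpow_half {y : ℂ} (hy : y ≠ 0) :
    (3 * y) ^ (1 / 2 : ℂ) * y ^ (1 / 2 : ℂ) = (Real.sqrt 3 : ℝ) * y := by
  have h3 : (3 * y) ^ (1 / 2 : ℂ) = (Real.sqrt 3 : ℝ) * y ^ (1 / 2 : ℂ) := by
    have : (3 : ℂ) * y ≠ 0 := mul_ne_zero (by norm_num) hy
    rw [Complex.cpow_def_of_ne_zero this, Complex.cpow_def_of_ne_zero hy,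
      show (3 : ℂ) * y = ((3 : ℝ) : ℂ) * y by norm_num, Complex.log_ofReal_mul (by norm_num) hy,
      add_mul, Complex.exp_add, Real.sqrt_eq_rpow, Real.rpow_def_of_pos (by norm_num)]
    push_cast
    rfl
  rw [h3, mul_assoc, ← Complex.cpow_add _ _ hy]
  norm_num

/-- The functional equation of `L`. -/
lemma L_neg_inv {τ : ℂ} (hτ : 0 < τ.im) :
    L (-1 / (3 * τ)) = -I * (Real.sqrt 3 : ℝ) * τ * L τ := by
  have h0 : τ ≠ 0 := by rintro rfl; simp at hτ
  have h1 : 0 < (3 * τ).im := by simpa using hτ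
  have hs1 : 0 < (3 * (τ / 2)).im := by
    rw [show 3 * (τ / 2) = ((3 / 2 : ℝ) : ℂ) * τ by push_cast; ring, Complex.im_ofReal_mul]
    positivity
  have hs2 : 0 < (τ / 2).im := by
    rw [show (τ / 2) = ((1 / 2 : ℝ) : ℂ) * τ by push_cast; ring, Complex.im_ofReal_mul]
    positivity
  rw [L_eq (neg_inv_im_pos h1), L_eq hτ,
    show 2 * (-1 / (3 * τ)) = -1 / (3 * (τ / 2)) by field_simp,
    show 6 * (-1 / (3 * τ)) = -1 / (τ / 2) by field_simp; norm_num,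
    jacobiTheta₂_zero_neg_inv hs1, jacobiTheta₂_zero_neg_inv hs2, shiftTheta_neg_inv hs1,
    shiftTheta_neg_inv hs2, jacobiTheta₂_zero_split hs1, jacobiTheta₂_zero_split hs2,
    jacobiTheta₂_half_split hs1, jacobiTheta₂_half_split hs2]
  have key := three_mul_cpow_half (y := -I * (τ / 2)) (by simp [h0])
  rw [show 3 * (-I * (τ / 2)) = -I * (3 * (τ / 2)) by ring] at key
  rw [show 4 * (3 * (τ / 2)) = 6 * τ by ring, show 4 * (τ / 2) = 2 * τ by ring]
  -- The algebra is (A+B)(C+D) + (A-B)(C-D) = 2(AC+BD), which reproduces the shape of `L`.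
  linear_combination 2 * (jacobiTheta₂ 0 (2 * τ) * jacobiTheta₂ 0 (6 * τ) +
    shiftTheta (2 * τ) * shiftTheta (6 * τ)) * key

/-- The primitive cube root of unity. -/
def omega : ℂ := cexp (2 * Real.pi * I / 3)

lemma omega_pow_three : omega ^ 3 = 1 := by
  rw [omega, ← Complex.exp_nat_mul, ← Complex.exp_two_pi_mul_I]
  congr 1; push_cast; ring

lemma one_add_two_omega : 1 + 2 * omega = I * (Real.sqrt 3 : ℝ) := by
  rw [omega, show 2 * (Real.pi : ℂ) * I / 3 = ((Real.pi - Real.pi / 3 : ℝ) : ℂ) * I by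
    push_cast; ring, Complex.exp_mul_I, ← Complex.ofReal_cos, ← Complex.ofReal_sin,
    Real.cos_pi_sub, Real.sin_pi_sub, Real.cos_pi_div_three, Real.sin_pi_div_three]
  push_cast
  ring

lemma sqrt_three_sq : ((Real.sqrt 3 : ℝ) : ℂ) ^ 2 = 3 := by
  rw [← Complex.ofReal_pow, Real.sq_sqrt (by norm_num)]; norm_num

lemma omega_quadratic : omega ^ 2 + omega + 1 = 0 := by
  have h := one_add_two_omega
  have h2 : (1 + 2 * omega) ^ 2 = -3 := by
    rw [h, mul_pow, I_sq, sqrt_three_sq]; norm_num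
  linear_combination h2 / 4

lemma L_add_one (τ : ℂ) : L (τ + 1) = L τ := by
  refine tsum_congr fun v => ?_
  rw [show 2 * (Real.pi : ℂ) * I * (τ + 1) *
      ((v.1 : ℂ) ^ 2 + (v.1 : ℂ) * (v.2 : ℂ) + (v.2 : ℂ) ^ 2) =
    2 * (Real.pi : ℂ) * I * τ * ((v.1 : ℂ) ^ 2 + (v.1 : ℂ) * (v.2 : ℂ) + (v.2 : ℂ) ^ 2) +
      ((v.1 ^ 2 + v.1 * v.2 + v.2 ^ 2 : ℤ) : ℂ) * (2 * Real.pi * I) by push_cast; ring,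
    Complex.exp_add, Complex.exp_int_mul_two_pi_mul_I, mul_one]

lemma cexp_third (n : ℤ) : cexp (2 * Real.pi * I * (1 / 3) * (n : ℂ)) = omega ^ n := by
  rw [omega, ← Complex.exp_int_mul]
  congr 1; ring

lemma omega_ne_zero : omega ≠ 0 := Complex.exp_ne_zero _

/-- Modulo 3 the norm form is (m - n)², hence 0 or 1. -/
lemma omega_zpow_norm (m n : ℤ) : omega ^ (m ^ 2 + m * n + n ^ 2) =
    omega + (1 - omega) * (if 3 ∣ m - n then 1 else 0) := by
  have h3 (k : ℤ) : omega ^ (3 * k) = 1 := by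
    rw [zpow_mul]
    have : omega ^ (3 : ℤ) = 1 := by exact_mod_cast omega_pow_three
    rw [this, one_zpow]
  split_ifs with h
  · obtain ⟨k, hk⟩ := h
    rw [show m ^ 2 + m * n + n ^ 2 = 3 * (3 * k ^ 2 + 3 * k * n + n ^ 2) by
      rw [show m = n + 3 * k by linarith]; ring, h3]
    ring
  · have : ∃ k, m - n = 3 * k + 1 ∨ m - n = 3 * k + 2 := ⟨(m - n) / 3, by omega⟩
    obtain ⟨k, hk | hk⟩ := this
    · rw [show m ^ 2 + m * n + n ^ 2 = 3 * (3 * k ^ 2 + 3 * k * n + n ^ 2 + 2 * k + n) + 1 by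
        rw [show m = n + 3 * k + 1 by linarith]; ring, zpow_add₀ omega_ne_zero, h3]
      simp
    · rw [show m ^ 2 + m * n + n ^ 2 = 3 * (3 * k ^ 2 + 3 * k * n + n ^ 2 + 4 * k + 2 * n + 1) + 1 by
        rw [show m = n + 3 * k + 2 by linarith]; ring, zpow_add₀ omega_ne_zero, h3]
      simp

lemma third_im {τ : ℂ} (hτ : 0 < τ.im) : 0 < (τ / 3).im := by
  rw [show (τ / 3) = ((1 / 3 : ℝ) : ℂ) * τ by push_cast; ring, Complex.im_ofReal_mul]
  positivity

/-- The sum over the sublattice of index three. -/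
lemma tsum_sublattice (τ : ℂ) :
    ∑' v : ℤ × ℤ, (if 3 ∣ v.1 - v.2 then latticeTerm (τ / 3) v else 0) = L τ := by
  -- This map multiplies the norm form by 3, and its image is exactly the sublattice 3 ∣ m - n.
  have hinj : Function.Injective (fun v : ℤ × ℤ => (v.1 + 2 * v.2, v.1 - v.2)) := by
    rintro ⟨a, b⟩ ⟨c, d⟩ h
    simp only [Prod.mk.injEq] at h ⊢
    omega
  rw [← hinj.tsum_eq]
  · refine tsum_congr fun v => ?_
    rw [if_pos ⟨v.2, by ring⟩, latticeTerm]
    congr 1; push_cast; ring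
  · intro v hv
    have : 3 ∣ v.1 - v.2 := by
      by_contra h
      simp [h] at hv
    obtain ⟨k, hk⟩ := this
    exact ⟨(v.2 + k, k), by ext <;> simp; linarith⟩

/-- The translation multiplies a vector's term by ω to the power of its norm: by 1 on the sublattice
3 ∣ m - n, whose sum at `τ/3` is `L τ`, and by ω off it. -/
lemma L_add_one_div_three {τ : ℂ} (hτ : 0 < τ.im) :
    L ((τ + 1) / 3) = omega * L (τ / 3) + (1 - omega) * L τ := by
  have hs := (hasSum_latticeTerm (third_im hτ)).summable
  have hs' : Summable (fun v : ℤ × ℤ => if 3 ∣ v.1 - v.2 then latticeTerm (τ / 3) v else 0) :=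
    hs.indicator {v : ℤ × ℤ | 3 ∣ v.1 - v.2} |>.congr fun v => by
      simp [Set.indicator_apply]
  rw [← tsum_sublattice τ, ← tsum_mul_left]
  change _ = omega * ∑' v, latticeTerm (τ / 3) v + _
  rw [← tsum_mul_left, ← (hs.mul_left _).tsum_add (hs'.mul_left _)]
  refine tsum_congr fun v => ?_
  rw [show 2 * (Real.pi : ℂ) * I * ((τ + 1) / 3) *
      ((v.1 : ℂ) ^ 2 + (v.1 : ℂ) * (v.2 : ℂ) + (v.2 : ℂ) ^ 2) =
    2 * (Real.pi : ℂ) * I * (1 / 3) * ((v.1 ^ 2 + v.1 * v.2 + v.2 ^ 2 : ℤ) : ℂ) +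
    2 * (Real.pi : ℂ) * I * (τ / 3) * ((v.1 : ℂ) ^ 2 + (v.1 : ℂ) * (v.2 : ℂ) + (v.2 : ℂ) ^ 2) by
      push_cast; ring, Complex.exp_add, cexp_third, omega_zpow_norm]
  split_ifs
  · simp only [latticeTerm]; ring
  · simp only [latticeTerm]; ring

end Bimodular

end

/-! ### Expansions at i∞ and rigidity of level-one forms -/

noncomputable section

namespace Bimodular

open Complex Filter

/-! ### Asymptotics at the cusp `i ∞` -/

/-- The filter of neighbourhoods of `i ∞` in the complex plane. -/
abbrev cuspFilter : Filter ℂ := comap Complex.im atTop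

lemma eventually_im_gt (c : ℝ) : ∀ᶠ z in cuspFilter, c < z.im :=
  tendsto_comap.eventually (eventually_gt_atTop c)

lemma tendsto_cexp_cuspFilter {c : ℝ} (hc : 0 < c) :
    Tendsto (fun z : ℂ => cexp (2 * Real.pi * I * z * c)) cuspFilter (𝓝 0) := by
  rw [tendsto_zero_iff_norm_tendsto_zero]
  have h : (fun z : ℂ => ‖cexp (2 * Real.pi * I * z * c)‖) =
      fun z : ℂ => Real.exp (-((2 * Real.pi * c) * z.im)) := by
    ext z
    rw [Complex.norm_exp]
    congr 1
    simp
    ring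
  rw [h]
  refine Real.tendsto_exp_neg_atTop_nhds_zero.comp ?_
  exact (tendsto_comap (f := Complex.im)).const_mul_atTop (by positivity)

lemma latticeNorm_pos {v : ℤ × ℤ} (hv : v ≠ 0) : 1 ≤ v.1 ^ 2 + v.1 * v.2 + v.2 ^ 2 := by
  by_contra! h
  have h2 : v.2 = 0 := by
    by_contra h2
    have : 0 < v.2 ^ 2 := by positivity
    nlinarith [sq_nonneg (2 * v.1 + v.2)]
  have h1 : v.1 = 0 := by
    by_contra h1
    have : 0 < v.1 ^ 2 := by positivity
    nlinarith [sq_nonneg (2 * v.2 + v.1)]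
  exact hv (Prod.ext h1 h2)

lemma norm_cexp_mul_int (τ : ℂ) (n : ℤ) :
    ‖cexp (2 * Real.pi * I * τ * n)‖ = Real.exp (-(2 * Real.pi * τ.im * n)) := by
  rw [Complex.norm_exp]
  congr 1
  simp [Complex.mul_re]

lemma latticeTerm_eq (τ : ℂ) (v : ℤ × ℤ) :
    latticeTerm τ v = cexp (2 * Real.pi * I * τ * ((v.1 ^ 2 + v.1 * v.2 + v.2 ^ 2 : ℤ) : ℂ)) := by
  rw [latticeTerm]; push_cast; rfl

lemma L_sub_one_div {τ : ℂ} (hτ : 0 < τ.im) :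
    (L τ - 1) / cexp (2 * Real.pi * I * τ) = ∑' v : ℤ × ℤ, if v = 0 then 0 else
      cexp (2 * Real.pi * I * τ * ((v.1 ^ 2 + v.1 * v.2 + v.2 ^ 2 - 1 : ℤ) : ℂ)) := by
  have h := (hasSum_latticeTerm hτ).summable.tsum_eq_add_tsum_ite 0
  have h0 : latticeTerm τ 0 = 1 := by simp [latticeTerm]
  rw [h0] at h
  rw [show L τ = ∑' v, latticeTerm τ v from rfl, h, add_sub_cancel_left, ← tsum_div_const]
  refine tsum_congr fun v => ?_
  split_ifs
  · simp
  · rw [latticeTerm_eq, ← Complex.exp_sub]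
    congr 1; push_cast; ring

/-- The vectors of minimal norm. -/
lemma latticeNorm_eq_one_iff (v : ℤ × ℤ) : v.1 ^ 2 + v.1 * v.2 + v.2 ^ 2 = 1 ↔
    v ∈ ({(1, 0), (-1, 0), (0, 1), (0, -1), (1, -1), (-1, 1)} : Finset (ℤ × ℤ)) := by
  obtain ⟨a, b⟩ := v
  constructor
  · intro h
    simp only at h
    have ha : -1 ≤ a ∧ a ≤ 1 := by
      constructor <;> nlinarith [sq_nonneg (2 * b + a)]
    have hb : -1 ≤ b ∧ b ≤ 1 := by
      constructor <;> nlinarith [sq_nonneg (2 * a + b)]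
    obtain ⟨h1, h2⟩ := ha
    obtain ⟨h3, h4⟩ := hb
    interval_cases a <;> interval_cases b <;> simp_all
  · intro h
    simp only [Finset.mem_insert, Finset.mem_singleton, Prod.mk.injEq] at h
    rcases h with ⟨rfl, rfl⟩ | ⟨rfl, rfl⟩ | ⟨rfl, rfl⟩ | ⟨rfl, rfl⟩ | ⟨rfl, rfl⟩ | ⟨rfl, rfl⟩ <;>
      norm_num

/-- After division by q, only the six vectors of norm one survive in the limit. -/
lemma tendsto_L_sub_one_div :
    Tendsto (fun τ => (L τ - 1) / cexp (2 * Real.pi * I * τ)) cuspFilter (𝓝 6) := by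
  have hsum : (∑' v : ℤ × ℤ, if v.1 ^ 2 + v.1 * v.2 + v.2 ^ 2 = 1 then (1 : ℂ) else 0) = 6 := by
    simp_rw [latticeNorm_eq_one_iff]
    rw [tsum_eq_sum (s := {(1, 0), (-1, 0), (0, 1), (0, -1), (1, -1), (-1, 1)})]
    · rw [Finset.sum_congr rfl (g := fun _ => (1 : ℂ)) fun v hv => if_pos hv]
      simp
    · intro v hv
      rw [if_neg hv]
  rw [← hsum]
  have hI : 0 < (I : ℂ).im := by simp
  have hlim := tendsto_tsum_of_dominated_convergence (𝓕 := cuspFilter)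
    (f := fun (τ : ℂ) (v : ℤ × ℤ) => if v = 0 then 0 else
      cexp (2 * Real.pi * I * τ * ((v.1 ^ 2 + v.1 * v.2 + v.2 ^ 2 - 1 : ℤ) : ℂ)))
    (g := fun v : ℤ × ℤ => if v.1 ^ 2 + v.1 * v.2 + v.2 ^ 2 = 1 then (1 : ℂ) else 0)
    -- For Im τ > 1 each term is at most its value at τ = i; the factor exp(2π) accounts for the
    -- division by q.
    (bound := fun v => Real.exp (2 * Real.pi) * ‖latticeTerm I v‖)
    ((hasSum_latticeTerm hI).summable.norm.mul_left _) ?_ ?_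
  · refine hlim.congr' ?_
    filter_upwards [eventually_im_gt 0] with τ hτ
    exact (L_sub_one_div hτ).symm
  · intro v
    by_cases h0 : v = 0
    · subst h0; simpa using tendsto_const_nhds
    simp only [h0, if_false]
    split_ifs with h1
    · rw [h1]; simpa using tendsto_const_nhds
    · have : 1 < v.1 ^ 2 + v.1 * v.2 + v.2 ^ 2 := lt_of_le_of_ne (latticeNorm_pos h0) (Ne.symm h1)
      have hc : (0 : ℝ) < ((v.1 ^ 2 + v.1 * v.2 + v.2 ^ 2 - 1 : ℤ) : ℝ) := by
        exact_mod_cast sub_pos.mpr this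
      simpa using tendsto_cexp_cuspFilter hc
  · filter_upwards [eventually_im_gt 1] with τ hτ v
    split_ifs with h0
    · rw [norm_zero]; positivity
    · rw [latticeTerm_eq, norm_cexp_mul_int, norm_cexp_mul_int, ← Real.exp_add]
      apply Real.exp_le_exp.mpr
      have h1 : (0 : ℝ) ≤ ((v.1 ^ 2 + v.1 * v.2 + v.2 ^ 2 - 1 : ℤ) : ℝ) := by
        exact_mod_cast sub_nonneg.mpr (latticeNorm_pos h0)
      have hp := Real.pi_pos
      have h2 : 0 ≤ (2 * Real.pi * (τ.im - 1)) * ((v.1 ^ 2 + v.1 * v.2 + v.2 ^ 2 - 1 : ℤ) : ℝ) :=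
        mul_nonneg (by nlinarith) h1
      push_cast at h1 h2 ⊢
      simp only [Complex.I_im]
      nlinarith

/-- Cauchy's estimate on unit discs, which lie high in the half plane when their centres do. -/
lemma tendsto_deriv_cuspFilter {f : ℂ → ℂ} {c : ℂ}
    (hf : ∀ z : ℂ, 0 < z.im → DifferentiableAt ℂ f z) (hlim : Tendsto f cuspFilter (𝓝 c)) :
    Tendsto (deriv f) cuspFilter (𝓝 0) := by
  rw [Metric.tendsto_nhds]
  intro ε hε
  have h := Metric.tendsto_nhds.mp hlim (ε / 2) (by positivity)
  rw [eventually_comap, eventually_atTop] at h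
  obtain ⟨K, hK⟩ := h
  filter_upwards [eventually_im_gt (max K 0 + 1)] with z hz
  have him : ∀ w ∈ Metric.closedBall z 1, max K 0 < w.im := by
    intro w hw
    have h1 := Complex.abs_im_le_norm (w - z)
    rw [Metric.mem_closedBall, dist_eq_norm] at hw
    have := abs_le.mp (h1.trans hw)
    simp only [Complex.sub_im] at this
    linarith [this.1]
  have hd : DifferentiableOn ℂ (fun w => f w - c) (Metric.closedBall z 1) := fun w hw =>
    ((hf w ((le_max_right _ _).trans_lt (him w hw))).sub_const c).differentiableWithinAt
  have hle := Complex.norm_deriv_le_of_forall_mem_sphere_norm_le (f := fun w => f w - c)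
    (C := ε / 2) zero_lt_one (hd.diffContOnCl_ball subset_rfl) ?_
  · rw [deriv_sub_const] at hle
    rw [dist_zero_right]
    linarith
  · intro w hw
    have := hK w.im ((le_max_left _ _).trans (him w (Metric.sphere_subset_closedBall hw)).le) w rfl
    rw [dist_eq_norm] at this
    exact this.le

/-! ### Cusp forms of level one as functions on the complex plane -/

-- S and T generate SL(2,ℤ), and in level one the limit at i∞ controls every cusp.
open UpperHalfPlane ModularGroup in
lemma exists_cuspForm {f : ℂ → ℂ} {k : ℤ} (hd : ∀ z : ℂ, 0 < z.im → DifferentiableAt ℂ f z)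
    (hT : ∀ z : ℂ, 0 < z.im → f (z + 1) = f z)
    (hS : ∀ z : ℂ, 0 < z.im → f (-1 / z) = z ^ k * f z) (h0 : Tendsto f cuspFilter (𝓝 0)) :
    ∃ F : CuspForm 𝒮ℒ k, ∀ τ : ℍ, F τ = f τ := by
  have hslash : ∀ γ : SL(2, ℤ), (fun τ : ℍ => f τ) ∣[k] γ = fun τ : ℍ => f τ := by
    refine SlashInvariantForm.slash_action_generators_SL2Z ?_ ?_
    · ext τ
      rw [ModularForm.SL_slash_apply, denom_S, modular_S_smul]
      have h := hS τ τ.im_pos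
      have e : (-(τ : ℂ))⁻¹ = -1 / (τ : ℂ) := by rw [inv_neg, neg_div, one_div]
      change f (-(τ : ℂ))⁻¹ * _ = _
      rw [e, h, mul_comm, ← mul_assoc, ← zpow_add₀ τ.ne_zero, neg_add_cancel, zpow_zero, one_mul]
    · ext τ
      rw [ModularForm.SL_slash_apply, modular_T_smul]
      have e : (((1 : ℝ) +ᵥ τ : ℍ) : ℂ) = (τ : ℂ) + 1 := by
        rw [UpperHalfPlane.coe_vadd]; push_cast; ring
      simp only [e, hT τ τ.im_pos]
      have hden : UpperHalfPlane.denom (ModularGroup.T : GL (Fin 2) ℝ) τ = 1 := by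
        rw [ModularGroup.denom_apply]
        simp [ModularGroup.T]
      rw [hden, one_zpow, mul_one]
  refine ⟨{ toFun := fun τ : ℍ => f τ
            slash_action_eq' := ?_
            holo' := ?_
            zero_at_cusps' := ?_ }, fun τ => rfl⟩
  · rintro _ ⟨γ, rfl⟩
    exact hslash γ
  · rw [UpperHalfPlane.mdifferentiable_iff]
    intro z hz
    refine DifferentiableAt.differentiableWithinAt ?_
    refine (hd z hz).congr_of_eventuallyEq ?_
    filter_upwards [isOpen_upperHalfPlaneSet.mem_nhds hz] with w hw
    simp [ofComplex_apply_of_im_pos hw]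
  · intro c hc
    rw [OnePoint.isZeroAt_iff_forall_SL2Z hc]
    intro γ _
    change IsZeroAtImInfty ((fun τ : ℍ => f τ) ∣[k] γ)
    rw [hslash γ]
    exact h0.comp tendsto_coe_atImInfty

/-- This turns every later identity of forms into three checks: T, S, and the limit at i∞. -/
lemma eq_zero_of_levelOne {f : ℂ → ℂ} {k : ℤ} (hk : k < 12)
    (hd : ∀ z : ℂ, 0 < z.im → DifferentiableAt ℂ f z)
    (hT : ∀ z : ℂ, 0 < z.im → f (z + 1) = f z)
    (hS : ∀ z : ℂ, 0 < z.im → f (-1 / z) = z ^ k * f z) (h0 : Tendsto f cuspFilter (𝓝 0))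
    {z : ℂ} (hz : 0 < z.im) : f z = 0 := by
  obtain ⟨F, hF⟩ := exists_cuspForm hd hT hS h0
  have h := rank_zero_iff_forall_zero.mp (CuspForm.rank_eq_zero_of_weight_lt_twelve hk) F
  have := hF ⟨z, hz⟩
  rw [h] at this
  simpa using this.symm

/-- Weight 12 cusp forms of level one are multiples of the discriminant, which has no zero; a single
nonzero value excludes the multiple 0. -/
lemma ne_zero_of_levelOne {f : ℂ → ℂ}
    (hd : ∀ z : ℂ, 0 < z.im → DifferentiableAt ℂ f z)
    (hT : ∀ z : ℂ, 0 < z.im → f (z + 1) = f z)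
    (hS : ∀ z : ℂ, 0 < z.im → f (-1 / z) = z ^ (12 : ℤ) * f z) (h0 : Tendsto f cuspFilter (𝓝 0))
    {w : ℂ} (hw : 0 < w.im) (hfw : f w ≠ 0) {z : ℂ} (hz : 0 < z.im) : f z ≠ 0 := by
  obtain ⟨F, hF⟩ := exists_cuspForm hd hT hS h0
  obtain ⟨c, hc⟩ := CuspForm.exists_smul_discriminant_of_weight_eq_twelve F
  have key : ∀ u : ℂ, ∀ hu : 0 < u.im, f u = c * ModularForm.discriminant ⟨u, hu⟩ := by
    intro u hu
    have := hF ⟨u, hu⟩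
    rw [← hc] at this
    exact this.symm
  have hc0 : c ≠ 0 := by
    rintro rfl
    exact hfw (by rw [key w hw, zero_mul])
  rw [key z hz]
  exact mul_ne_zero hc0 (ModularForm.discriminant_ne_zero _)

end Bimodular

end

/-! ### A vector-valued modular form of weight one and its differential identities -/

noncomputable section

namespace Bimodular

open Complex Filter

/-! ### The pair of theta functions of weight one -/

/-- The theta function of the hexagonal lattice. -/
def thP (z : ℂ) : ℂ := L z

/-- The theta function of the shifted hexagonal lattice. -/
def thC (z : ℂ) : ℂ := (L (z / 3) - L z) / 2

/-- The constant `-i / √3`. -/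
def sigma : ℂ := -I * (Real.sqrt 3 : ℝ) / 3

lemma sigma_sq : sigma ^ 2 = -1 / 3 := by
  rw [sigma, div_pow, mul_pow, neg_sq, I_sq, sqrt_three_sq]; norm_num

lemma sigma_pow_four : sigma ^ 4 = 1 / 9 := by
  rw [show sigma ^ 4 = (sigma ^ 2) ^ 2 by ring, sigma_sq]; norm_num

lemma ne_zero_of_im_pos {z : ℂ} (hz : 0 < z.im) : z ≠ 0 := by
  rintro rfl; simp at hz

lemma thP_add_one (z : ℂ) : thP (z + 1) = thP z := L_add_one z

lemma thC_add_one {z : ℂ} (hz : 0 < z.im) : thC (z + 1) = omega * thC z := by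
  rw [thC, thC, L_add_one, L_add_one_div_three hz]; ring

/-- The functional equation of `L` at `z/3`, since -1/z = -1/(3(z/3)) and `L (z/3) = thP z + 2 * thC
z`. -/
lemma thP_neg_inv {z : ℂ} (hz : 0 < z.im) :
    thP (-1 / z) = sigma * z * (thP z + 2 * thC z) := by
  have h := L_neg_inv (third_im hz)
  rw [show 3 * (z / 3) = z by ring] at h
  rw [thP, h, sigma, thC, thP]; ring

lemma thC_neg_inv {z : ℂ} (hz : 0 < z.im) :
    thC (-1 / z) = sigma * z * (thP z - thC z) := by
  have h := L_neg_inv (third_im hz)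
  rw [show 3 * (z / 3) = z by ring] at h
  have h2 := L_neg_inv hz
  rw [show -1 / (3 * z) = -1 / z / 3 by rw [div_div, mul_comm]] at h2
  rw [thC, h, h2, sigma, thC, thP]; ring

lemma differentiableAt_thP {z : ℂ} (hz : 0 < z.im) : DifferentiableAt ℂ thP z :=
  differentiableAt_L hz

lemma differentiableAt_thC {z : ℂ} (hz : 0 < z.im) : DifferentiableAt ℂ thC z := by
  have h3 : DifferentiableAt ℂ (fun z : ℂ => L (z / 3)) z :=
    (differentiableAt_L (third_im hz)).comp z (f := fun z : ℂ => z / 3) (by fun_prop)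
  exact (h3.sub (differentiableAt_L hz)).div_const 2

lemma im_pos_mem_nhds {z : ℂ} (hz : 0 < z.im) : ∀ᶠ w in 𝓝 z, 0 < w.im :=
  (isOpen_lt continuous_const Complex.continuous_im).mem_nhds hz

lemma differentiableAt_deriv {f : ℂ → ℂ} (hf : ∀ z : ℂ, 0 < z.im → DifferentiableAt ℂ f z)
    {z : ℂ} (hz : 0 < z.im) : DifferentiableAt ℂ (deriv f) z := by
  have : AnalyticAt ℂ f z := by
    rw [Complex.analyticAt_iff_eventually_differentiableAt]
    filter_upwards [im_pos_mem_nhds hz] with w hw using hf w hw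
  exact this.deriv.differentiableAt

lemma deriv_eq_of_add_one {f g : ℂ → ℂ} (h : ∀ z : ℂ, 0 < z.im → f (z + 1) = g z)
    {z : ℂ} (hz : 0 < z.im) : deriv f (z + 1) = deriv g z := by
  rw [← deriv_comp_add_const]
  refine Filter.EventuallyEq.deriv_eq ?_
  filter_upwards [im_pos_mem_nhds hz] with w hw using h w hw

lemma deriv_eq_of_neg_inv {f g : ℂ → ℂ} (hf : ∀ z : ℂ, 0 < z.im → DifferentiableAt ℂ f z)
    (h : ∀ z : ℂ, 0 < z.im → f (-1 / z) = g z)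
    {z : ℂ} (hz : 0 < z.im) : deriv f (-1 / z) = z ^ 2 * deriv g z := by
  have h0 := ne_zero_of_im_pos hz
  have e : deriv (fun w => f (-1 / w)) z = deriv g z := by
    refine Filter.EventuallyEq.deriv_eq ?_
    filter_upwards [im_pos_mem_nhds hz] with w hw using h w hw
  have hi : HasDerivAt (fun w : ℂ => -1 / w) (1 / z ^ 2) z := by
    have := (hasDerivAt_inv h0).neg
    convert! this using 1
    · ext w; simp [neg_div]
    · simp
  have hc : HasDerivAt (fun w => f (-1 / w)) (deriv f (-1 / z) * (1 / z ^ 2)) z :=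
    HasDerivAt.comp z (hf _ (neg_inv_im_pos hz)).hasDerivAt hi
  rw [← e, hc.deriv]
  field_simp

lemma deriv_thP_add_one {z : ℂ} (hz : 0 < z.im) : deriv thP (z + 1) = deriv thP z :=
  deriv_eq_of_add_one (fun z _ => thP_add_one z) hz

lemma deriv_thC_add_one {z : ℂ} (hz : 0 < z.im) : deriv thC (z + 1) = omega * deriv thC z := by
  rw [deriv_eq_of_add_one (fun z hz => thC_add_one hz) hz, deriv_const_mul_field]

lemma deriv_thP_neg_inv {z : ℂ} (hz : 0 < z.im) : deriv thP (-1 / z) =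
    z ^ 2 * (sigma * (thP z + 2 * thC z) + sigma * z * (deriv thP z + 2 * deriv thC z)) := by
  rw [deriv_eq_of_neg_inv (fun z hz => differentiableAt_thP hz) (fun z hz => thP_neg_inv hz) hz]
  have h : HasDerivAt (fun z => sigma * z * (thP z + 2 * thC z))
      (sigma * 1 * (thP z + 2 * thC z) + sigma * z * (deriv thP z + 2 * deriv thC z)) z :=
    ((hasDerivAt_id z).const_mul sigma).mul ((differentiableAt_thP hz).hasDerivAt.add
      ((differentiableAt_thC hz).hasDerivAt.const_mul 2))
  rw [h.deriv, mul_one]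

lemma deriv_thC_neg_inv {z : ℂ} (hz : 0 < z.im) : deriv thC (-1 / z) =
    z ^ 2 * (sigma * (thP z - thC z) + sigma * z * (deriv thP z - deriv thC z)) := by
  rw [deriv_eq_of_neg_inv (fun z hz => differentiableAt_thC hz) (fun z hz => thC_neg_inv hz) hz]
  have h : HasDerivAt (fun z => sigma * z * (thP z - thC z))
      (sigma * 1 * (thP z - thC z) + sigma * z * (deriv thP z - deriv thC z)) z :=
    ((hasDerivAt_id z).const_mul sigma).mul ((differentiableAt_thP hz).hasDerivAt.sub
      ((differentiableAt_thC hz).hasDerivAt))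
  rw [h.deriv, mul_one]

/-! ### Behaviour at the cusp -/

lemma tendsto_thP : Tendsto thP cuspFilter (𝓝 1) := by
  have h := tendsto_L_sub_one_div.mul (tendsto_cexp_cuspFilter zero_lt_one)
  have h' := h.add_const 1
  rw [mul_zero, zero_add] at h'
  refine h'.congr fun z => ?_
  have := Complex.exp_ne_zero (2 * Real.pi * I * z)
  simp only [ofReal_one, mul_one, thP]
  field_simp
  ring

lemma tendsto_div_three : Tendsto (fun z : ℂ => z / 3) cuspFilter cuspFilter := by
  rw [tendsto_comap_iff]
  have : Complex.im ∘ (fun z : ℂ => z / 3) = fun z => (1 / 3) * z.im := by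
    ext z
    simp only [Function.comp_apply]
    rw [show (z / 3) = ((1 / 3 : ℝ) : ℂ) * z by push_cast; ring, Complex.im_ofReal_mul]
  rw [this]
  exact (tendsto_comap (f := Complex.im)).const_mul_atTop (by norm_num)

/-- The leading term of `thC` is `3 exp (2 π i z / 3)`. -/
lemma tendsto_thC_div :
    Tendsto (fun z => thC z * cexp (-(2 * Real.pi * I * z / 3))) cuspFilter (𝓝 3) := by
  have h1 := tendsto_L_sub_one_div.comp tendsto_div_three
  have h2 := tendsto_L_sub_one_div.mul (tendsto_cexp_cuspFilter (c := 2 / 3) (by norm_num))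
  have h := (h1.sub h2).div_const 2
  rw [mul_zero, sub_zero, show (6 : ℂ) / 2 = 3 by norm_num] at h
  refine h.congr fun z => ?_
  have e1 : cexp (-(2 * Real.pi * I * z / 3)) = (cexp (2 * Real.pi * I * (z / 3)))⁻¹ := by
    rw [← Complex.exp_neg]; congr 1; ring
  have e2 : cexp (2 * Real.pi * I * z) =
      cexp (2 * Real.pi * I * (z / 3)) * cexp (2 * Real.pi * I * z * ((2 / 3 : ℝ) : ℂ)) := by
    rw [← Complex.exp_add]; congr 1; push_cast; ring
  have n1 := Complex.exp_ne_zero (2 * Real.pi * I * (z / 3))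
  have n2 := Complex.exp_ne_zero (2 * Real.pi * I * z * ((2 / 3 : ℝ) : ℂ))
  simp only [Function.comp_apply]
  rw [e1, e2, thC]
  field_simp
  ring

lemma thC_eq_mul (z : ℂ) : thC z =
    (thC z * cexp (-(2 * Real.pi * I * z / 3))) * cexp (2 * Real.pi * I * z / 3) := by
  rw [mul_assoc, ← Complex.exp_add, neg_add_cancel, Complex.exp_zero, mul_one]

lemma tendsto_thC : Tendsto thC cuspFilter (𝓝 0) := by
  have h := tendsto_thC_div.mul (tendsto_cexp_cuspFilter (c := 1 / 3) (by norm_num))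
  rw [mul_zero] at h
  refine h.congr fun z => ?_
  conv_rhs => rw [thC_eq_mul z]
  congr 2
  push_cast; ring

lemma eventually_thC_ne_zero : ∀ᶠ z in cuspFilter, thC z ≠ 0 := by
  filter_upwards [tendsto_thC_div.eventually_ne (show (3 : ℂ) ≠ 0 by norm_num)] with z hz
  exact left_ne_zero_of_mul hz

/-- Write `thC` as q^(1/3) times a function g with limit 3. The logarithmic derivative of g tends to
0, so only that of q^(1/3) remains. -/
lemma tendsto_deriv_thC_div :
    Tendsto (fun z => deriv thC z / thC z) cuspFilter (𝓝 (2 * Real.pi * I / 3)) := by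
  set g : ℂ → ℂ := fun z => thC z * cexp (-(2 * Real.pi * I * z / 3)) with hg
  have hgd : ∀ z : ℂ, 0 < z.im → DifferentiableAt ℂ g z := fun z hz =>
    (differentiableAt_thC hz).mul (by fun_prop)
  have h1 := tendsto_deriv_cuspFilter hgd tendsto_thC_div
  have h2 := (h1.div tendsto_thC_div (by norm_num)).add_const (2 * Real.pi * I / 3)
  rw [zero_div, zero_add] at h2
  refine h2.congr' ?_
  filter_upwards [eventually_im_gt 0, eventually_thC_ne_zero] with z hz hz0
  have hexp : HasDerivAt (fun z => cexp (-(2 * Real.pi * I * z / 3)))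
      (cexp (-(2 * Real.pi * I * z / 3)) * (-(2 * Real.pi * I * 1 / 3))) z :=
    ((((hasDerivAt_id z).const_mul _).div_const 3).neg).cexp
  have hd := ((differentiableAt_thC hz).hasDerivAt.mul hexp).deriv
  change deriv g z = _ at hd
  have n1 := Complex.exp_ne_zero (-(2 * Real.pi * I * z / 3))
  simp only [Pi.div_apply]
  rw [hd]
  field_simp
  ring

lemma tendsto_deriv_thP : Tendsto (deriv thP) cuspFilter (𝓝 0) :=
  tendsto_deriv_cuspFilter (fun _ hz => differentiableAt_thP hz) tendsto_thP

lemma tendsto_deriv_thC : Tendsto (deriv thC) cuspFilter (𝓝 0) :=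
  tendsto_deriv_cuspFilter (fun _ hz => differentiableAt_thC hz) tendsto_thC

/-! ### The form of weight four vanishing at the cusps -/

/-- A constant multiple of `η ^ 8`. -/
def formE (z : ℂ) : ℂ := thC z * (thP z ^ 3 - thC z ^ 3)

lemma formE_add_one {z : ℂ} (hz : 0 < z.im) : formE (z + 1) = omega * formE z := by
  rw [formE, thC_add_one hz, thP_add_one, mul_pow, omega_pow_three, formE]; ring

lemma formE_neg_inv {z : ℂ} (hz : 0 < z.im) : formE (-1 / z) = z ^ 4 * formE z := by
  rw [formE, thC_neg_inv hz, thP_neg_inv hz, formE]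
  linear_combination (z ^ 4 * (thP z - thC z) * ((thP z + 2 * thC z) ^ 3 - (thP z - thC z) ^ 3)) *
    sigma_pow_four

lemma differentiableAt_formE {z : ℂ} (hz : 0 < z.im) : DifferentiableAt ℂ formE z :=
  (differentiableAt_thC hz).mul
    (((differentiableAt_thP hz).pow 3).sub ((differentiableAt_thC hz).pow 3))

lemma tendsto_cubeDiff : Tendsto (fun z => thP z ^ 3 - thC z ^ 3) cuspFilter (𝓝 1) := by
  simpa using (tendsto_thP.pow 3).sub (tendsto_thC.pow 3)

lemma tendsto_formE : Tendsto formE cuspFilter (𝓝 0) := by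
  have h := tendsto_thC.mul tendsto_cubeDiff
  rwa [zero_mul] at h

instance : cuspFilter.NeBot := by
  refine Filter.comap_neBot fun s hs => ?_
  obtain ⟨r, hr⟩ := Filter.nonempty_of_mem hs
  exact ⟨⟨0, r⟩, hr⟩

/-- The cube loses the cubic character under T and becomes a nonzero level-one cusp form of weight
12. -/
lemma formE_ne_zero {z : ℂ} (hz : 0 < z.im) : formE z ≠ 0 := by
  obtain ⟨w, hw, hw1, hw2⟩ := ((eventually_im_gt 0).and (eventually_thC_ne_zero.and
    (tendsto_cubeDiff.eventually_ne one_ne_zero))).exists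
  have h : formE z ^ 3 ≠ 0 := by
    refine ne_zero_of_levelOne (f := fun z => formE z ^ 3)
      (fun z hz => (differentiableAt_formE hz).pow 3) (fun z hz => ?_) (fun z hz => ?_) ?_ hw
      (pow_ne_zero 3 (mul_ne_zero hw1 hw2)) hz
    · rw [formE_add_one hz, mul_pow, omega_pow_three, one_mul]
    · rw [formE_neg_inv hz, mul_pow, ← pow_mul]; norm_cast
    · simpa using tendsto_formE.pow 3
  exact fun h0 => h (by rw [h0]; norm_num)

/-- The Wronskian of the pair of theta functions. -/
lemma wronskian_eq {z : ℂ} (hz : 0 < z.im) :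
    thP z * deriv thC z - thC z * deriv thP z = 2 * Real.pi * I / 3 * formE z := by
  -- The Wronskian and `formE` have the same weight and character, so their quotient is a weight 0
  -- form without poles. Subtracting its limit at i∞ leaves a cusp form of weight 0, hence zero.
  have hlim : Tendsto (fun z => (thP z * deriv thC z - thC z * deriv thP z) / formE z -
      2 * Real.pi * I / 3) cuspFilter (𝓝 0) := by
    have h := (((tendsto_thP.mul tendsto_deriv_thC_div).sub tendsto_deriv_thP).div tendsto_cubeDiff
      one_ne_zero).sub_const (2 * Real.pi * I / 3)
    rw [one_mul, sub_zero, div_one, sub_self] at h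
    refine h.congr' ?_
    filter_upwards [eventually_thC_ne_zero] with z hz
    simp only [Pi.div_apply]
    rw [formE, ← div_div]
    congr 2
    field_simp
  have h := eq_zero_of_levelOne (k := 0) (f := fun z => (thP z * deriv thC z - thC z * deriv thP z) /
    formE z - 2 * Real.pi * I / 3) (by norm_num) (fun z hz => ?_) (fun z hz => ?_) (fun z hz => ?_)
    hlim hz
  · have := formE_ne_zero hz
    field_simp at h
    linear_combination h / 3
  · have d1 := differentiableAt_deriv (fun z hz => differentiableAt_thP hz) hz
    have d2 := differentiableAt_deriv (fun z hz => differentiableAt_thC hz) hz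
    exact ((((differentiableAt_thP hz).mul d2).sub ((differentiableAt_thC hz).mul d1)).div
      (differentiableAt_formE hz) (formE_ne_zero hz)).sub_const _
  · have := formE_ne_zero hz
    have := omega_ne_zero
    rw [formE_add_one hz, thC_add_one hz, thP_add_one, deriv_thC_add_one hz, deriv_thP_add_one hz]
    field_simp
  · have h1 := formE_ne_zero hz
    have h2 := ne_zero_of_im_pos hz
    simp only [zpow_zero, one_mul]
    congr 1
    rw [formE_neg_inv hz, thC_neg_inv hz, thP_neg_inv hz, deriv_thC_neg_inv hz,
      deriv_thP_neg_inv hz, div_eq_div_iff (mul_ne_zero (pow_ne_zero 4 h2) h1) h1]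
    linear_combination (-3 * z ^ 4 * formE z *
      (thP z * deriv thC z - thC z * deriv thP z)) * sigma_sq

/-- A quarter of the logarithmic derivative of `formE`. -/
def logE (z : ℂ) : ℂ := deriv formE z / (4 * formE z)

lemma differentiableAt_logE {z : ℂ} (hz : 0 < z.im) : DifferentiableAt ℂ logE z :=
  (differentiableAt_deriv (fun z hz => differentiableAt_formE hz) hz).div
    ((differentiableAt_formE hz).const_mul 4) (mul_ne_zero (by norm_num) (formE_ne_zero hz))

lemma logE_add_one {z : ℂ} (hz : 0 < z.im) : logE (z + 1) = logE z := by
  have h := deriv_eq_of_add_one (fun z hz => formE_add_one hz) hz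
  rw [deriv_const_mul_field] at h
  have := omega_ne_zero
  rw [logE, h, formE_add_one hz, logE]
  have := formE_ne_zero hz
  field_simp

/-- The anomaly z comes from differentiating the factor z⁴. It is of the quasimodular kind that
cancels in `logE² - deriv logE`, leaving a form of weight 4. -/
lemma logE_neg_inv {z : ℂ} (hz : 0 < z.im) : logE (-1 / z) = z + z ^ 2 * logE z := by
  have h := deriv_eq_of_neg_inv (fun z hz => differentiableAt_formE hz)
    (fun z hz => formE_neg_inv hz) hz
  have hd : HasDerivAt (fun z => z ^ 4 * formE z)
      ((4 : ℕ) * z ^ 3 * formE z + z ^ 4 * deriv formE z) z :=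
    (hasDerivAt_pow 4 z).mul (differentiableAt_formE hz).hasDerivAt
  rw [hd.deriv] at h
  rw [logE, h, formE_neg_inv hz, logE]
  have h1 := formE_ne_zero hz
  have h2 := ne_zero_of_im_pos hz
  field_simp
  push_cast
  ring

lemma hasDerivAt_formE {z : ℂ} (hz : 0 < z.im) : HasDerivAt formE
    (deriv thC z * (thP z ^ 3 - thC z ^ 3) + thC z *
      ((3 : ℕ) * thP z ^ 2 * deriv thP z - (3 : ℕ) * thC z ^ 2 * deriv thC z)) z :=
  (differentiableAt_thC hz).hasDerivAt.mul
    (((differentiableAt_thP hz).hasDerivAt.pow 3).sub ((differentiableAt_thC hz).hasDerivAt.pow 3))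

lemma tendsto_logE : Tendsto logE cuspFilter (𝓝 (Real.pi * I / 6)) := by
  have h1 := (((((tendsto_thP.pow 2).const_mul 3).mul tendsto_deriv_thP).sub
    (((tendsto_thC.pow 2).const_mul 3).mul tendsto_deriv_thC)).div tendsto_cubeDiff
      one_ne_zero)
  have h := (tendsto_deriv_thC_div.add h1).div_const 4
  rw [show (2 * Real.pi * I / 3 + (3 * 1 ^ 2 * 0 - 3 * 0 ^ 2 * 0) / 1) / 4 = Real.pi * I / 6 by
    ring] at h
  refine h.congr' ?_
  filter_upwards [eventually_thC_ne_zero, eventually_im_gt 0] with z hz hz0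
  have hE := formE_ne_zero hz0
  have hE2 : thP z ^ 3 - thC z ^ 3 ≠ 0 := right_ne_zero_of_mul hE
  simp only [Pi.div_apply]
  rw [logE, (hasDerivAt_formE hz0).deriv, formE]
  push_cast
  field_simp

/-- Ramanujan's differential equation. -/
lemma ramanujan {z : ℂ} (hz : 0 < z.im) :
    logE z ^ 2 - deriv logE z = (Real.pi * I / 6) ^ 2 * (thP z * (thP z ^ 3 + 8 * thC z ^ 3)) := by
  -- Both sides are level-one forms of weight 4 with the same constant term, so their difference is
  -- a cusp form of weight 4.
  have hlim : Tendsto (fun z => logE z ^ 2 - deriv logE z -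
      (Real.pi * I / 6) ^ 2 * (thP z * (thP z ^ 3 + 8 * thC z ^ 3))) cuspFilter (𝓝 0) := by
    have h := ((tendsto_logE.pow 2).sub
      (tendsto_deriv_cuspFilter (fun z hz => differentiableAt_logE hz) tendsto_logE)).sub
      ((tendsto_thP.mul ((tendsto_thP.pow 3).add ((tendsto_thC.pow 3).const_mul 8))).const_mul
        ((Real.pi * I / 6) ^ 2))
    simpa using h
  have h := eq_zero_of_levelOne (k := 4) (f := fun z => logE z ^ 2 - deriv logE z -
      (Real.pi * I / 6) ^ 2 * (thP z * (thP z ^ 3 + 8 * thC z ^ 3))) (by norm_num)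
      (fun z hz => ?_) (fun z hz => ?_) (fun z hz => ?_) hlim hz
  · exact sub_eq_zero.mp h
  · have h1 := differentiableAt_logE hz
    have h2 := differentiableAt_deriv (fun z hz => differentiableAt_logE hz) hz
    have h3 := differentiableAt_thP hz
    have h4 := differentiableAt_thC hz
    fun_prop
  · rw [logE_add_one hz, deriv_eq_of_add_one (fun z hz => logE_add_one hz) hz, thP_add_one,
      thC_add_one hz, mul_pow, omega_pow_three, one_mul]
  · have hd : HasDerivAt (fun z => z + z ^ 2 * logE z)
        (1 + ((2 : ℕ) * z ^ 1 * logE z + z ^ 2 * deriv logE z)) z :=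
      (hasDerivAt_id z).add ((hasDerivAt_pow 2 z).mul (differentiableAt_logE hz).hasDerivAt)
    have h1 := deriv_eq_of_neg_inv (fun z hz => differentiableAt_logE hz)
      (fun z hz => logE_neg_inv hz) hz
    rw [hd.deriv] at h1
    rw [h1, logE_neg_inv hz, thP_neg_inv hz, thC_neg_inv hz]
    push_cast
    rw [show ((4 : ℤ)) = ((4 : ℕ) : ℤ) from rfl, zpow_natCast]
    linear_combination (-(Real.pi * I / 6) ^ 2 * z ^ 4 * (thP z + 2 * thC z) *
      ((thP z + 2 * thC z) ^ 3 + 8 * (thP z - thC z) ^ 3)) * sigma_pow_four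

end Bimodular

end

noncomputable section

namespace Bimodular

open Complex Filter

/-! ### The differential equations of the cubic theta functions -/

/-- `a (z / 3)`. -/
def scaledA (z : ℂ) : ℂ := thP z + 2 * thC z

/-- `b (z / 3)`. -/
def scaledB (z : ℂ) : ℂ := thP z - thC z

/-- The constant `-2 π i / 9`. -/
def kappa : ℂ := -(2 * Real.pi * I) / 9

lemma kappa_ne_zero : kappa ≠ 0 := by
  simp [kappa, Real.pi_ne_zero]

lemma scaledA_mul_three (z : ℂ) : scaledA (3 * z) = L z := by
  rw [scaledA, thP, thC, show 3 * z / 3 = z by ring]; ring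

lemma scaledB_mul_three (z : ℂ) : scaledB (3 * z) = (3 * L (3 * z) - L z) / 2 := by
  rw [scaledB, thP, thC, show 3 * z / 3 = z by ring]; ring

lemma differentiableAt_scaledA {z : ℂ} (hz : 0 < z.im) : DifferentiableAt ℂ scaledA z :=
  (differentiableAt_thP hz).add ((differentiableAt_thC hz).const_mul 2)

lemma formE_eq (z : ℂ) : 9 * formE z = scaledB z * (scaledA z ^ 3 - scaledB z ^ 3) := by
  rw [formE, scaledA, scaledB]; ring

/-- `t (z / 3)`. -/
def scaledT (z : ℂ) : ℂ := scaledB z / scaledA z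

lemma formE_eq_scaledT {z : ℂ} (hA : scaledA z ≠ 0) :
    formE z = scaledA z ^ 4 * (scaledT z * (1 - scaledT z ^ 3)) / 9 := by
  have h := formE_eq z
  rw [scaledT]
  field_simp
  linear_combination h

lemma scaledT_mul_ne_zero {z : ℂ} (hz : 0 < z.im) (hA : scaledA z ≠ 0) :
    scaledT z * (1 - scaledT z ^ 3) ≠ 0 := by
  have h := formE_ne_zero hz
  rw [formE_eq_scaledT hA] at h
  intro h0
  rw [h0] at h
  simp at h

/-- The numerator of the quotient rule is -3 times the Wronskian of `thP` and `thC`, that is, a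
multiple of `formE`. -/
lemma hasDerivAt_scaledT {z : ℂ} (hz : 0 < z.im) (hA : scaledA z ≠ 0) :
    HasDerivAt scaledT (kappa * scaledA z ^ 2 * (scaledT z * (1 - scaledT z ^ 3))) z := by
  have dP := (differentiableAt_thP hz).hasDerivAt
  have dC := (differentiableAt_thC hz).hasDerivAt
  have h := (dP.sub dC).div (dP.add (dC.const_mul 2)) hA
  change HasDerivAt scaledT _ z at h
  convert h using 1
  have hw := wronskian_eq hz
  rw [formE_eq_scaledT hA] at hw
  change _ = (_ - _) / scaledA z ^ 2
  rw [eq_div_iff (pow_ne_zero 2 hA), kappa]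
  simp only [Pi.add_apply, Pi.sub_apply]
  linear_combination (3 : ℂ) * hw

/-- The logarithmic derivative of `scaledA`. -/
def logA (z : ℂ) : ℂ := deriv scaledA z / scaledA z

lemma differentiableAt_logA {z : ℂ} (hz : 0 < z.im) (hA : scaledA z ≠ 0) :
    DifferentiableAt ℂ logA z :=
  (differentiableAt_deriv (fun _ hz => differentiableAt_scaledA hz) hz).div
    (differentiableAt_scaledA hz) hA

lemma eventually_scaledA_ne_zero {z : ℂ} (hz : 0 < z.im) (hA : scaledA z ≠ 0) :
    ∀ᶠ w in 𝓝 z, 0 < w.im ∧ scaledA w ≠ 0 :=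
  (im_pos_mem_nhds hz).and ((differentiableAt_scaledA hz).continuousAt.eventually_ne hA)

/-- Logarithmic differentiation of `formE = A⁴ T (1 - T³) / 9`. It transports Ramanujan's equation
from `logE` to `logA`. -/
lemma logE_eq {z : ℂ} (hz : 0 < z.im) (hA : scaledA z ≠ 0) :
    logE z = logA z + kappa / 4 * ((1 - 4 * scaledT z ^ 3) * scaledA z ^ 2) := by
  have dA := (differentiableAt_scaledA hz).hasDerivAt
  have dT := hasDerivAt_scaledT hz hA
  have hd := ((dA.pow 4).mul (dT.mul ((dT.pow 3).const_sub 1))).div_const 9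
  have he : formE =ᶠ[𝓝 z] fun z => scaledA z ^ 4 * (scaledT z * (1 - scaledT z ^ 3)) / 9 := by
    filter_upwards [eventually_scaledA_ne_zero hz hA] with w hw using formE_eq_scaledT hw.2
  have h := (hd.congr_of_eventuallyEq he).deriv
  have hT := scaledT_mul_ne_zero hz hA
  have hT1 := left_ne_zero_of_mul hT
  have hT2 := right_ne_zero_of_mul hT
  rw [logE, h, formE_eq_scaledT hA, logA]
  simp only [Pi.mul_apply, Pi.pow_apply]
  field_simp
  push_cast
  ring

/-- Ramanujan's equation rewritten for `logA`: a Riccati equation, equivalent to a linear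
second-order equation for `scaledA`. -/
lemma deriv_logA {z : ℂ} (hz : 0 < z.im) (hA : scaledA z ≠ 0) :
    deriv logA z = logA z ^ 2 +
      2 * kappa ^ 2 * scaledA z ^ 4 * (scaledT z ^ 3 * (1 - scaledT z ^ 3)) := by
  have dA := (differentiableAt_scaledA hz).hasDerivAt
  have dT := hasDerivAt_scaledT hz hA
  have du := (differentiableAt_logA hz hA).hasDerivAt
  have hd := du.add (((((dT.pow 3).const_mul 4).const_sub 1).mul (dA.pow 2)).const_mul (kappa / 4))
  have he : logE =ᶠ[𝓝 z]
      fun z => logA z + kappa / 4 * ((1 - 4 * scaledT z ^ 3) * scaledA z ^ 2) := by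
    filter_upwards [eventually_scaledA_ne_zero hz hA] with w hw using logE_eq hw.1 hw.2
  have h := (hd.congr_of_eventuallyEq he).deriv
  have hr := ramanujan hz
  -- The quartic P(P³ + 8C³) keeps its shape, up to the factor 9, under (P, C) ↦ (P + 2C, P - C). Up
  -- to a scalar this substitution is the action of S.
  have hg : thP z * (thP z ^ 3 + 8 * thC z ^ 3) =
      scaledA z ^ 4 * (1 + 8 * scaledT z ^ 3) / 9 := by
    have : scaledT z * scaledA z = scaledB z := by rw [scaledT]; field_simp
    have e : scaledA z ^ 4 * (1 + 8 * scaledT z ^ 3) =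
      scaledA z * (scaledA z ^ 3 + 8 * scaledB z ^ 3) := by rw [← this]; ring
    rw [e, scaledA, scaledB]; ring
  rw [h, logE_eq hz hA, hg] at hr
  have hA' : deriv scaledA z = logA z * scaledA z := by rw [logA]; field_simp
  simp only [Pi.pow_apply] at hr
  rw [hA'] at hr
  have hk : (Real.pi * I / 6) ^ 2 = kappa ^ 2 * 9 / 16 := by rw [kappa]; ring
  rw [hk] at hr
  push_cast at hr
  linear_combination -hr

/-- The constant `-2 π i / 3`. -/
def mu : ℂ := 3 * kappa

lemma mu_ne_zero : mu ≠ 0 := mul_ne_zero (by norm_num) kappa_ne_zero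

/-- `t` as a function on the complex plane. -/
def tC (z : ℂ) : ℂ := (3 * L (3 * z) - L z) / 2 / L z

/-- The normalized logarithmic derivative of `a`. -/
def alC (z : ℂ) : ℂ := deriv L z / (mu * L z ^ 3)

lemma tC_eq (z : ℂ) : tC z = scaledT (3 * z) := by
  rw [tC, scaledT, scaledA_mul_three, scaledB_mul_three]

lemma three_mul_im {z : ℂ} (hz : 0 < z.im) : 0 < (3 * z).im := by simpa using hz

lemma hasDerivAt_three_mul (z : ℂ) : HasDerivAt (fun w : ℂ => 3 * w) 3 z := by
  simpa using (hasDerivAt_id z).const_mul (3 : ℂ)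

lemma hasDerivAt_tC {z : ℂ} (hz : 0 < z.im) (hL : L z ≠ 0) :
    HasDerivAt tC (mu * L z ^ 2 * (tC z * (1 - tC z ^ 3))) z := by
  have hA : scaledA (3 * z) ≠ 0 := by rwa [scaledA_mul_three]
  have h := (hasDerivAt_scaledT (three_mul_im hz) hA).comp z (hasDerivAt_three_mul z)
  rw [show tC = scaledT ∘ fun w => 3 * w from funext tC_eq]
  refine h.congr_deriv ?_
  rw [Function.comp_apply, scaledA_mul_three, mu]; ring

/-- All derivatives are written with the factor `mu * L z ^ 2` in front, that is, in terms of the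
derivation D₀ = (μL²)⁻¹ d/dz, for which D₀t = t(1 - t³) and D₀L = L · `alC`. -/
lemma hasDerivAt_L {z : ℂ} (hz : 0 < z.im) (hL : L z ≠ 0) :
    HasDerivAt L (mu * L z ^ 2 * (L z * alC z)) z := by
  refine (differentiableAt_L hz).hasDerivAt.congr_deriv ?_
  rw [alC]
  have := mu_ne_zero
  field_simp

lemma tC_mul_ne_zero {z : ℂ} (hz : 0 < z.im) (hL : L z ≠ 0) : tC z * (1 - tC z ^ 3) ≠ 0 := by
  rw [tC_eq]
  exact scaledT_mul_ne_zero (three_mul_im hz) (by rwa [scaledA_mul_three])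

lemma alC_eq {z : ℂ} (hz : 0 < z.im) :
    alC z = logA (3 * z) / (kappa * scaledA (3 * z) ^ 2) := by
  have h : HasDerivAt L (deriv scaledA (3 * z) * 3) z := by
    have := (differentiableAt_scaledA (three_mul_im hz)).hasDerivAt.comp z (hasDerivAt_three_mul z)
    rwa [show scaledA ∘ (fun w => 3 * w) = L from funext scaledA_mul_three] at this
  rw [alC, h.deriv, logA, scaledA_mul_three, mu]
  by_cases h0 : L z = 0
  · simp [h0]
  have := kappa_ne_zero
  field_simp

/-- The Picard-Fuchs equation of `a`. -/
lemma hasDerivAt_alC {z : ℂ} (hz : 0 < z.im) (hL : L z ≠ 0) :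
    HasDerivAt alC (mu * L z ^ 2 * (2 * tC z ^ 3 * (1 - tC z ^ 3) - alC z ^ 2)) z := by
  have hA : scaledA (3 * z) ≠ 0 := by rwa [scaledA_mul_three]
  have h3 := three_mul_im hz
  have hk := kappa_ne_zero
  have d1 := (differentiableAt_logA h3 hA).hasDerivAt.div
    (((differentiableAt_scaledA h3).hasDerivAt.pow 2).const_mul kappa)
    (mul_ne_zero hk (pow_ne_zero 2 hA))
  have d2 := d1.comp z (hasDerivAt_three_mul z)
  have he : alC =ᶠ[𝓝 z] (fun w => logA w / (kappa * scaledA w ^ 2)) ∘ fun w => 3 * w := by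
    filter_upwards [im_pos_mem_nhds hz] with w hw using alC_eq hw
  have d3 := d2.congr_of_eventuallyEq he
  refine d3.congr_deriv ?_
  have hA' : deriv scaledA (3 * z) = logA (3 * z) * scaledA (3 * z) := by rw [logA]; field_simp
  rw [alC_eq hz, deriv_logA h3 hA, tC_eq, ← scaledA_mul_three, mu]
  simp only [Pi.pow_apply]
  rw [hA']
  field_simp
  push_cast
  ring

end Bimodular

end

/-! ### The action of SL(2,ℤ) on theta vectors, its invariants and its kernel -/

noncomputable section

namespace Bimodular

open Complex Filter Matrix

/-! ### Factors of automorphy -/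

lemma autFactor_ne_zero (g : SL(2, ℝ)) (τ : ℍ) : autFactor g τ ≠ 0 :=
  UpperHalfPlane.denom_ne_zero (g : GL (Fin 2) ℝ) τ

lemma coe_smul_eq (g : SL(2, ℝ)) (τ : ℍ) :
    ((g • τ : ℍ) : ℂ) = (((g 0 0 : ℝ) : ℂ) * τ + ((g 0 1 : ℝ) : ℂ)) / autFactor g τ := by
  rw [UpperHalfPlane.coe_specialLinearGroup_apply]
  rfl

lemma autFactor_mul (g h : SL(2, ℝ)) (τ : ℍ) :
    autFactor (g * h) τ = autFactor g (h • τ) * autFactor h τ := by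
  have h0 := autFactor_ne_zero h τ
  have e (i j : Fin 2) : (g * h) i j = g i 0 * h 0 j + g i 1 * h 1 j := by
    change (g.1 * h.1) i j = _
    rw [Matrix.mul_apply, Fin.sum_univ_two]
  rw [autFactor, autFactor, coe_smul_eq, add_mul, mul_assoc, div_mul_cancel₀ _ h0, autFactor, e, e]
  push_cast
  ring

/-- The embedding of `SL(2, ℤ)` into `SL(2, ℝ)`. -/
abbrev intToReal : SL(2, ℤ) →* SL(2, ℝ) := SpecialLinearGroup.map (Int.castRingHom ℝ)

lemma intToReal_apply (M : SL(2, ℤ)) (i j : Fin 2) : intToReal M i j = (M i j : ℝ) := rfl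

lemma intToReal_smul (M : SL(2, ℤ)) (τ : ℍ) : intToReal M • τ = M • τ := by
  ext
  rw [UpperHalfPlane.coe_specialLinearGroup_apply, UpperHalfPlane.coe_specialLinearGroup_apply]
  rfl

/-! ### The action of `SL(2, ℤ)` on the pair of theta functions -/

/-- The pair of theta functions. -/
def thVec (τ : ℍ) : Fin 2 → ℂ := ![thP τ, thC τ]

/-- The pair of theta functions transforms under `g` by the matrix `R`. -/
def Transforms (g : SL(2, ℝ)) (R : Matrix (Fin 2) (Fin 2) ℂ) : Prop :=
  ∀ τ : ℍ, thVec (g • τ) = autFactor g τ • R *ᵥ thVec τ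

lemma Transforms.mul {g h : SL(2, ℝ)} {R Q : Matrix (Fin 2) (Fin 2) ℂ} (hg : Transforms g R)
    (hh : Transforms h Q) : Transforms (g * h) (R * Q) := by
  intro τ
  rw [mul_smul, hg, hh, Matrix.mulVec_smul, smul_smul, autFactor_mul, Matrix.mulVec_mulVec]

lemma transforms_one : Transforms 1 1 := by
  intro τ
  simp [autFactor]

/-- The matrix of `T`. -/
def matT : Matrix (Fin 2) (Fin 2) ℂ := !![1, 0; 0, omega]

/-- The matrix of `S`. -/
def matS : Matrix (Fin 2) (Fin 2) ℂ := !![sigma, 2 * sigma; sigma, -sigma]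

lemma transforms_T : Transforms (intToReal ModularGroup.T) matT := by
  intro τ
  rw [intToReal_smul, UpperHalfPlane.modular_T_smul]
  have e : (((1 : ℝ) +ᵥ τ : ℍ) : ℂ) = (τ : ℂ) + 1 := by
    rw [UpperHalfPlane.coe_vadd]; push_cast; ring
  have hj : autFactor (intToReal ModularGroup.T) τ = 1 := by
    rw [autFactor, intToReal_apply, intToReal_apply]
    simp [ModularGroup.T]
  rw [hj, one_smul]
  ext i
  fin_cases i
  · simp [thVec, e, thP_add_one, matT]
  · simp [thVec, e, thC_add_one τ.im_pos, matT, mul_comm]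

lemma transforms_S : Transforms (intToReal ModularGroup.S) matS := by
  intro τ
  rw [intToReal_smul, UpperHalfPlane.modular_S_smul]
  have e : (-(τ : ℂ))⁻¹ = -1 / (τ : ℂ) := by rw [inv_neg, neg_div, one_div]
  have hj : autFactor (intToReal ModularGroup.S) τ = τ := by
    rw [autFactor, intToReal_apply, intToReal_apply]
    simp [ModularGroup.S]
  rw [hj]
  ext i
  fin_cases i
  · simp only [thVec, matS]
    simp [e, thP_neg_inv τ.im_pos]
    ring
  · simp only [thVec, matS]
    simp [e, thC_neg_inv τ.im_pos]
    ring

/-! ### Invariant polynomials -/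

/-- The coordinate `a` of a pair. -/
def vecA (u : Fin 2 → ℂ) : ℂ := u 0 + 2 * u 1

/-- The coordinate `b` of a pair. -/
def vecB (u : Fin 2 → ℂ) : ℂ := u 0 - u 1

/-- The homogeneous form of `1 + 4 t₁ t₂ (t₁ + t₂)`. -/
def polyD (u v : Fin 2 → ℂ) : ℂ :=
  vecA u ^ 2 * vecA v ^ 2 + 4 * vecB u * vecB v * (vecB u * vecA v + vecA u * vecB v)

/-- The homogeneous form of `t₁ + t₂ - 2 t₁² t₂²`. -/
def polyN (u v : Fin 2 → ℂ) : ℂ :=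
  vecB u * vecA u * vecA v ^ 2 + vecA u ^ 2 * (vecA v * vecB v) - 2 * vecB u ^ 2 * vecB v ^ 2

/-- The homogeneous form of `t (1 - t³)`. -/
def polyE (u : Fin 2 → ℂ) : ℂ := vecB u * (vecA u ^ 3 - vecB u ^ 3)

/-- The matrices that preserve the three polynomials up to compatible cube roots of unity. -/
def Preserves (R : Matrix (Fin 2) (Fin 2) ℂ) : Prop :=
  R.det ≠ 0 ∧ (∀ u v, polyD (R *ᵥ u) (R *ᵥ v) = polyD u v) ∧
    ∃ c : ℂ, c ^ 3 = 1 ∧ (∀ u v, polyN (R *ᵥ u) (R *ᵥ v) = c * polyN u v) ∧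
      ∀ u v, polyE (R *ᵥ u) * polyE (R *ᵥ v) = c ^ 2 * (polyE u * polyE v)

lemma preserves_one : Preserves 1 :=
  ⟨by simp, by simp, 1, by simp, by simp, by simp⟩

lemma Preserves.mul {R Q : Matrix (Fin 2) (Fin 2) ℂ} (hR : Preserves R) (hQ : Preserves Q) :
    Preserves (R * Q) := by
  obtain ⟨h1, h2, c, hc, h3, h4⟩ := hR
  obtain ⟨k1, k2, d, hd, k3, k4⟩ := hQ
  refine ⟨by rw [Matrix.det_mul]; exact mul_ne_zero h1 k1, fun u v => ?_, c * d,
    by rw [mul_pow, hc, hd, one_mul], fun u v => ?_, fun u v => ?_⟩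
  · rw [← Matrix.mulVec_mulVec, ← Matrix.mulVec_mulVec, h2, k2]
  · rw [← Matrix.mulVec_mulVec, ← Matrix.mulVec_mulVec, h3, k3, mul_assoc]
  · rw [← Matrix.mulVec_mulVec, ← Matrix.mulVec_mulVec, h4, k4]; ring

lemma mulVec_matT (u : Fin 2 → ℂ) : matT *ᵥ u = ![u 0, omega * u 1] := by
  ext i; fin_cases i <;> simp [matT, Matrix.mulVec, dotProduct, Fin.sum_univ_two]

lemma mulVec_matS (u : Fin 2 → ℂ) : matS *ᵥ u = ![sigma * (u 0 + 2 * u 1), sigma * (u 0 - u 1)] := by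
  ext i; fin_cases i <;> simp [matS, Matrix.mulVec, dotProduct, Fin.sum_univ_two] <;> ring

lemma polyE_eq (u : Fin 2 → ℂ) : polyE u = 9 * (u 1 * (u 0 ^ 3 - u 1 ^ 3)) := by
  rw [polyE, vecA, vecB]; ring

lemma polyD_eq (u v : Fin 2 → ℂ) : polyD u v =
    9 * (u 0 ^ 2 * v 0 ^ 2 + 4 * u 0 * u 1 * v 1 ^ 2 + 4 * u 1 ^ 2 * v 0 * v 1) := by
  rw [polyD, vecA, vecB, vecA, vecB]; ring

lemma polyN_eq (u v : Fin 2 → ℂ) : polyN u v =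
    9 * (u 0 ^ 2 * v 0 * v 1 + u 0 * u 1 * v 0 ^ 2 - 2 * u 1 ^ 2 * v 1 ^ 2) := by
  rw [polyN, vecA, vecB, vecA, vecB]; ring

lemma preserves_matT : Preserves matT := by
  refine ⟨by simp [matT, omega_ne_zero], fun u v => ?_, omega, omega_pow_three, fun u v => ?_,
    fun u v => ?_⟩
  · rw [mulVec_matT, mulVec_matT, polyD_eq, polyD_eq]
    simp only [Matrix.cons_val_zero, Matrix.cons_val_one]
    linear_combination 36 * (u 0 * u 1 * v 1 ^ 2 + u 1 ^ 2 * v 0 * v 1) * omega_pow_three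
  · rw [mulVec_matT, mulVec_matT, polyN_eq, polyN_eq]
    simp only [Matrix.cons_val_zero, Matrix.cons_val_one]
    linear_combination (-18) * omega * (u 1 ^ 2 * v 1 ^ 2) * omega_pow_three
  · rw [mulVec_matT, mulVec_matT, polyE_eq, polyE_eq, polyE_eq, polyE_eq]
    simp only [Matrix.cons_val_zero, Matrix.cons_val_one, mul_pow, omega_pow_three]
    ring

lemma preserves_matS : Preserves matS := by
  refine ⟨?_, fun u v => ?_, 1, one_pow 3, fun u v => ?_, fun u v => ?_⟩
  · have : matS.det = 1 := by
      rw [matS, Matrix.det_fin_two_of]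
      linear_combination -3 * sigma_sq
    rw [this]; exact one_ne_zero
  · rw [mulVec_matS, mulVec_matS, polyD_eq, polyD_eq]
    simp only [Matrix.cons_val_zero, Matrix.cons_val_one]
    linear_combination 81 * (u 0 ^ 2 * v 0 ^ 2 + 4 * u 0 * u 1 * v 1 ^ 2 +
      4 * u 1 ^ 2 * v 0 * v 1) * sigma_pow_four
  · rw [mulVec_matS, mulVec_matS, polyN_eq, polyN_eq]
    simp only [Matrix.cons_val_zero, Matrix.cons_val_one]
    linear_combination 81 * (u 0 ^ 2 * v 0 * v 1 + u 0 * u 1 * v 0 ^ 2 -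
      2 * u 1 ^ 2 * v 1 ^ 2) * sigma_pow_four
  · rw [mulVec_matS, mulVec_matS, polyE_eq, polyE_eq, polyE_eq, polyE_eq]
    simp only [Matrix.cons_val_zero, Matrix.cons_val_one]
    linear_combination 81 * 9 * 9 * (u 1 * (u 0 ^ 3 - u 1 ^ 3)) * (v 1 * (v 0 ^ 3 - v 1 ^ 3)) *
      (sigma ^ 4 + 1 / 9) * sigma_pow_four

/-! ### The kernel of the representation -/

/-- Words of the form `± T ^ i` and `± T ^ i S T ^ j`. -/
def bruhatWords {A : Type*} [Ring A] (T S : A) : Set A :=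
  {x | ∃ e : A, (e = 1 ∨ e = -1) ∧ ∃ i : ℕ, x = e * T ^ i ∨ ∃ j : ℕ, x = e * (T ^ i * S * T ^ j)}

section Bruhat

variable {A : Type*} [Ring A] {T S : A}

lemma one_mem_bruhatWords : (1 : A) ∈ bruhatWords T S :=
  ⟨1, Or.inl rfl, 0, Or.inl (by simp)⟩

lemma T_mul_mem_bruhatWords {x : A} (hx : x ∈ bruhatWords T S) : T * x ∈ bruhatWords T S := by
  obtain ⟨e, he, i, h⟩ := hx
  have hc : T * e = e * T := by rcases he with rfl | rfl <;> simp
  refine ⟨e, he, i + 1, ?_⟩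
  rcases h with rfl | ⟨j, rfl⟩
  · left; rw [← mul_assoc, hc, pow_succ', mul_assoc]
  · right; exact ⟨j, by rw [← mul_assoc, hc, pow_succ']; simp only [mul_assoc]⟩

/-- Since T³ = 1, only i modulo 3 matters in S T^i S T^j. The three residues are handled by the
three relations, each of which returns a word with at most one S. -/
lemma S_mul_mem_bruhatWords (hT : T ^ 3 = 1) (hS : S * S = -1) (h1 : S * T * S = T ^ 2 * S * T ^ 2)
    (h2 : S * T ^ 2 * S = -(T * S * T)) {x : A} (hx : x ∈ bruhatWords T S) :
    S * x ∈ bruhatWords T S := by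
  obtain ⟨e, he, i, h⟩ := hx
  have hc : S * e = e * S := by rcases he with rfl | rfl <;> simp
  have hn : -e = 1 ∨ -e = -1 := by rcases he with rfl | rfl <;> simp
  rcases h with rfl | ⟨j, rfl⟩
  · exact ⟨e, he, 0, Or.inr ⟨i, by rw [← mul_assoc, hc]; simp [mul_assoc]⟩⟩
  · have hi : T ^ i = T ^ (i % 3) := by
      conv_lhs => rw [← Nat.div_add_mod i 3, pow_add, pow_mul, hT, one_pow, one_mul]
    have e1 : S * (e * (T ^ i * S * T ^ j)) = e * (S * T ^ (i % 3) * S * T ^ j) := by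
      rw [← mul_assoc, hc, hi]; simp only [mul_assoc]
    rw [e1]
    have : i % 3 < 3 := Nat.mod_lt _ (by norm_num)
    interval_cases i % 3
    · refine ⟨-e, hn, j, Or.inl ?_⟩
      rw [pow_zero, mul_one, hS]; simp
    · refine ⟨e, he, 2, Or.inr ⟨2 + j, ?_⟩⟩
      rw [pow_one, h1, pow_add]; simp only [mul_assoc]
    · refine ⟨-e, hn, 1, Or.inr ⟨1 + j, ?_⟩⟩
      rw [h2, pow_add, pow_one]; simp only [mul_assoc, neg_mul, mul_neg]

end Bruhat

/-- Reduction modulo three. -/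
def modThree (M : SL(2, ℤ)) : Matrix (Fin 2) (Fin 2) (ZMod 3) :=
  (Int.castRingHom (ZMod 3)).mapMatrix M.1

lemma modThree_mul (M N : SL(2, ℤ)) : modThree (M * N) = modThree M * modThree N := by
  exact map_mul (Int.castRingHom (ZMod 3)).mapMatrix M.1 N.1

lemma matT_pow (i : ℕ) : matT ^ i = !![1, 0; 0, omega ^ i] := by
  induction i with
  | zero => simp [Matrix.one_fin_two]
  | succ k ih =>
    rw [pow_succ, ih, matT, Matrix.mul_fin_two]
    simp [pow_succ]

lemma matT_pow_three : matT ^ 3 = 1 := by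
  rw [matT_pow, omega_pow_three, Matrix.one_fin_two]

lemma matS_mul_self : matS * matS = -1 := by
  rw [matS, Matrix.mul_fin_two, Matrix.one_fin_two]
  ext i j
  fin_cases i <;> fin_cases j <;> simp <;>
    first | ring1 | linear_combination 3 * sigma_sq

lemma three_mul_sigma : 3 * sigma = -(1 + 2 * omega) := by
  rw [one_add_two_omega, sigma]; ring

lemma matS_T_S : matS * matT * matS = matT ^ 2 * matS * matT ^ 2 := by
  have h1 := omega_quadratic
  have h2 := three_mul_sigma
  rw [matT_pow, matS, matT]
  simp only [Matrix.mul_fin_two]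
  ext i j
  fin_cases i <;> fin_cases j <;> simp <;> grind

lemma matS_T_sq_S : matS * matT ^ 2 * matS = -(matT * matS * matT) := by
  have h1 := omega_quadratic
  have h2 := three_mul_sigma
  rw [matT_pow, matS, matT]
  simp only [Matrix.mul_fin_two]
  ext i j
  fin_cases i <;> fin_cases j <;> simp <;> grind

/-- The matrix of `T` together with its reduction modulo three. -/
def pairT : Matrix (Fin 2) (Fin 2) (ZMod 3) × Matrix (Fin 2) (Fin 2) ℂ := (!![1, 1; 0, 1], matT)

/-- The matrix of `S` together with its reduction modulo three. -/
def pairS : Matrix (Fin 2) (Fin 2) (ZMod 3) × Matrix (Fin 2) (Fin 2) ℂ := (!![0, -1; 1, 0], matS)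

/-- Inverses of the generators as positive words, so that induction over SL(2,ℤ) needs only left
multiplication by S and T. -/
lemma T_inv_eq : ModularGroup.T⁻¹ = ModularGroup.S * (ModularGroup.S * (ModularGroup.S *
    (ModularGroup.T * (ModularGroup.S * (ModularGroup.T * ModularGroup.S))))) := by
  decide

lemma S_inv_eq : ModularGroup.S⁻¹ = ModularGroup.S * (ModularGroup.S * ModularGroup.S) := by
  decide

/-- An induction principle for `SL(2, ℤ)`. -/
lemma SL2Z_induction {p : SL(2, ℤ) → Prop} (h1 : p 1) (hS : ∀ M, p M → p (ModularGroup.S * M))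
    (hT : ∀ M, p M → p (ModularGroup.T * M)) (M : SL(2, ℤ)) : p M := by
  have hM : M ∈ Subgroup.closure {ModularGroup.S, ModularGroup.T} := by
    simp [SpecialLinearGroup.SL2Z_generators]
  induction hM using Subgroup.closure_induction_left with
  | one => exact h1
  | mul_left x hx y _ ih =>
    rcases hx with rfl | rfl
    · exact hS y ih
    · exact hT y ih
  | inv_mul_cancel x hx y _ ih =>
    rcases hx with rfl | rfl
    · rw [S_inv_eq]
      simp only [mul_assoc]
      exact hS _ (hS _ (hS _ ih))
    · rw [T_inv_eq]
      simp only [mul_assoc]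
      exact hS _ (hS _ (hS _ (hT _ (hS _ (hT _ (hS _ ih))))))

/-- The matrix `R` is carried along with the reduction of `M` modulo 3 as one element of a product
ring. The defining relations of the words hold in both factors, so both components are given by the
same word, and the first can be used to control the second. -/
lemma exists_transforms (M : SL(2, ℤ)) : ∃ R, Transforms (intToReal M) R ∧ Preserves R ∧
    (modThree M, R) ∈ bruhatWords pairT pairS := by
  induction M using SL2Z_induction with
  | h1 =>
    refine ⟨1, by rw [map_one]; exact transforms_one, preserves_one, ?_⟩
    have : modThree 1 = 1 := map_one (Int.castRingHom (ZMod 3)).mapMatrix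
    rw [this]
    exact one_mem_bruhatWords
  | hS M ih =>
    obtain ⟨R, h1, h2, h3⟩ := ih
    refine ⟨matS * R, by rw [map_mul]; exact transforms_S.mul h1, preserves_matS.mul h2, ?_⟩
    have e : modThree ModularGroup.S = !![0, -1; 1, 0] := by decide
    rw [modThree_mul, e]
    refine S_mul_mem_bruhatWords (T := pairT) (S := pairS) ?_ ?_ ?_ ?_ h3
    · exact Prod.ext (by decide) matT_pow_three
    · exact Prod.ext (by decide) matS_mul_self
    · exact Prod.ext (by decide) matS_T_S
    · exact Prod.ext (by decide) matS_T_sq_S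
  | hT M ih =>
    obtain ⟨R, h1, h2, h3⟩ := ih
    refine ⟨matT * R, by rw [map_mul]; exact transforms_T.mul h1, preserves_matT.mul h2, ?_⟩
    have e : modThree ModularGroup.T = !![1, 1; 0, 1] := by decide
    rw [modThree_mul, e]
    exact T_mul_mem_bruhatWords (T := pairT) (S := pairS) h3

lemma pow_unipotent (i : ℕ) :
    (!![1, 1; 0, 1] : Matrix (Fin 2) (Fin 2) (ZMod 3)) ^ i = !![1, (i : ZMod 3); 0, 1] := by
  induction i with
  | zero => simp [Matrix.one_fin_two]
  | succ k ih =>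
    rw [pow_succ, ih, Matrix.mul_fin_two]
    simp [add_comm]

/-- The representation is trivial on `Γ(3)`, up to sign. -/
lemma transforms_of_modThree (M : SL(2, ℤ)) (h01 : (3 : ℤ) ∣ M 0 1) (h10 : (3 : ℤ) ∣ M 1 0) :
    Transforms (intToReal M) 1 ∨ Transforms (intToReal M) (-1) := by
  obtain ⟨R, h1, -, e, he, i, h3⟩ := exists_transforms M
  have m01 : modThree M 0 1 = 0 := by
    change ((M 0 1 : ℤ) : ZMod 3) = 0
    rwa [ZMod.intCast_zmod_eq_zero_iff_dvd]
  have m10 : modThree M 1 0 = 0 := by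
    change ((M 1 0 : ℤ) : ZMod 3) = 0
    rwa [ZMod.intCast_zmod_eq_zero_iff_dvd]
  rcases h3 with h3 | ⟨j, h3⟩
  -- In a word ±T^i the upper right entry modulo 3 is ±i, so 3 divides i and T^i acts trivially.
  · have hi : (i : ZMod 3) = 0 := by
      have h4 := congrArg Prod.fst h3
      rw [Prod.fst_mul, Prod.pow_fst, pairT, pow_unipotent] at h4
      simp only at h4
      rw [h4] at m01
      rcases he with rfl | rfl <;> simpa using m01
    have h5 := congrArg Prod.snd h3
    obtain ⟨k, rfl⟩ := (ZMod.natCast_eq_zero_iff i 3).mp hi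
    rw [Prod.snd_mul, Prod.pow_snd, pairT, pow_mul, matT_pow_three, one_pow, mul_one] at h5
    simp only at h5
    subst h5
    rcases he with rfl | rfl
    · exact Or.inl h1
    · exact Or.inr h1
  -- A word ±T^i S T^j has lower left entry ±1 modulo 3, which is excluded.
  · exfalso
    have h4 := congrArg Prod.fst h3
    rw [Prod.fst_mul, Prod.fst_mul, Prod.fst_mul, Prod.pow_fst, Prod.pow_fst, pairT, pow_unipotent,
      pow_unipotent, pairS] at h4
    simp only [Matrix.mul_fin_two] at h4
    rw [h4] at m10
    rcases he with rfl | rfl <;> simp at m10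

end Bimodular

end

noncomputable section

namespace Bimodular

open Complex Filter Matrix

/-! ### The normalizer of `Γ₀(9)` -/

/-- The subring of integers in the real numbers. -/
abbrev intSubring : Subring ℝ := (Int.castRingHom ℝ).range

lemma intCast_mem (n : ℤ) : (n : ℝ) ∈ intSubring := ⟨n, rfl⟩

/-- A rational number whose square is an integer is an integer. -/
lemma mem_intSubring_of_sq {x : ℝ} {n : ℤ} (hn : n ≠ 0) (h1 : n * x ∈ intSubring)
    (h2 : x ^ 2 ∈ intSubring) : x ∈ intSubring := by
  obtain ⟨m, hm⟩ := h1
  obtain ⟨k, hk⟩ := h2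
  have hm' : (m : ℝ) = n * x := hm
  have hk' : (k : ℝ) = x ^ 2 := hk
  have h : n ^ 2 ∣ m ^ 2 := by
    refine ⟨k, ?_⟩
    have : (m : ℝ) ^ 2 = n ^ 2 * k := by rw [hm', hk']; ring
    exact_mod_cast this
  rw [Int.pow_dvd_pow_iff two_ne_zero] at h
  obtain ⟨l, hl⟩ := h
  refine ⟨l, ?_⟩
  have hn' : (n : ℝ) ≠ 0 := by exact_mod_cast hn
  change (l : ℝ) = x
  rw [hl] at hm'
  push_cast at hm'
  exact mul_left_cancel₀ hn' hm'

lemma exists_gcd_four (a b c d : ℤ) : ∃ g : ℤ, g ∣ a ∧ g ∣ b ∧ g ∣ c ∧ g ∣ d ∧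
    ∃ p q r s : ℤ, g = p * a + q * b + r * c + s * d := by
  refine ⟨Int.gcd (Int.gcd a b) (Int.gcd c d), ?_, ?_, ?_, ?_, ?_⟩
  · exact (Int.gcd_dvd_left _ _).trans (Int.gcd_dvd_left _ _)
  · exact (Int.gcd_dvd_left _ _).trans (Int.gcd_dvd_right _ _)
  · exact (Int.gcd_dvd_right _ _).trans (Int.gcd_dvd_left _ _)
  · exact (Int.gcd_dvd_right _ _).trans (Int.gcd_dvd_right _ _)
  · set u : ℤ := ((Int.gcd a b : ℕ) : ℤ) with hu
    set v : ℤ := ((Int.gcd c d : ℕ) : ℤ) with hv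
    refine ⟨Int.gcdA u v * Int.gcdA a b, Int.gcdA u v * Int.gcdB a b,
      Int.gcdB u v * Int.gcdA c d, Int.gcdB u v * Int.gcdB c d, ?_⟩
    rw [Int.gcd_eq_gcd_ab u v]
    have h1 := Int.gcd_eq_gcd_ab a b
    have h2 := Int.gcd_eq_gcd_ab c d
    rw [← hu] at h1
    rw [← hv] at h2
    linear_combination Int.gcdA u v * h1 + Int.gcdB u v * h2

/-- If all products of two entries of a matrix of determinant `± 1` are integers, then so are the
entries. -/
lemma mem_intSubring_of_products {x y z w : ℝ} (hxx : x * x ∈ intSubring)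
    (hxy : x * y ∈ intSubring) (hxz : x * z ∈ intSubring) (hxw : x * w ∈ intSubring)
    (hyy : y * y ∈ intSubring) (hyz : y * z ∈ intSubring) (hyw : y * w ∈ intSubring)
    (hzz : z * z ∈ intSubring) (hzw : z * w ∈ intSubring) (hww : w * w ∈ intSubring)
    (hdet : (x * w - y * z) ^ 2 = 1) : x ∈ intSubring := by
  by_cases hx : x = 0
  · rw [hx]; exact zero_mem _
  obtain ⟨k0, h0⟩ := hxx
  obtain ⟨k1, h1⟩ := hxy
  obtain ⟨k2, h2⟩ := hxz
  obtain ⟨k3, h3⟩ := hxw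
  -- Let g be the gcd of the integers x·x, x·y, x·z, x·w. Bézout gives g = x·u, so (x, y, z, w) =
  -- u·(a, b, c, d). Then u² is an integer and u²(ad - bc) = ±1, which forces u = ±1 and x = ±g.
  obtain ⟨g, ⟨a, ha⟩, ⟨b, hb⟩, ⟨c, hc⟩, ⟨d, hd⟩, p, q, r, s, hg⟩ := exists_gcd_four k0 k1 k2 k3
  change (k0 : ℝ) = _ at h0
  change (k1 : ℝ) = _ at h1
  change (k2 : ℝ) = _ at h2
  change (k3 : ℝ) = _ at h3
  set u : ℝ := p * x + q * y + r * z + s * w with hu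
  have hgu : (g : ℝ) = x * u := by
    rw [hg]; push_cast; rw [h0, h1, h2, h3, hu]; ring
  have huu : u ^ 2 ∈ intSubring := by
    have e : u ^ 2 = (p ^ 2 : ℤ) * (x * x) + (q ^ 2 : ℤ) * (y * y) + (r ^ 2 : ℤ) * (z * z) +
        (s ^ 2 : ℤ) * (w * w) + (2 * p * q : ℤ) * (x * y) + (2 * p * r : ℤ) * (x * z) +
        (2 * p * s : ℤ) * (x * w) + (2 * q * r : ℤ) * (y * z) + (2 * q * s : ℤ) * (y * w) +
        (2 * r * s : ℤ) * (z * w) := by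
      rw [hu]; push_cast; ring
    rw [e]
    have m {n : ℤ} {t : ℝ} (ht : t ∈ intSubring) : (n : ℝ) * t ∈ intSubring :=
      mul_mem (intCast_mem n) ht
    exact add_mem (add_mem (add_mem (add_mem (add_mem (add_mem (add_mem (add_mem (add_mem
      (m ⟨k0, h0⟩) (m hyy)) (m hzz)) (m hww)) (m ⟨k1, h1⟩)) (m ⟨k2, h2⟩)) (m ⟨k3, h3⟩)) (m hyz))
      (m hyw)) (m hzw)
  obtain ⟨n, hn⟩ := huu
  change (n : ℝ) = _ at hn
  have key : (n : ℝ) * (a * d - b * c) * (a * d - b * c) * n = 1 := by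
    have e1 : (g : ℝ) ^ 2 * (a * d - b * c) = x ^ 2 * (x * w - y * z) := by
      have i0 : (k0 : ℝ) = g * a := by exact_mod_cast ha
      have i1 : (k1 : ℝ) = g * b := by exact_mod_cast hb
      have i2 : (k2 : ℝ) = g * c := by exact_mod_cast hc
      have i3 : (k3 : ℝ) = g * d := by exact_mod_cast hd
      linear_combination (-(g * a : ℝ)) * i3 - (i0 : (k0 : ℝ) = g * a) * k3 + g * b * i2 + i1 * k2 +
        k0 * h3 + h0 * (x * w) - k1 * h2 - h1 * (x * z)
    rw [hgu] at e1
    have hx2 : x ^ 2 ≠ 0 := pow_ne_zero 2 hx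
    have e2 : u ^ 2 * (a * d - b * c) = x * w - y * z :=
      mul_left_cancel₀ hx2 (by linear_combination e1)
    rw [hn]
    linear_combination (u ^ 2 * (a * d - b * c) + (x * w - y * z)) * e2 + hdet
  have hn1 : n ∣ 1 := ⟨(a * d - b * c) * (a * d - b * c) * n, by
    have : (1 : ℝ) = n * ((a * d - b * c) * (a * d - b * c) * n) := by linear_combination -key
    exact_mod_cast this⟩
  have hn0 : (0 : ℝ) ≤ n := by rw [hn]; positivity
  have hn2 : n = 1 := Int.eq_one_of_dvd_one (by exact_mod_cast hn0) hn1
  rw [hn2] at hn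
  have hu1 : u = 1 ∨ u = -1 := by
    have : (u - 1) * (u + 1) = 0 := by push_cast at hn; linear_combination -hn
    rcases mul_eq_zero.mp this with h | h
    · exact Or.inl (by linarith)
    · exact Or.inr (by linarith)
  rcases hu1 with h | h
  · exact ⟨g, by change (g : ℝ) = x; rw [hgu, h, mul_one]⟩
  · exact ⟨-g, by change ((-g : ℤ) : ℝ) = x; push_cast; rw [hgu, h]; ring⟩

/-- The conjugates of an element of `Γ₀(9)` by an element of the normalizer. -/
lemma conj_mem_of_normalizer {g : SL(2, ℝ)}
    (hg : g ∈ normalizerReal (CongruenceSubgroup.Gamma0 9)) {k l m n : ℤ}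
    (hdet : k * n - l * (9 * m) = 1) : ∃ a b c d : ℤ,
      g 0 0 * (k * g 1 1 - l * g 1 0) + g 0 1 * (9 * m * g 1 1 - n * g 1 0) = a ∧
      g 0 0 * (-k * g 0 1 + l * g 0 0) + g 0 1 * (-(9 * m) * g 0 1 + n * g 0 0) = b ∧
      g 1 0 * (k * g 1 1 - l * g 1 0) + g 1 1 * (9 * m * g 1 1 - n * g 1 0) = 9 * c ∧
      g 1 0 * (-k * g 0 1 + l * g 0 0) + g 1 1 * (-(9 * m) * g 0 1 + n * g 0 0) = d := by
  let γ : SL(2, ℤ) := ⟨!![k, l; 9 * m, n], by rw [Matrix.det_fin_two_of]; exact hdet⟩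
  have hγ : γ ∈ CongruenceSubgroup.Gamma0 9 := by
    rw [CongruenceSubgroup.Gamma0_mem, ZMod.intCast_zmod_eq_zero_iff_dvd]
    exact ⟨m, rfl⟩
  have h := (Subgroup.mem_normalizer_iff.mp hg (intToReal γ)).mp ⟨γ, hγ, rfl⟩
  obtain ⟨δ, hδ, he⟩ := h
  rw [SetLike.mem_coe, CongruenceSubgroup.Gamma0_mem, ZMod.intCast_zmod_eq_zero_iff_dvd] at hδ
  obtain ⟨c, hc⟩ := hδ
  have e (i j : Fin 2) : (δ i j : ℝ) =
      (g i 0 * k + g i 1 * (9 * m)) * (g⁻¹) 0 j + (g i 0 * l + g i 1 * n) * (g⁻¹) 1 j := by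
    have h2 : intToReal δ = g * intToReal γ * g⁻¹ := he
    have h3 : (intToReal δ) i j = (g.1 * (intToReal γ).1 * (g⁻¹).1) i j := by rw [h2]; rfl
    rw [Matrix.mul_apply, Fin.sum_univ_two, Matrix.mul_apply, Fin.sum_univ_two, Matrix.mul_apply,
      Fin.sum_univ_two] at h3
    have h4 : (intToReal γ).1 1 0 = 9 * m := by
      change ((9 * m : ℤ) : ℝ) = _
      push_cast; rfl
    rw [h4] at h3
    exact h3
  have i00 : (g⁻¹) 0 0 = g 1 1 := by rw [SpecialLinearGroup.SL2_inv_expl]; rfl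
  have i01 : (g⁻¹) 0 1 = -g 0 1 := by rw [SpecialLinearGroup.SL2_inv_expl]; rfl
  have i10 : (g⁻¹) 1 0 = -g 1 0 := by rw [SpecialLinearGroup.SL2_inv_expl]; rfl
  have i11 : (g⁻¹) 1 1 = g 0 0 := by rw [SpecialLinearGroup.SL2_inv_expl]; rfl
  refine ⟨δ 0 0, δ 0 1, c, δ 1 1, ?_, ?_, ?_, ?_⟩
  · rw [e, i00, i10]; ring
  · rw [e, i01, i11]; ring
  · have : (δ 1 0 : ℝ) = 9 * c := by exact_mod_cast hc
    rw [← this, e, i00, i10]; ring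
  · rw [e, i01, i11]; ring

/-- The elements of `SL(2, ℝ)` that are conjugate to `M` by the scaling by three. -/
def IsScaled (g : SL(2, ℝ)) (M : SL(2, ℤ)) : Prop :=
  g 0 0 = M 0 0 ∧ 3 * g 0 1 = M 0 1 ∧ g 1 0 = 3 * M 1 0 ∧ g 1 1 = M 1 1

/-- For g with rows (p, q) and (r, s), the entries p, 3q, r/3, s of the rescaled matrix must be
integers. Conjugates of elements of Γ₀(9) have entries quadratic in g, so some multiple of each
product of two entries is an integer. Integrality of the squares removes the multiples, and the gcd
argument passes from products to entries. -/
lemma exists_isScaled_of_normalizer {g : SL(2, ℝ)}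
    (hg : g ∈ normalizerReal (CongruenceSubgroup.Gamma0 9)) : ∃ M : SL(2, ℤ), IsScaled g M := by
  have hdet : g 0 0 * g 1 1 - g 0 1 * g 1 0 = 1 := by
    have := g.2; rwa [Matrix.det_fin_two] at this
  -- The three test elements are parabolic, fixing ∞, 0 and 1/3. The first two give the squares of
  -- the rescaled entries, the third the mixed products.
  obtain ⟨a1, b1, c1, -, ha1, hb1, hc1, -⟩ := conj_mem_of_normalizer hg (k := 1) (l := 1) (m := 0)
    (n := 1) (by norm_num)
  obtain ⟨a2, b2, c2, -, ha2, hb2, hc2, -⟩ := conj_mem_of_normalizer hg (k := 1) (l := 0) (m := 1)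
    (n := 1) (by norm_num)
  obtain ⟨a3, b3, c3, -, ha3, hb3, hc3, -⟩ := conj_mem_of_normalizer hg (k := -2) (l := 1) (m := -1)
    (n := 4) (by norm_num)
  push_cast at ha1 hb1 hc1 ha2 hb2 hc2 ha3 hb3 hc3
  unfold IsScaled
  suffices h : g 0 0 ∈ intSubring ∧ 3 * g 0 1 ∈ intSubring ∧ g 1 0 / 3 ∈ intSubring ∧
      g 1 1 ∈ intSubring by
    obtain ⟨⟨k, hk⟩, ⟨l, hl⟩, ⟨m, hm⟩, ⟨n, hn⟩⟩ := h
    change (k : ℝ) = _ at hk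
    change (l : ℝ) = _ at hl
    change (m : ℝ) = _ at hm
    change (n : ℝ) = _ at hn
    refine ⟨⟨!![k, l; m, n], ?_⟩, hk.symm, hl.symm, ?_, hn.symm⟩
    · rw [Matrix.det_fin_two_of]
      have : (k : ℝ) * n - l * m = 1 := by rw [hk, hl, hm, hn]; linear_combination hdet
      exact_mod_cast this
    · change g 1 0 = 3 * (m : ℝ)
      rw [hm]; ring
  generalize g 0 0 = p at *
  generalize g 0 1 = q at *
  generalize g 1 0 = r at *
  generalize g 1 1 = s at *
  have mk {x : ℝ} (n : ℤ) (h : x = n) : x ∈ intSubring := ⟨n, h.symm⟩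
  have hpp : p * p ∈ intSubring := mk b1 (by rw [← hb1]; ring)
  have hpr : p * r ∈ intSubring := mk (1 - a1) (by push_cast; linear_combination hdet - ha1)
  have hrr : r / 3 * (r / 3) ∈ intSubring := mk (-c1) (by push_cast; linear_combination -hc1 / 9)
  have hqs : 3 * (3 * q * s) ∈ intSubring :=
    mk (a2 - 1) (by push_cast; linear_combination ha2 - hdet)
  have hqq : 3 * q * (3 * q) ∈ intSubring := mk (-b2) (by push_cast; linear_combination -hb2)
  have hss : s * s ∈ intSubring := mk c2 (by linear_combination hc2 / 9)
  have hpq : 2 * (p * (3 * q)) ∈ intSubring :=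
    mk (b3 - b1 + b2) (by push_cast; linear_combination hb3 - hb1 + hb2)
  have hrs : 2 * (r / 3 * s) ∈ intSubring :=
    mk (-c3 + c1 - c2) (by push_cast; linear_combination (-hc3 + hc1 - hc2) / 9)
  have hps : 6 * (p * s) ∈ intSubring :=
    mk (-a3 + a1 - a2 + 4) (by push_cast; linear_combination -ha3 + ha1 - ha2 + 4 * hdet)
  -- Each mixed product has an integral multiple, and its square is a product of two integral
  -- squares.
  have PR : p * (r / 3) ∈ intSubring := by
    refine mem_intSubring_of_sq (n := 3) (by norm_num) ?_ ?_
    · convert hpr using 1; push_cast; ring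
    · convert mul_mem hpp hrr using 1; ring
  have QS : 3 * q * s ∈ intSubring := by
    refine mem_intSubring_of_sq (n := 3) (by norm_num) (by simpa using hqs) ?_
    convert mul_mem hqq hss using 1; ring
  have PQ : p * (3 * q) ∈ intSubring := by
    refine mem_intSubring_of_sq (n := 2) (by norm_num) (by simpa using hpq) ?_
    convert mul_mem hpp hqq using 1; ring
  have RS : r / 3 * s ∈ intSubring := by
    refine mem_intSubring_of_sq (n := 2) (by norm_num) (by simpa using hrs) ?_
    convert mul_mem hrr hss using 1; ring
  have PS : p * s ∈ intSubring := by
    refine mem_intSubring_of_sq (n := 6) (by norm_num) (by simpa using hps) ?_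
    convert mul_mem hpp hss using 1; ring
  have QR : 3 * q * (r / 3) ∈ intSubring := by
    convert sub_mem PS (one_mem _) using 1; linear_combination -hdet
  -- The same lemma with each entry in turn in first place; these rearrangements can change the sign
  -- of the determinant, which is why only its square is required.
  refine ⟨mem_intSubring_of_products hpp PQ PR PS hqq QR QS hrr RS hss ?_,
    mem_intSubring_of_products (y := p) (z := s) (w := r / 3) hqq ?_ QS QR hpp PS PR hss ?_ hrr ?_,
    mem_intSubring_of_products (y := s) (z := p) (w := 3 * q) hrr RS ?_ ?_ hss ?_ ?_ hpp PQ hqq ?_,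
    mem_intSubring_of_products (y := r / 3) (z := 3 * q) (w := p) hss ?_ ?_ ?_ hrr ?_ ?_ hqq ?_ hpp
      ?_⟩
  · linear_combination (p * s - q * r + 1) * hdet
  · rwa [mul_comm]
  · rwa [mul_comm]
  · linear_combination (p * s - q * r + 1) * hdet
  · rwa [mul_comm]
  · rwa [mul_comm]
  · rwa [mul_comm]
  · rwa [mul_comm]
  · linear_combination (p * s - q * r + 1) * hdet
  · rwa [mul_comm]
  · rwa [mul_comm]
  · rwa [mul_comm]
  · rwa [mul_comm]
  · rwa [mul_comm]
  · rwa [mul_comm]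
  · linear_combination (p * s - q * r + 1) * hdet

end Bimodular

end

noncomputable section

namespace Bimodular

open Complex Filter Matrix

/-! ### Transformation laws of `a` and `b` -/

/-- Multiplication by three on the upper half plane. -/
def triple (τ : ℍ) : ℍ := ⟨3 * τ, three_mul_im τ.im_pos⟩

lemma coe_triple (τ : ℍ) : (triple τ : ℂ) = 3 * τ := rfl

/-- The pair of theta functions at `3 τ`. -/
def wVec (τ : ℍ) : Fin 2 → ℂ := thVec (triple τ)

lemma vecA_wVec (τ : ℍ) : vecA (wVec τ) = thetaA τ := scaledA_mul_three τ

lemma vecB_wVec (τ : ℍ) : vecB (wVec τ) = thetaB τ := scaledB_mul_three τ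

/-- If `M` is the conjugate of `g` by the scaling, then 3·(gτ) = M(3τ), with equal factors of
automorphy. -/
lemma wVec_of_isScaled {g : SL(2, ℝ)} {M : SL(2, ℤ)} (h : IsScaled g M)
    {R : Matrix (Fin 2) (Fin 2) ℂ} (hR : Transforms (intToReal M) R) (τ : ℍ) :
    wVec (g • τ) = autFactor g τ • R *ᵥ wVec τ := by
  obtain ⟨h00, h01, h10, h11⟩ := h
  have hj : autFactor (intToReal M) (triple τ) = autFactor g τ := by
    rw [autFactor, autFactor, coe_triple, h10, h11, intToReal_apply, intToReal_apply]
    push_cast; ring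
  have ht : triple (g • τ) = intToReal M • triple τ := by
    ext
    rw [coe_triple, coe_smul_eq, coe_smul_eq, hj, coe_triple, h00, intToReal_apply,
      intToReal_apply, ← h01]
    push_cast; ring
  rw [wVec, ht, hR, hj, wVec]

lemma wVec_of_normalizer {g : SL(2, ℝ)}
    (hg : g ∈ normalizerReal (CongruenceSubgroup.Gamma0 9)) :
    ∃ R, Preserves R ∧ ∀ τ : ℍ, wVec (g • τ) = autFactor g τ • R *ᵥ wVec τ := by
  obtain ⟨M, hM⟩ := exists_isScaled_of_normalizer hg
  obtain ⟨R, h1, h2, -⟩ := exists_transforms M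
  exact ⟨R, h2, wVec_of_isScaled hM h1⟩

/-- The scaling conjugates Γ₀(9) into matrices with both off-diagonal entries divisible by 3. The
sign `e` is harmless because the polynomials D, N, E have even degree in each vector. -/
lemma wVec_of_Gamma0 {γ : SL(2, ℤ)} (hγ : γ ∈ CongruenceSubgroup.Gamma0 9) :
    ∃ e : ℂ, e ^ 2 = 1 ∧ ∀ τ : ℍ, wVec (γ • τ) = (autFactor (intToReal γ) τ * e) • wVec τ := by
  rw [CongruenceSubgroup.Gamma0_mem, ZMod.intCast_zmod_eq_zero_iff_dvd] at hγ
  obtain ⟨c, hc⟩ := hγ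
  have hd : γ 0 0 * γ 1 1 - γ 0 1 * γ 1 0 = 1 := by
    have := γ.2; rwa [Matrix.det_fin_two] at this
  let M : SL(2, ℤ) := ⟨!![γ 0 0, 3 * γ 0 1; 3 * c, γ 1 1], by
    rw [Matrix.det_fin_two_of]
    rw [hc] at hd
    push_cast at hd
    linear_combination hd⟩
  have hM : IsScaled (intToReal γ) M := by
    refine ⟨rfl, ?_, ?_, rfl⟩
    · rw [intToReal_apply]
      change _ = ((3 * γ 0 1 : ℤ) : ℝ)
      push_cast; rfl
    · rw [intToReal_apply, hc]
      change _ = 3 * ((3 * c : ℤ) : ℝ)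
      push_cast; ring
  have h := transforms_of_modThree M ⟨γ 0 1, rfl⟩ ⟨c, rfl⟩
  rcases h with h | h
  · refine ⟨1, by norm_num, fun τ => ?_⟩
    rw [← intToReal_smul, wVec_of_isScaled hM h, Matrix.one_mulVec, mul_one]
  · refine ⟨-1, by norm_num, fun τ => ?_⟩
    rw [← intToReal_smul, wVec_of_isScaled hM h, Matrix.neg_mulVec, Matrix.one_mulVec, mul_neg_one,
      smul_neg, neg_smul]

/-- The affine map `τ ↦ h (h τ + B) / 3`. -/
def affineMap (h B : ℝ) (hh : 0 < h) (τ : ℍ) : ℍ := ⟨(h * τ + B) * h / 3, by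
  rw [show ((h : ℂ) * τ + B) * h / 3 = ((h * h / 3 : ℝ) : ℂ) * τ + ((B * h / 3 : ℝ) : ℂ) by
    push_cast; ring, Complex.add_im, Complex.im_ofReal_mul, Complex.ofReal_im, add_zero]
  have := τ.im_pos
  positivity⟩

lemma tendsto_affineMap {h B : ℝ} (hh : 0 < h) :
    Tendsto (fun τ => ((affineMap h B hh τ : ℍ) : ℂ)) UpperHalfPlane.atImInfty cuspFilter := by
  rw [tendsto_comap_iff]
  have : Complex.im ∘ (fun τ => ((affineMap h B hh τ : ℍ) : ℂ)) =
      fun τ : ℍ => (h * h / 3) * τ.im := by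
    ext τ
    change (((h : ℂ) * τ + B) * h / 3).im = _
    rw [show ((h : ℂ) * τ + B) * h / 3 = ((h * h / 3 : ℝ) : ℂ) * τ + ((B * h / 3 : ℝ) : ℂ) by
      push_cast; ring, Complex.add_im, Complex.im_ofReal_mul, Complex.ofReal_im, add_zero]
    rfl
  rw [this]
  exact (tendsto_comap (f := UpperHalfPlane.im)).const_mul_atTop (by positivity)

lemma tendsto_thVec_affineMap {h B : ℝ} (hh : 0 < h) :
    Tendsto (fun τ => thVec (affineMap h B hh τ)) UpperHalfPlane.atImInfty (𝓝 ![1, 0]) := by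
  rw [tendsto_pi_nhds]
  intro i
  fin_cases i
  · exact tendsto_thP.comp (tendsto_affineMap hh)
  · exact tendsto_thC.comp (tendsto_affineMap hh)

/-- For cusps, γ is arbitrary in SL(2,ℤ) and need not normalize Γ₀(9). The matrix diag(3, 1)γ is
factored as `M` in SL(2,ℤ) times an upper triangular matrix with diagonal (h, 3/h), where h is the
gcd of the first column. The triangular factor acts by `affineMap` and preserves i∞. -/
lemma wVec_smul (γ : SL(2, ℤ)) : ∃ (R : Matrix (Fin 2) (Fin 2) ℂ) (h B : ℝ) (hh : 0 < h),
    R.det ≠ 0 ∧ ∀ τ : ℍ, wVec (γ • τ) =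
      (h / 3 * autFactor (intToReal γ) τ) • R *ᵥ thVec (affineMap h B hh τ) := by
  have hd : γ 0 0 * γ 1 1 - γ 0 1 * γ 1 0 = 1 := by
    have := γ.2; rwa [Matrix.det_fin_two] at this
  have hne : 3 * γ 0 0 ≠ 0 ∨ γ 1 0 ≠ 0 := by
    by_contra! h0
    have h1 : γ 0 0 = 0 := by omega
    rw [h1, h0.2] at hd
    simp at hd
  have hpos : 0 < Int.gcd (3 * γ 0 0) (γ 1 0) := by
    rcases hne with h | h
    · exact Int.gcd_pos_of_ne_zero_left _ h
    · exact Int.gcd_pos_of_ne_zero_right _ h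
  obtain ⟨m0, e0⟩ := Int.gcd_dvd_left (3 * γ 0 0) (γ 1 0)
  obtain ⟨m1, e1⟩ := Int.gcd_dvd_right (3 * γ 0 0) (γ 1 0)
  have eg := Int.gcd_eq_gcd_ab (3 * γ 0 0) (γ 1 0)
  set u := Int.gcdA (3 * γ 0 0) (γ 1 0)
  set v := Int.gcdB (3 * γ 0 0) (γ 1 0)
  set h : ℤ := (Int.gcd (3 * γ 0 0) (γ 1 0) : ℤ) with hh
  have hpos' : 0 < h := Int.natCast_pos.mpr hpos
  have hb : m0 * u + v * m1 = 1 := by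
    rw [e0, e1] at eg
    have : h * (m0 * u + v * m1) = h * 1 := by linear_combination -eg
    exact mul_left_cancel₀ hpos'.ne' this
  -- The first column of `M` is that of diag(3, 1)γ divided by its gcd; the Bézout coefficients
  -- complete it to determinant 1.
  let M : SL(2, ℤ) := ⟨!![m0, -v; m1, u], by
    rw [Matrix.det_fin_two_of]; linear_combination hb⟩
  obtain ⟨R, h1, h2, -⟩ := exists_transforms M
  have hposR : (0 : ℝ) < h := by exact_mod_cast hpos'
  have hC : ((h : ℝ) : ℂ) ≠ 0 := by exact_mod_cast hpos'.ne'
  refine ⟨R, h, 3 * u * γ 0 1 + v * γ 1 1, hposR, h2.1, fun τ => ?_⟩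
  set s := affineMap h (3 * u * γ 0 1 + v * γ 1 1) hposR τ with hs
  have hs' : (s : ℂ) = ((h : ℝ) * τ + ((3 * u * γ 0 1 + v * γ 1 1 : ℝ) : ℂ)) * (h : ℝ) / 3 := rfl
  have e0' : (3 * γ 0 0 : ℂ) = h * m0 := by exact_mod_cast e0
  have e1' : (γ 1 0 : ℂ) = h * m1 := by exact_mod_cast e1
  have hb' : (m0 * u + v * m1 : ℂ) = 1 := by exact_mod_cast hb
  have hd' : (γ 0 0 * γ 1 1 - γ 0 1 * γ 1 0 : ℂ) = 1 := by exact_mod_cast hd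
  have hC' : (h : ℂ) ≠ 0 := by exact_mod_cast hpos'.ne'
  have hdet3 : (m0 * γ 1 1 - 3 * γ 0 1 * m1 : ℂ) * h = 3 := by
    linear_combination 3 * hd' - e0' * γ 1 1 + 3 * γ 0 1 * e1'
  have hj : autFactor (intToReal M) s = (h : ℝ) / 3 * autFactor (intToReal γ) τ := by
    rw [autFactor, autFactor, hs', intToReal_apply, intToReal_apply, intToReal_apply,
      intToReal_apply]
    change (((m1 : ℤ) : ℝ) : ℂ) * _ + (((u : ℤ) : ℝ) : ℂ) = _
    push_cast
    rw [e1']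
    linear_combination (h : ℂ) * γ 1 1 / 3 * hb' - (u : ℂ) / 3 * hdet3
  have ht : triple (γ • τ) = intToReal M • s := by
    ext
    rw [coe_triple, ← intToReal_smul, coe_smul_eq, coe_smul_eq, hj]
    have hj0 := autFactor_ne_zero (intToReal γ) τ
    rw [mul_div_assoc', div_eq_div_iff hj0 (by
      refine mul_ne_zero (div_ne_zero hC (by norm_num)) hj0), hs', intToReal_apply,
      intToReal_apply, intToReal_apply, intToReal_apply]
    have key : (h : ℂ) / 3 * (3 * ((γ 0 0 : ℂ) * τ + γ 0 1)) =
      (m0 : ℂ) * (((h : ℂ) * τ + (3 * u * γ 0 1 + v * γ 1 1)) * h / 3) + (-v : ℂ) := by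
      linear_combination (h : ℂ) / 3 * τ * e0' - (h : ℂ) * γ 0 1 * hb' - (v : ℂ) / 3 * hdet3
    change _ = ((((m0 : ℤ) : ℝ) : ℂ) * _ + (((-v : ℤ) : ℝ) : ℂ)) * _
    push_cast
    linear_combination autFactor (intToReal γ) τ * key
  rw [wVec, ht, h1, hj]

end Bimodular

end

/-! ### Generic points, and growth of functions of theta vectors -/

noncomputable section

namespace Bimodular

open Complex Filter Matrix

/-! ### Density of generic points -/

lemma coe_thetaA (τ : ℍ) : thetaA τ = L τ := rfl

lemma t_eq (τ : ℍ) : t τ = tC τ := rfl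

/-- Zeros of `L` are simple: if `scaledA` and its derivative vanished at the same point, so would
the Wronskian, hence `formE`. -/
lemma eventually_L_ne_zero {z : ℂ} (hz : 0 < z.im) : ∀ᶠ w in 𝓝[≠] z, L w ≠ 0 := by
  by_cases hL : L z = 0
  · have h3 := three_mul_im hz
    have hA : scaledA (3 * z) = 0 := by rwa [scaledA_mul_three]
    have hd : HasDerivAt L (deriv scaledA (3 * z) * 3) z := by
      have := (differentiableAt_scaledA h3).hasDerivAt.comp z (hasDerivAt_three_mul z)
      rwa [show scaledA ∘ (fun w => 3 * w) = L from funext scaledA_mul_three] at this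
    refine hd.eventually_ne (mul_ne_zero ?_ (by norm_num))
    intro h0
    have hw := wronskian_eq h3
    have hdA : deriv scaledA (3 * z) = deriv thP (3 * z) + 2 * deriv thC (3 * z) :=
      ((differentiableAt_thP h3).hasDerivAt.add
        ((differentiableAt_thC h3).hasDerivAt.const_mul 2)).deriv
    rw [hdA] at h0
    rw [scaledA] at hA
    have hE := formE_ne_zero h3
    have : 2 * (Real.pi : ℂ) * I / 3 * formE (3 * z) = 0 := by
      rw [← hw]
      linear_combination deriv thC (3 * z) * hA - thC (3 * z) * h0
    have hpi : (Real.pi : ℂ) ≠ 0 := by exact_mod_cast Real.pi_ne_zero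
    simp [hE, hpi] at this
  · exact ((differentiableAt_L hz).continuousAt.eventually_ne hL).filter_mono nhdsWithin_le_nhds

lemma eventually_tC_ne {z : ℂ} (hz : 0 < z.im) (hL : L z ≠ 0) (c : ℂ) :
    ∀ᶠ w in 𝓝[≠] z, tC w ≠ c :=
  (hasDerivAt_tC hz hL).eventually_ne
    (mul_ne_zero (mul_ne_zero mu_ne_zero (pow_ne_zero 2 hL)) (tC_mul_ne_zero hz hL))

lemma dense_generic {F : Set ℂ} (hF : F.Finite) : Dense {τ : ℍ | thetaA τ ≠ 0 ∧ t τ ∉ F} := by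
  rw [dense_iff_inter_open]
  rintro W hW ⟨τ, hτ⟩
  have hW' : IsOpen ((↑) '' W : Set ℂ) := UpperHalfPlane.isOpenEmbedding_coe.isOpenMap W hW
  have hm : ∀ᶠ w in 𝓝[≠] (τ : ℂ), w ∈ ((↑) '' W : Set ℂ) :=
    nhdsWithin_le_nhds (hW'.mem_nhds ⟨τ, hτ, rfl⟩)
  obtain ⟨w, ⟨σ, hσ, rfl⟩, hL⟩ := (hm.and (eventually_L_ne_zero τ.im_pos)).exists
  have hm2 : ∀ᶠ w in 𝓝[≠] (σ : ℂ), w ∈ ((↑) '' W : Set ℂ) :=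
    nhdsWithin_le_nhds (hW'.mem_nhds ⟨σ, hσ, rfl⟩)
  have hF' : ∀ᶠ w in 𝓝[≠] (σ : ℂ), ∀ c ∈ F, tC w ≠ c :=
    (hF.eventually_all).mpr fun c _ => eventually_tC_ne σ.im_pos hL c
  obtain ⟨w, ⟨ρ, hρ, rfl⟩, hL2, hF2⟩ := (hm2.and ((eventually_L_ne_zero σ.im_pos).and hF')).exists
  exact ⟨ρ, hρ, hL2, fun h => hF2 _ h rfl⟩

lemma dense_thetaA_ne_zero : Dense {τ : ℍ | thetaA τ ≠ 0} :=
  (dense_generic Set.finite_empty).mono fun _ h => h.1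

open Polynomial in
open scoped Polynomial.Bivariate in
/-- A nonzero polynomial in `t₁` and `t₂` does not vanish on a dense set. -/
lemma dense_bivariate {q : ℂ[X][Y]} (hq : q ≠ 0) : Dense {p : ℍ × ℍ |
    thetaA p.1 ≠ 0 ∧ thetaA p.2 ≠ 0 ∧ q.evalEval (t p.1) (t p.2) ≠ 0} := by
  rw [dense_iff_inter_open]
  rintro W hW ⟨⟨τ₁, τ₂⟩, hτ⟩
  obtain ⟨U, V, hU, hV, h1, h2, hUV⟩ := isOpen_prod_iff.mp hW τ₁ τ₂ hτ
  -- The finitely many values of t₂ for which the polynomial becomes identically zero in t₁ are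
  -- avoided first, then the roots in t₁.
  have hfin : {c : ℂ | q.eval (C c) = 0}.Finite :=
    (q.finite_setOfPred_isRoot hq).preimage (Polynomial.C_injective.injOn)
  obtain ⟨σ₂, hσ₂, hA2, ht2⟩ := (dense_generic hfin).inter_open_nonempty V hV ⟨τ₂, h2⟩
  obtain ⟨σ₁, hσ₁, hA1, ht1⟩ := (dense_generic ((q.eval (C (t σ₂))).finite_setOfPred_isRoot
    ht2)).inter_open_nonempty U hU ⟨τ₁, h1⟩
  exact ⟨(σ₁, σ₂), hUV ⟨hσ₁, hσ₂⟩, hA1, hA2, ht1⟩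

lemma continuous_thetaA : Continuous thetaA := by
  rw [continuous_iff_continuousAt]
  intro τ
  exact (differentiableAt_L τ.im_pos).continuousAt.comp UpperHalfPlane.continuous_coe.continuousAt

lemma continuous_thP : Continuous fun τ : ℍ => thP τ := by
  rw [continuous_iff_continuousAt]
  intro τ
  exact (differentiableAt_thP τ.im_pos).continuousAt.comp
    UpperHalfPlane.continuous_coe.continuousAt

lemma continuous_thC : Continuous fun τ : ℍ => thC τ := by
  rw [continuous_iff_continuousAt]
  intro τ
  exact (differentiableAt_thC τ.im_pos).continuousAt.comp
    UpperHalfPlane.continuous_coe.continuousAt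

lemma continuous_thVec : Continuous thVec := by
  refine continuous_pi fun i => ?_
  fin_cases i
  · exact continuous_thP
  · exact continuous_thC

lemma continuous_triple : Continuous triple := by
  rw [UpperHalfPlane.isEmbedding_coe.continuous_iff]
  exact continuous_const.mul UpperHalfPlane.continuous_coe

lemma continuous_wVec : Continuous wVec := continuous_thVec.comp continuous_triple

lemma continuous_vecB : Continuous vecB := by unfold vecB; fun_prop

lemma continuous_thetaB : Continuous thetaB := by
  have := continuous_vecB.comp continuous_wVec
  exact this.congr vecB_wVec

/-! ### Homogeneous forms of `x` and `y` -/

lemma polyD_smul (k l : ℂ) (u v : Fin 2 → ℂ) :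
    polyD (k • u) (l • v) = k ^ 2 * l ^ 2 * polyD u v := by
  rw [polyD_eq, polyD_eq]; simp only [Pi.smul_apply, smul_eq_mul]; ring

lemma polyN_smul (k l : ℂ) (u v : Fin 2 → ℂ) :
    polyN (k • u) (l • v) = k ^ 2 * l ^ 2 * polyN u v := by
  rw [polyN_eq, polyN_eq]; simp only [Pi.smul_apply, smul_eq_mul]; ring

lemma polyE_smul (k : ℂ) (u : Fin 2 → ℂ) : polyE (k • u) = k ^ 4 * polyE u := by
  rw [polyE_eq, polyE_eq]; simp only [Pi.smul_apply, smul_eq_mul]; ring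

lemma vecA_smul (k : ℂ) (u : Fin 2 → ℂ) : vecA (k • u) = k * vecA u := by
  rw [vecA, vecA]; simp only [Pi.smul_apply, smul_eq_mul]; ring

/-- The homogeneous form of `x`. -/
def homX (u v : Fin 2 → ℂ) : ℂ := (polyN u v / polyD u v) ^ 3

/-- The homogeneous form of `y`. -/
def homY (u v : Fin 2 → ℂ) : ℂ := polyE u * polyE v / polyN u v ^ 2

lemma homX_smul {k l : ℂ} (hk : k ≠ 0) (hl : l ≠ 0) (u v : Fin 2 → ℂ) :
    homX (k • u) (l • v) = homX u v := by
  rw [homX, polyN_smul, polyD_smul, mul_div_mul_left, homX]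
  exact mul_ne_zero (pow_ne_zero 2 hk) (pow_ne_zero 2 hl)

lemma homY_smul {k l : ℂ} (hk : k ≠ 0) (hl : l ≠ 0) (u v : Fin 2 → ℂ) :
    homY (k • u) (l • v) = homY u v := by
  rw [homY, polyN_smul, polyE_smul, polyE_smul, homY,
    show k ^ 4 * polyE u * (l ^ 4 * polyE v) = (k ^ 2 * l ^ 2) ^ 2 * (polyE u * polyE v) by ring,
    mul_pow _ (polyN u v), mul_div_mul_left]
  exact pow_ne_zero 2 (mul_ne_zero (pow_ne_zero 2 hk) (pow_ne_zero 2 hl))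

lemma denQ_eq {p : ℍ × ℍ} (h1 : thetaA p.1 ≠ 0) (h2 : thetaA p.2 ≠ 0) :
    denQ p = polyD (wVec p.1) (wVec p.2) / (thetaA p.1 ^ 2 * thetaA p.2 ^ 2) := by
  rw [denQ, polyD, vecA_wVec, vecA_wVec, vecB_wVec, vecB_wVec, t, t]
  field_simp

lemma numP_eq {p : ℍ × ℍ} (h1 : thetaA p.1 ≠ 0) (h2 : thetaA p.2 ≠ 0) :
    numP p = polyN (wVec p.1) (wVec p.2) / (thetaA p.1 ^ 2 * thetaA p.2 ^ 2) := by
  rw [numP, polyN, vecA_wVec, vecA_wVec, vecB_wVec, vecB_wVec, t, t]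
  field_simp

lemma polyE_div {τ : ℍ} (h : thetaA τ ≠ 0) :
    t τ * (1 - t τ ^ 3) = polyE (wVec τ) / thetaA τ ^ 4 := by
  rw [polyE, vecA_wVec, vecB_wVec, t]
  field_simp

lemma x_eq {p : ℍ × ℍ} (h1 : thetaA p.1 ≠ 0) (h2 : thetaA p.2 ≠ 0) :
    x p = homX (wVec p.1) (wVec p.2) := by
  rw [x, homX, denQ_eq h1 h2, numP_eq h1 h2, div_div_div_cancel_right₀]
  exact mul_ne_zero (pow_ne_zero 2 h1) (pow_ne_zero 2 h2)

lemma y_eq {p : ℍ × ℍ} (h1 : thetaA p.1 ≠ 0) (h2 : thetaA p.2 ≠ 0) :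
    y p = homY (wVec p.1) (wVec p.2) := by
  rw [y, homY, numP_eq h1 h2,
    show t p.1 * t p.2 * (1 - t p.1 ^ 3) * (1 - t p.2 ^ 3) =
      (t p.1 * (1 - t p.1 ^ 3)) * (t p.2 * (1 - t p.2 ^ 3)) by ring, polyE_div h1, polyE_div h2,
    div_pow, div_mul_div_comm, mul_pow, ← pow_mul, ← pow_mul, div_div_div_cancel_right₀]
  exact mul_ne_zero (pow_ne_zero _ h1) (pow_ne_zero _ h2)

lemma x_swap (p : ℍ × ℍ) : x p.swap = x p := by
  rw [x, x, numP, numP, denQ, denQ, Prod.fst_swap, Prod.snd_swap]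
  congr 2 <;> ring

lemma y_swap (p : ℍ × ℍ) : y p.swap = y p := by
  rw [y, y, numP, numP, Prod.fst_swap, Prod.snd_swap]
  congr 1 <;> ring

/-! ### Holomorphy -/

lemma differentiableAt_comp_ofComplex {f : ℂ → ℂ} (hf : ∀ z : ℂ, 0 < z.im → DifferentiableAt ℂ f z)
    {z : ℂ} (hz : 0 < z.im) :
    DifferentiableAt ℂ (fun w => f (UpperHalfPlane.ofComplex w : ℍ)) z := by
  refine (hf z hz).congr_of_eventuallyEq ?_
  filter_upwards [im_pos_mem_nhds hz] with w hw
  rw [UpperHalfPlane.ofComplex_apply_of_im_pos hw]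

lemma differentiableAt_thetaB {z : ℂ} (hz : 0 < z.im) :
    DifferentiableAt ℂ (fun z => (3 * L (3 * z) - L z) / 2) z := by
  have h1 := differentiableAt_L hz
  have h2 : DifferentiableAt ℂ (fun z => L (3 * z)) z :=
    (differentiableAt_L (three_mul_im hz)).comp z (f := fun z : ℂ => 3 * z) (by fun_prop)
  fun_prop

lemma holomorphicOn_polynomial {G : ℂ × ℂ × ℂ × ℂ → ℂ} (hG : Differentiable ℂ G)
    (U : Set (ℍ × ℍ)) :
    HolomorphicOn (fun p => G (thetaA p.1, thetaB p.1, thetaA p.2, thetaB p.2)) U := by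
  rintro _ ⟨p, -, rfl⟩
  have h1 := differentiableAt_comp_ofComplex (fun z hz => differentiableAt_L hz) p.1.im_pos
  have h2 := differentiableAt_comp_ofComplex (fun z hz => differentiableAt_L hz) p.2.im_pos
  have h3 := differentiableAt_comp_ofComplex (fun z hz => differentiableAt_thetaB hz) p.1.im_pos
  have h4 := differentiableAt_comp_ofComplex (fun z hz => differentiableAt_thetaB hz) p.2.im_pos
  refine DifferentiableAt.differentiableWithinAt ?_
  refine (hG _).comp (f := fun z : ℂ × ℂ =>
    (thetaA (UpperHalfPlane.ofComplex z.1), thetaB (UpperHalfPlane.ofComplex z.1),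
      thetaA (UpperHalfPlane.ofComplex z.2), thetaB (UpperHalfPlane.ofComplex z.2)))
    ((p.1 : ℂ), (p.2 : ℂ)) ?_
  exact (DifferentiableAt.comp (f := Prod.fst) ((p.1 : ℂ), (p.2 : ℂ)) h1
    differentiableAt_fst).prodMk ((DifferentiableAt.comp (f := Prod.fst) ((p.1 : ℂ), (p.2 : ℂ)) h3
    differentiableAt_fst).prodMk ((DifferentiableAt.comp (f := Prod.snd) ((p.1 : ℂ), (p.2 : ℂ)) h2
    differentiableAt_snd).prodMk (DifferentiableAt.comp (f := Prod.snd) ((p.1 : ℂ), (p.2 : ℂ)) h4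
    differentiableAt_snd)))

lemma isMeromorphic_of_quotient {f : ℍ × ℍ → ℂ} {G H : ℂ × ℂ × ℂ × ℂ → ℂ}
    (hG : Differentiable ℂ G) (hH : Differentiable ℂ H)
    (hd : Dense {p : ℍ × ℍ | H (thetaA p.1, thetaB p.1, thetaA p.2, thetaB p.2) ≠ 0})
    (hf : ∀ p : ℍ × ℍ, H (thetaA p.1, thetaB p.1, thetaA p.2, thetaB p.2) ≠ 0 →
      f p = G (thetaA p.1, thetaB p.1, thetaA p.2, thetaB p.2) /
        H (thetaA p.1, thetaB p.1, thetaA p.2, thetaB p.2)) : IsMeromorphic f := by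
  intro p
  refine ⟨Set.univ, _, _, isOpen_univ, Set.mem_univ p, holomorphicOn_polynomial hG _,
    holomorphicOn_polynomial hH _, ?_, fun q _ hq => hf q hq⟩
  rw [interior_eq_empty_iff_dense_compl]
  convert hd using 1
  ext q
  simp

/-! ### Behaviour at the cusps -/

lemma meromorphicAtCuspsFst_of_bounded {f : ℍ × ℍ → ℂ}
    (hf : ∀ γ : SL(2, ℤ), Dense {τ₀ : ℍ | ∃ (D : Set (ℍ × ℍ)) (K : ℝ), IsOpen D ∧ Dense D ∧
      ∀ᶠ p in UpperHalfPlane.atImInfty ×ˢ 𝓝 τ₀, p ∈ D → ‖f (γ • p.1, p.2)‖ ≤ K}) :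
    MeromorphicAtCuspsFst f := by
  intro γ
  refine (hf γ).mono ?_
  rintro τ₀ ⟨D, K, hD1, hD2, hK⟩
  obtain ⟨S, hS, N, hN, h⟩ := Filter.eventually_prod_iff.mp hK
  obtain ⟨A, hA⟩ := (UpperHalfPlane.atImInfty_mem _).mp hS
  -- With C at least 1, A and K, the bound exp(C Im τ) ≥ C Im τ + 1 exceeds K as soon as Im τ ≥ C.
  refine ⟨{τ | N τ}, hN, max 1 (max A K), D, hD1, hD2, fun p hp hpN hC => ?_⟩
  set C := max 1 (max A K)
  have h1 : 1 ≤ C := le_max_left _ _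
  have h2 : A ≤ C := (le_max_left _ _).trans (le_max_right _ _)
  have h3 : K ≤ C := (le_max_right _ _).trans (le_max_right _ _)
  refine (h (hA _ (h2.trans hC)) hpN hp).trans ?_
  have h4 := Real.add_one_le_exp (C * p.1.im)
  nlinarith

open Polynomial in
/-- The exceptional values of `t₂` near a cusp in the first variable. -/
lemma exists_finite_exceptional {A B : ℂ} (h : A ≠ 0 ∨ B ≠ 0) : ∃ F : Set ℂ, F.Finite ∧
    ∀ s ∉ F, A ^ 2 + 4 * B * s * (B + A * s) ≠ 0 ∧ B * A + A ^ 2 * s - 2 * B ^ 2 * s ^ 2 ≠ 0 := by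
  set q : ℂ[X] := C (A ^ 2) + C (4 * B ^ 2) * X + C (4 * A * B) * X ^ 2 with hq
  set r : ℂ[X] := C (B * A) + C (A ^ 2) * X + C (-2 * B ^ 2) * X ^ 2 with hr
  have hq0 : q ≠ 0 := by
    intro h0
    have c0 := congrArg (fun p : ℂ[X] => p.coeff 0) h0
    have c1 := congrArg (fun p : ℂ[X] => p.coeff 1) h0
    simp [hq, coeff_X, coeff_C, -map_mul, -map_pow] at c0 c1
    rcases h with h | h <;> contradiction
  have hr0 : r ≠ 0 := by
    intro h0
    have c1 := congrArg (fun p : ℂ[X] => p.coeff 1) h0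
    have c2 := congrArg (fun p : ℂ[X] => p.coeff 2) h0
    simp [hr, coeff_C, -map_mul, -map_pow, -map_neg] at c1 c2
    rcases h with h | h <;> contradiction
  refine ⟨{s | q.IsRoot s} ∪ {s | r.IsRoot s}, (q.finite_setOfPred_isRoot hq0).union
    (r.finite_setOfPred_isRoot hr0), fun s hs => ?_⟩
  simp only [Set.mem_union, Set.mem_ofPred_eq, not_or, IsRoot.def] at hs
  refine ⟨fun h0 => hs.1 ?_, fun h0 => hs.2 ?_⟩
  · rw [← h0, hq]; simp; ring
  · rw [← h0, hr]; simp; ring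

end Bimodular

end

noncomputable section

namespace Bimodular

open Complex Filter Matrix

/-! ### Invariant functions of the theta vectors -/

lemma isPair_Gamma0 :
    IsPair (CongruenceSubgroup.Gamma0 9) (normalizerReal (CongruenceSubgroup.Gamma0 9)) :=
  ⟨CongruenceSubgroup.Gamma0_is_congruence 9, Subgroup.le_normalizer, le_rfl⟩

lemma dense_preimage_smul (g : SL(2, ℝ)) : Dense {τ : ℍ | thetaA (g • τ) ≠ 0} :=
  dense_thetaA_ne_zero.preimage (isOpenMap_smul g)

lemma isOpen_preimage_smul (g : SL(2, ℝ)) : IsOpen {τ : ℍ | thetaA (g • τ) ≠ 0} :=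
  isOpen_ne_fun (continuous_thetaA.comp (continuous_const_smul g)) continuous_const

lemma isOpen_thetaA_ne_zero : IsOpen {τ : ℍ | thetaA τ ≠ 0} :=
  isOpen_ne_fun continuous_thetaA continuous_const

lemma meroEq_of_forall {f h : ℍ × ℍ → ℂ} {S T : Set ℍ} (hS : IsOpen S) (hS' : Dense S)
    (hT : IsOpen T) (hT' : Dense T) (hf : ∀ p : ℍ × ℍ, p.1 ∈ S → p.2 ∈ T → f p = h p) :
    MeroEq f h :=
  ⟨S ×ˢ T, hS.prod hT, hS'.prod hT', fun p hp => hf p hp.1 hp.2⟩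

lemma polyD_wVec (u : Fin 2 → ℂ) {τ : ℍ} (h : thetaA τ ≠ 0) : polyD u (wVec τ) =
    thetaA τ ^ 2 * (vecA u ^ 2 + 4 * vecB u * t τ * (vecB u + vecA u * t τ)) := by
  rw [polyD, vecA_wVec, vecB_wVec, t]
  field_simp

lemma polyN_wVec (u : Fin 2 → ℂ) {τ : ℍ} (h : thetaA τ ≠ 0) : polyN u (wVec τ) =
    thetaA τ ^ 2 * (vecB u * vecA u + vecA u ^ 2 * t τ - 2 * vecB u ^ 2 * t τ ^ 2) := by
  rw [polyN, vecA_wVec, vecB_wVec, t]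
  field_simp

lemma vecA_ne_zero_or {u : Fin 2 → ℂ} (hu : u ≠ 0) : vecA u ≠ 0 ∨ vecB u ≠ 0 := by
  by_contra! h
  refine hu ?_
  obtain ⟨h1, h2⟩ := h
  rw [vecA] at h1
  rw [vecB] at h2
  ext i
  fin_cases i
  · change u 0 = 0; linear_combination h1 / 3 + 2 / 3 * h2
  · change u 1 = 0; linear_combination h1 / 3 - h2 / 3

/-- A function of the two theta vectors that is homogeneous of degree zero, invariant under the
matrices that preserve the basic polynomials, and regular off the zeros of these. -/
structure IsInvariant (H : (Fin 2 → ℂ) → (Fin 2 → ℂ) → ℂ) : Prop where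
  smul : ∀ {k l : ℂ}, k ≠ 0 → l ≠ 0 → ∀ u v, H (k • u) (l • v) = H u v
  preserves : ∀ {R}, Preserves R → ∀ u v, H (R *ᵥ u) (R *ᵥ v) = H u v
  continuousAt : ∀ {u v}, polyD u v ≠ 0 → polyN u v ≠ 0 →
    ContinuousAt (fun p : (Fin 2 → ℂ) × (Fin 2 → ℂ) => H p.1 p.2) (u, v)

variable {H : (Fin 2 → ℂ) → (Fin 2 → ℂ) → ℂ} {f : ℍ × ℍ → ℂ}

/-- Up to a scalar, which homogeneity removes, the first theta vector tends to the nonzero vector u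
= R(1, 0) at the cusp. For τ₀ off the finitely many exceptional values of t, the function H is
continuous at (u, `wVec τ₀`), so f is even bounded there. -/
lemma IsInvariant.meromorphicAtCuspsFst (hH : IsInvariant H)
    (hf : ∀ p : ℍ × ℍ, thetaA p.1 ≠ 0 → thetaA p.2 ≠ 0 → f p = H (wVec p.1) (wVec p.2)) :
    MeromorphicAtCuspsFst f := by
  refine meromorphicAtCuspsFst_of_bounded fun γ => ?_
  obtain ⟨R, h, B, hh, hR, hγ⟩ := wVec_smul γ
  set u : Fin 2 → ℂ := R *ᵥ ![1, 0] with hu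
  have hu0 : u ≠ 0 := by
    intro h0
    have := Matrix.eq_zero_of_mulVec_eq_zero hR h0
    simpa using congrFun this 0
  obtain ⟨F, hF, hF'⟩ := exists_finite_exceptional (vecA_ne_zero_or hu0)
  refine (dense_generic hF).mono ?_
  rintro τ₀ ⟨hA, ht⟩
  obtain ⟨h1, h2⟩ := hF' _ ht
  have hc := hH.continuousAt (u := u) (v := wVec τ₀)
    (by rw [polyD_wVec u hA]; exact mul_ne_zero (pow_ne_zero 2 hA) h1)
    (by rw [polyN_wVec u hA]; exact mul_ne_zero (pow_ne_zero 2 hA) h2)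
  have hlim : Tendsto (fun p : ℍ × ℍ => (R *ᵥ thVec (affineMap h B hh p.1), wVec p.2))
      (UpperHalfPlane.atImInfty ×ˢ 𝓝 τ₀) (𝓝 (u, wVec τ₀)) := by
    refine Tendsto.prodMk_nhds ?_ (continuous_wVec.continuousAt.tendsto.comp tendsto_snd)
    exact ((Continuous.matrix_mulVec continuous_const continuous_id).tendsto _).comp
      ((tendsto_thVec_affineMap hh).comp tendsto_fst)
  refine ⟨{τ | thetaA (intToReal γ • τ) ≠ 0} ×ˢ {τ | thetaA τ ≠ 0}, ‖H u (wVec τ₀)‖ + 1,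
    (isOpen_preimage_smul _).prod isOpen_thetaA_ne_zero,
    (dense_preimage_smul _).prod dense_thetaA_ne_zero, ?_⟩
  have hev := ((hc.tendsto.comp hlim).norm).eventually_le_const
    (lt_add_one ‖H u (wVec τ₀)‖)
  filter_upwards [hev] with p hp hpD
  rw [hf (γ • p.1, p.2) (by simpa [intToReal_smul] using hpD.1) hpD.2]
  change ‖H (wVec (γ • p.1)) (wVec p.2)‖ ≤ _
  have hk : ((h : ℂ) / 3 * autFactor (intToReal γ) p.1) ≠ 0 :=
    mul_ne_zero (div_ne_zero (by exact_mod_cast hh.ne') (by norm_num)) (autFactor_ne_zero _ _)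
  have e := hH.smul hk one_ne_zero (R *ᵥ thVec (affineMap h B hh p.1)) (wVec p.2)
  rw [one_smul] at e
  rw [hγ, e]
  exact hp

lemma thetaA_smul_ne_zero {γ : SL(2, ℤ)} (hγ : γ ∈ CongruenceSubgroup.Gamma0 9) {τ : ℍ}
    (h : thetaA τ ≠ 0) : thetaA (γ • τ) ≠ 0 := by
  obtain ⟨e, he, hw⟩ := wVec_of_Gamma0 hγ
  have he0 : e ≠ 0 := by rintro rfl; norm_num at he
  rw [← vecA_wVec, hw, vecA_smul, vecA_wVec]
  exact mul_ne_zero (mul_ne_zero (autFactor_ne_zero _ _) he0) h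

lemma IsInvariant.law_fst (hH : IsInvariant H)
    (hf : ∀ p : ℍ × ℍ, thetaA p.1 ≠ 0 → thetaA p.2 ≠ 0 → f p = H (wVec p.1) (wVec p.2))
    {γ : SL(2, ℤ)} (hγ : γ ∈ CongruenceSubgroup.Gamma0 9) :
    MeroEq (fun p => f (γ • p.1, p.2)) f := by
  refine meroEq_of_forall isOpen_thetaA_ne_zero dense_thetaA_ne_zero isOpen_thetaA_ne_zero
    dense_thetaA_ne_zero fun p h1 h2 => ?_
  obtain ⟨e, he, hw⟩ := wVec_of_Gamma0 hγ
  have he0 : e ≠ 0 := by rintro rfl; norm_num at he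
  have h3 := hH.smul (mul_ne_zero (autFactor_ne_zero (intToReal γ) p.1) he0) one_ne_zero
    (wVec p.1) (wVec p.2)
  rw [one_smul, ← hw] at h3
  exact (hf (γ • p.1, p.2) (thetaA_smul_ne_zero hγ h1) h2).trans (h3.trans (hf p h1 h2).symm)

lemma MeroEq.comp_swap {f g : ℍ × ℍ → ℂ} (h : MeroEq f g) :
    MeroEq (fun p => f p.swap) (fun p => g p.swap) := by
  obtain ⟨U, hU, hU', h⟩ := h
  exact ⟨Prod.swap ⁻¹' U, hU.preimage continuous_swap,
    hU'.preimage (Homeomorph.prodComm ℍ ℍ).isOpenMap, fun p hp => h _ hp⟩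

/-- An element of the normalizer may move a zero of `thetaA` to a nonzero, so the identity is taken
where `thetaA` vanishes at neither τ nor gτ. -/
lemma IsInvariant.law_diag (hH : IsInvariant H)
    (hf : ∀ p : ℍ × ℍ, thetaA p.1 ≠ 0 → thetaA p.2 ≠ 0 → f p = H (wVec p.1) (wVec p.2))
    {g : SL(2, ℝ)} (hg : g ∈ normalizerReal (CongruenceSubgroup.Gamma0 9)) :
    MeroEq (fun p => f (g • p.1, g • p.2)) f := by
  have ho := isOpen_thetaA_ne_zero.inter (isOpen_preimage_smul g)
  have hd := dense_thetaA_ne_zero.inter_of_isOpen_left (dense_preimage_smul g)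
    isOpen_thetaA_ne_zero
  refine meroEq_of_forall ho hd ho hd fun p h1 h2 => ?_
  obtain ⟨R, hR, hw⟩ := wVec_of_normalizer hg
  have h3 := hH.smul (autFactor_ne_zero g p.1) (autFactor_ne_zero g p.2)
    (R *ᵥ wVec p.1) (R *ᵥ wVec p.2)
  rw [← hw, ← hw, hH.preserves hR] at h3
  exact (hf (g • p.1, g • p.2) h1.2 h2.2).trans (h3.trans (hf p h1.1 h2.1).symm)

theorem IsInvariant.isBimodularFunction (hH : IsInvariant H) (hm : IsMeromorphic f)
    (hf : ∀ p : ℍ × ℍ, thetaA p.1 ≠ 0 → thetaA p.2 ≠ 0 → f p = H (wVec p.1) (wVec p.2))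
    (hs : ∀ p, f p.swap = f p) :
    IsBimodularFunction (CongruenceSubgroup.Gamma0 9)
      (normalizerReal (CongruenceSubgroup.Gamma0 9)) f := by
  have hs' : (fun p : ℍ × ℍ => f p.swap) = f := funext hs
  refine ⟨isPair_Gamma0, hm, hH.meromorphicAtCuspsFst hf, ?_, fun γ hγ => hH.law_fst hf hγ,
    fun γ hγ => ?_, fun g hg => hH.law_diag hf hg⟩
  · rw [hs']
    exact hH.meromorphicAtCuspsFst hf
  · have h := (hH.law_fst hf hγ).comp_swap
    rw [hs'] at h
    exact (funext fun p : ℍ × ℍ => hs (p.1, γ • p.2)) ▸ h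

/-! ### The functions `x` and `y` -/

lemma continuous_polyD : Continuous fun p : (Fin 2 → ℂ) × (Fin 2 → ℂ) => polyD p.1 p.2 := by
  simp only [polyD_eq]; fun_prop

lemma continuous_polyN : Continuous fun p : (Fin 2 → ℂ) × (Fin 2 → ℂ) => polyN p.1 p.2 := by
  simp only [polyN_eq]; fun_prop

lemma continuous_polyE : Continuous polyE := by
  simp only [funext polyE_eq]; fun_prop

/-- The cube in x removes the cube root of unity by which N changes. -/
lemma isInvariant_homX : IsInvariant homX where
  smul hk hl := homX_smul hk hl
  preserves := by
    rintro R ⟨-, hD, c, hc, hN, -⟩ u v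
    rw [homX, hD, hN, mul_div_assoc, mul_pow, hc, one_mul, homX]
  continuousAt hD _ := (ContinuousAt.div (continuous_polyN.continuousAt (x := (_, _)))
    (continuous_polyD.continuousAt (x := (_, _))) hD).pow 3

/-- The factor c² from the product of the two E cancels that of N². -/
lemma isInvariant_homY : IsInvariant homY where
  smul hk hl := homY_smul hk hl
  preserves := by
    rintro R ⟨-, -, c, hc, hN, hE⟩ u v
    have hc0 : c ≠ 0 := by rintro rfl; norm_num at hc
    rw [homY, hE, hN, mul_pow, mul_div_mul_left _ _ (pow_ne_zero 2 hc0), homY]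
  continuousAt _ hN := ContinuousAt.div (((continuous_polyE.comp continuous_fst).mul
    (continuous_polyE.comp continuous_snd)).continuousAt (x := (_, _)))
      ((continuous_polyN.pow 2).continuousAt (x := (_, _))) (pow_ne_zero 2 hN)

open Polynomial in
open scoped Polynomial.Bivariate in
lemma dense_denQ_ne_zero :
    Dense {p : ℍ × ℍ | thetaA p.1 ≠ 0 ∧ thetaA p.2 ≠ 0 ∧ denQ p ≠ 0} := by
  set q : ℂ[X][Y] := 1 + 4 * C X * Y * (C X + Y) with hq
  have e (a b : ℂ) : q.evalEval a b = 1 + 4 * a * b * (a + b) := by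
    simp [hq, evalEval]
  have h0 : q ≠ 0 := by
    intro h
    have := e 0 0
    rw [h] at this
    simp at this
  refine (dense_bivariate h0).mono ?_
  rintro p ⟨h1, h2, h3⟩
  rw [e] at h3
  exact ⟨h1, h2, h3⟩

open Polynomial in
open scoped Polynomial.Bivariate in
lemma dense_numP_ne_zero :
    Dense {p : ℍ × ℍ | thetaA p.1 ≠ 0 ∧ thetaA p.2 ≠ 0 ∧ numP p ≠ 0} := by
  set q : ℂ[X][Y] := C X + Y - 2 * C X ^ 2 * Y ^ 2 with hq
  have e (a b : ℂ) : q.evalEval a b = a + b - 2 * a ^ 2 * b ^ 2 := by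
    simp [hq, evalEval]
  have h0 : q ≠ 0 := by
    intro h
    have := e 1 0
    rw [h] at this
    simp at this
  refine (dense_bivariate h0).mono ?_
  rintro p ⟨h1, h2, h3⟩
  rw [e] at h3
  exact ⟨h1, h2, h3⟩

/-- The polynomial `polyD` in the coordinates `a₁, b₁, a₂, b₂`. -/
def abD (w : ℂ × ℂ × ℂ × ℂ) : ℂ := w.1 ^ 2 * w.2.2.1 ^ 2 +
  4 * w.2.1 * w.2.2.2 * (w.2.1 * w.2.2.1 + w.1 * w.2.2.2)

/-- The polynomial `polyN` in the coordinates `a₁, b₁, a₂, b₂`. -/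
def abN (w : ℂ × ℂ × ℂ × ℂ) : ℂ := w.2.1 * w.1 * w.2.2.1 ^ 2 +
  w.1 ^ 2 * (w.2.2.1 * w.2.2.2) - 2 * w.2.1 ^ 2 * w.2.2.2 ^ 2

lemma polyD_eq_abD (p : ℍ × ℍ) : polyD (wVec p.1) (wVec p.2) =
    abD (thetaA p.1, thetaB p.1, thetaA p.2, thetaB p.2) := by
  rw [polyD, vecA_wVec, vecB_wVec, vecA_wVec, vecB_wVec]; rfl

lemma polyN_eq_abN (p : ℍ × ℍ) : polyN (wVec p.1) (wVec p.2) =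
    abN (thetaA p.1, thetaB p.1, thetaA p.2, thetaB p.2) := by
  rw [polyN, vecA_wVec, vecB_wVec, vecA_wVec, vecB_wVec]; rfl

lemma isMeromorphic_x : IsMeromorphic x := by
  -- The common factor a₁a₂ makes the denominator vanish wherever t₁ or t₂ is a division by zero
  -- with default value 0, so no claim is made there.
  refine isMeromorphic_of_quotient (G := fun w => abN w ^ 3 * (w.1 * w.2.2.1))
    (H := fun w => abD w ^ 3 * (w.1 * w.2.2.1)) (by unfold abN; fun_prop)
    (by unfold abD; fun_prop) ?_ ?_
  · refine dense_denQ_ne_zero.mono ?_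
    rintro p ⟨h1, h2, h3⟩
    rw [denQ_eq h1 h2, polyD_eq_abD] at h3
    exact mul_ne_zero (pow_ne_zero 3 (div_ne_zero_iff.mp h3).1) (mul_ne_zero h1 h2)
  · intro p hp
    have ha := right_ne_zero_of_mul hp
    have h1 : thetaA p.1 ≠ 0 := left_ne_zero_of_mul ha
    have h2 : thetaA p.2 ≠ 0 := right_ne_zero_of_mul ha
    rw [x_eq h1 h2, homX, polyN_eq_abN, polyD_eq_abD, div_pow, mul_div_mul_right _ _ ha]

lemma isMeromorphic_y : IsMeromorphic y := by
  refine isMeromorphic_of_quotient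
    (G := fun w => (w.2.1 * (w.1 ^ 3 - w.2.1 ^ 3)) * (w.2.2.2 * (w.2.2.1 ^ 3 - w.2.2.2 ^ 3)) *
      (w.1 * w.2.2.1))
    (H := fun w => abN w ^ 2 * (w.1 * w.2.2.1)) (by fun_prop) (by unfold abN; fun_prop) ?_ ?_
  · refine dense_numP_ne_zero.mono ?_
    rintro p ⟨h1, h2, h3⟩
    rw [numP_eq h1 h2, polyN_eq_abN] at h3
    exact mul_ne_zero (pow_ne_zero 2 (div_ne_zero_iff.mp h3).1) (mul_ne_zero h1 h2)
  · intro p hp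
    have ha := right_ne_zero_of_mul hp
    have h1 : thetaA p.1 ≠ 0 := left_ne_zero_of_mul ha
    have h2 : thetaA p.2 ≠ 0 := right_ne_zero_of_mul ha
    rw [y_eq h1 h2, homY, polyN_eq_abN, polyE, polyE, vecA_wVec, vecB_wVec, vecA_wVec, vecB_wVec,
      mul_div_mul_right _ _ ha]

theorem isBimodularFunction_x : IsBimodularFunction (CongruenceSubgroup.Gamma0 9)
    (normalizerReal (CongruenceSubgroup.Gamma0 9)) x :=
  isInvariant_homX.isBimodularFunction isMeromorphic_x (fun _ => x_eq) x_swap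

theorem isBimodularFunction_y : IsBimodularFunction (CongruenceSubgroup.Gamma0 9)
    (normalizerReal (CongruenceSubgroup.Gamma0 9)) y :=
  isInvariant_homY.isBimodularFunction isMeromorphic_y (fun _ => y_eq) y_swap

/-! ### The form `F²` -/

/-- The form `F²`. -/
def formF2 (p : ℍ × ℍ) : ℂ := 1 / 9 * polyD (wVec p.1) (wVec p.2)

lemma formF2_swap (p : ℍ × ℍ) : formF2 p.swap = formF2 p := by
  rw [formF2, formF2, polyD_eq, polyD_eq, Prod.fst_swap, Prod.snd_swap]; ring

lemma formF2_smul_fst {γ : SL(2, ℤ)} (hγ : γ ∈ CongruenceSubgroup.Gamma0 9) (τ₁ τ₂ : ℍ) :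
    formF2 (γ • τ₁, τ₂) = autFactor (intToReal γ) τ₁ ^ 2 * formF2 (τ₁, τ₂) := by
  obtain ⟨e, he, hw⟩ := wVec_of_Gamma0 hγ
  have h := polyD_smul (autFactor (intToReal γ) τ₁ * e) 1 (wVec τ₁) (wVec τ₂)
  rw [one_smul] at h
  rw [formF2, formF2, hw, h]
  linear_combination 1 / 9 * polyD (wVec τ₁) (wVec τ₂) * autFactor (intToReal γ) τ₁ ^ 2 * he

lemma isBoundedAtImInfty_formF2 (γ : SL(2, ℤ)) (τ₂ : ℍ) :
    UpperHalfPlane.IsBoundedAtImInfty ((fun τ₁ : ℍ => formF2 (τ₁, τ₂)) ∣[(2 : ℤ)] γ) := by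
  obtain ⟨R, h, B, hh, hR, hγ⟩ := wVec_smul γ
  have hlim : Tendsto (fun τ : ℍ => (R *ᵥ thVec (affineMap h B hh τ), wVec τ₂))
      UpperHalfPlane.atImInfty (𝓝 (R *ᵥ ![1, 0], wVec τ₂)) := by
    refine Tendsto.prodMk_nhds ?_ tendsto_const_nhds
    exact ((Continuous.matrix_mulVec continuous_const continuous_id).tendsto _).comp
      (tendsto_thVec_affineMap hh)
  have h2 := ((continuous_polyD.tendsto _).comp hlim).const_mul (1 / 9 * ((h : ℂ) / 3) ^ 2)
  refine (h2.congr fun τ => ?_).isBigO_one ℝ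
  have e := polyD_smul ((h : ℂ) / 3 * autFactor (intToReal γ) τ) 1
    (R *ᵥ thVec (affineMap h B hh τ)) (wVec τ₂)
  rw [one_smul] at e
  rw [ModularForm.SL_slash_apply, formF2, hγ, e]
  have hj : UpperHalfPlane.denom γ τ = autFactor (intToReal γ) τ := rfl
  have h0 := autFactor_ne_zero (intToReal γ) τ
  rw [hj, _root_.zpow_neg, Function.comp_apply]
  change _ = _ * (autFactor (intToReal γ) τ ^ 2)⁻¹
  field_simp

theorem isBimodularForm_formF2 : IsBimodularForm 2 (CongruenceSubgroup.Gamma0 9)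
    (normalizerReal (CongruenceSubgroup.Gamma0 9)) 1 1 formF2 where
  pair := isPair_Gamma0
  compat _ _ _ := by simp
  holo := by
    have : formF2 = fun p => (fun w => 1 / 9 * abD w)
        (thetaA p.1, thetaB p.1, thetaA p.2, thetaB p.2) :=
      funext fun p => by rw [formF2, polyD_eq_abD]
    rw [this]
    exact holomorphicOn_polynomial (G := fun w => 1 / 9 * abD w) (by unfold abD; fun_prop) _
  law_fst γ τ₁ τ₂ := by
    rw [formF2_smul_fst γ.2, MonoidHom.one_apply, Units.val_one, one_mul]
    rfl
  law_snd γ τ₁ τ₂ := by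
    rw [← formF2_swap, Prod.swap_prod_mk, formF2_smul_fst γ.2, ← formF2_swap, MonoidHom.one_apply,
      Units.val_one, one_mul]
    rfl
  cusps_fst := isBoundedAtImInfty_formF2
  cusps_snd γ τ₁ := by
    have : (fun τ₂ : ℍ => formF2 (τ₁, τ₂)) = fun τ₂ => formF2 (τ₂, τ₁) :=
      funext fun τ₂ => formF2_swap (τ₂, τ₁)
    rw [this]
    exact isBoundedAtImInfty_formF2 γ τ₁
  law_diag g τ₁ τ₂ := by
    obtain ⟨R, hR, hw⟩ := wVec_of_normalizer g.2
    rw [formF2, hw, hw, polyD_smul, hR.2.1, MonoidHom.one_apply, Units.val_one, one_mul, formF2]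
    rw [zpow_ofNat, zpow_ofNat]
    ring

lemma formF2_eq {p : ℍ × ℍ} (h1 : thetaA p.1 ≠ 0) (h2 : thetaA p.2 ≠ 0) {w : ℂ}
    (hw : w ^ 2 = denQ p) : formF2 p = valF w p ^ 2 := by
  rw [denQ_eq h1 h2] at hw
  rw [formF2, valF, mul_pow, mul_pow, mul_pow, hw]
  field_simp
  ring

end Bimodular

end

/-! ### Holomorphy of derivatives, and the system in normal form -/

noncomputable section

namespace Bimodular

open Complex Filter Matrix

/-! ### Derivatives of holomorphic functions of several variables -/

/-- The directional derivatives of a holomorphic function of two variables are holomorphic. -/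
theorem differentiableOn_fderiv_apply {V : Set (ℂ × ℂ)} (hV : IsOpen V) {Φ : ℂ × ℂ → ℂ}
    (h : DifferentiableOn ℂ Φ V) (v : ℂ × ℂ) :
    DifferentiableOn ℂ (fun p => fderiv ℂ Φ p v) V := by
  intro p₀ hp₀
  refine DifferentiableAt.differentiableWithinAt ?_
  have hc : ContinuousAt Φ p₀ := (h.differentiableAt (hV.mem_nhds hp₀)).continuousAt
  obtain ⟨ε, hε, hball⟩ := Metric.mem_nhds_iff.mp (inter_mem (hV.mem_nhds hp₀)
    (hc.preimage_mem_nhds (Metric.ball_mem_nhds (Φ p₀) one_pos)))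
  -- For p within R of p₀, the circle p + zv with |z| = r stays within 2R of p₀, and balls of radius
  -- R around its points stay in the ball of radius ε.
  set R := ε / 4 with hR
  have hR0 : 0 < R := by positivity
  set r := R / (‖v‖ + 1) with hr
  have hr0 : 0 < r := by positivity
  have hrv : r * ‖v‖ < R := by
    rw [hr, div_mul_eq_mul_div, div_lt_iff₀ (by positivity)]
    nlinarith [norm_nonneg v]
  have hmem {p : ℂ × ℂ} (hp : p ∈ Metric.ball p₀ R) {z : ℂ} (hz : ‖z‖ ≤ r) :
      p + z • v ∈ Metric.ball p₀ (2 * R) := by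
    rw [mem_ball_iff_norm] at hp ⊢
    have h1 : ‖z • v‖ ≤ r * ‖v‖ := by rw [norm_smul]; gcongr
    calc ‖p + z • v - p₀‖ = ‖(p - p₀) + z • v‖ := by congr 1; abel
      _ ≤ ‖p - p₀‖ + ‖z • v‖ := norm_add_le _ _
      _ < 2 * R := by linarith
  have hsub : Metric.ball p₀ (2 * R) ⊆ V := fun q hq =>
    (hball (Metric.ball_subset_ball (by linarith) hq)).1
  -- On the ball of radius ε, Φ stays within 1 of `Φ p₀`, hence varies by less than 2; a
  -- Schwarz-type estimate bounds the derivative.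
  have hbound {q : ℂ × ℂ} (hq : q ∈ Metric.ball p₀ (2 * R)) : ‖fderiv ℂ Φ q‖ ≤ 2 / R := by
    have hb : Metric.ball q R ⊆ Metric.ball p₀ ε :=
      Metric.ball_subset_ball' (by have := Metric.mem_ball.mp hq; linarith)
    refine norm_fderiv_le_div_of_mapsTo_ball (h.mono fun z hz => (hball (hb hz)).1) ?_ hR0
    intro z hz
    have h1 : dist (Φ z) (Φ p₀) < 1 := (hball (hb hz)).2
    have h2 : dist (Φ q) (Φ p₀) < 1 := (hball (hb (Metric.mem_ball_self hR0))).2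
    rw [Metric.mem_closedBall]
    linarith [dist_triangle_right (Φ z) (Φ q) (Φ p₀)]
  have hdiff {q : ℂ × ℂ} (hq : q ∈ Metric.ball p₀ (2 * R)) : DifferentiableAt ℂ Φ q :=
    h.differentiableAt (hV.mem_nhds (hsub hq))
  have hcirc (θ : ℝ) : ‖circleMap 0 r θ‖ ≤ r := by simp [abs_of_pos hr0]
  set k : ℝ → ℂ := fun θ => (2 * Real.pi * I : ℂ)⁻¹ * (deriv (circleMap 0 r) θ *
    ((circleMap 0 r θ) ^ 2)⁻¹) with hk
  have hkc : Continuous k := by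
    refine continuous_const.mul (Continuous.mul ?_ (((continuous_circleMap 0 r).pow 2).inv₀
      fun θ => pow_ne_zero 2 (circleMap_ne_center hr0.ne')))
    simp_rw [funext fun θ => deriv_circleMap 0 r θ]
    have := continuous_circleMap 0 r
    fun_prop
  -- Cauchy's formula for the derivative along the line p + zv. The kernel `k` does not depend on p,
  -- so differentiability in p follows by differentiating under the integral.
  have hrep {p : ℂ × ℂ} (hp : p ∈ Metric.ball p₀ R) :
      fderiv ℂ Φ p v = ∫ θ in (0 : ℝ)..2 * Real.pi, k θ * Φ (p + circleMap 0 r θ • v) := by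
    have hline : Continuous fun z : ℂ => p + z • v := by fun_prop
    have hd : DifferentiableOn ℂ (fun z : ℂ => Φ (p + z • v)) ((fun z : ℂ => p + z • v) ⁻¹' V) :=
      h.comp (by fun_prop) (fun z hz => hz)
    have := two_pi_I_inv_smul_circleIntegral_sub_sq_inv_smul_of_differentiable
      (hV.preimage hline) (c := 0) (R := r) (fun z hz => hsub (hmem hp (by simpa using hz))) hd
      (Metric.mem_ball_self hr0)
    have hder : deriv (fun z : ℂ => Φ (p + z • v)) 0 = fderiv ℂ Φ p v := by
      have hd0 : DifferentiableAt ℂ Φ (p + (0 : ℂ) • v) := by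
        rw [zero_smul, add_zero]
        exact hdiff (Metric.ball_subset_ball (by linarith) hp)
      have h1 : HasDerivAt (fun z : ℂ => p + z • v) v 0 := by
        simpa using ((hasDerivAt_id (0 : ℂ)).smul_const v).const_add p
      have := (hd0.hasFDerivAt.comp_hasDerivAt (0 : ℂ) h1).deriv
      rwa [zero_smul, add_zero] at this
    rw [← hder, ← this, circleIntegral, smul_eq_mul, ← intervalIntegral.integral_const_mul]
    refine intervalIntegral.integral_congr fun θ _ => ?_
    simp only [hk, smul_eq_mul, sub_zero]
    ring
  have hFc {p : ℂ × ℂ} (hp : p ∈ Metric.ball p₀ R) :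
      Continuous fun θ => k θ * Φ (p + circleMap 0 r θ • v) := by
    refine hkc.mul (continuous_iff_continuousAt.mpr fun θ => ?_)
    refine ContinuousAt.comp (f := fun θ => p + circleMap 0 r θ • v)
      (hdiff (hmem hp (hcirc θ))).continuousAt ?_
    have := continuous_circleMap 0 r
    fun_prop
  have hB : Metric.ball p₀ R ∈ 𝓝 p₀ := Metric.ball_mem_nhds _ hR0
  have key := intervalIntegral.hasFDerivAt_integral_of_dominated_of_fderiv_le (𝕜 := ℂ)
    (μ := MeasureTheory.volume) (a := 0) (b := 2 * Real.pi)
    (F := fun p θ => k θ * Φ (p + circleMap 0 r θ • v))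
    (F' := fun p θ => k θ • fderiv ℂ Φ (p + circleMap 0 r θ • v)) (x₀ := p₀)
    (bound := fun θ => ‖k θ‖ * (2 / R)) hB
    (by filter_upwards [hB] with p hp using (hFc hp).aestronglyMeasurable)
    ((hFc (Metric.mem_ball_self hR0)).intervalIntegrable _ _)
    (by
      refine AEMeasurable.aestronglyMeasurable (Measurable.aemeasurable ?_)
      refine hkc.measurable.smul ((measurable_fderiv ℂ Φ).comp ?_)
      have := continuous_circleMap 0 r
      exact Continuous.measurable (by fun_prop))
    (by
      refine Eventually.of_forall fun θ _ p hp => ?_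
      rw [norm_smul]
      gcongr
      exact hbound (hmem hp (hcirc θ)))
    ((hkc.norm.mul continuous_const).intervalIntegrable _ _)
    (by
      refine Eventually.of_forall fun θ _ p hp => ?_
      have h1 : HasFDerivAt (fun p : ℂ × ℂ => Φ (p + circleMap 0 r θ • v))
          (fderiv ℂ Φ (p + circleMap 0 r θ • v)) p :=
        hasFDerivAt_comp_add_right _ |>.mpr (hdiff (hmem hp (hcirc θ))).hasFDerivAt
      exact h1.const_mul (k θ))
  refine key.differentiableAt.congr_of_eventuallyEq ?_
  filter_upwards [hB] with p hp using hrep hp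

end Bimodular

end

noncomputable section

namespace Bimodular

open Complex Filter Matrix

/-! ### The operators `θ_x` and `θ_y` -/

section Theta

variable {V : Set (ℂ × ℂ)} {Φ Ψ : ℂ × ℂ → ℂ} {z : ℂ × ℂ}

lemma hasDerivAt_fst (hV : IsOpen V) (h : DifferentiableOn ℂ Φ V) (hz : z ∈ V) :
    HasDerivAt (fun u => Φ (u, z.2)) (fderiv ℂ Φ z (1, 0)) z.1 :=
  (h.differentiableAt (hV.mem_nhds hz)).hasFDerivAt.comp_hasDerivAt z.1 (f := fun u => (u, z.2))
    ((hasDerivAt_id z.1).prodMk (hasDerivAt_const z.1 z.2))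

lemma hasDerivAt_snd (hV : IsOpen V) (h : DifferentiableOn ℂ Φ V) (hz : z ∈ V) :
    HasDerivAt (fun v => Φ (z.1, v)) (fderiv ℂ Φ z (0, 1)) z.2 :=
  (h.differentiableAt (hV.mem_nhds hz)).hasFDerivAt.comp_hasDerivAt z.2 (f := fun v => (z.1, v))
    ((hasDerivAt_const z.2 z.1).prodMk (hasDerivAt_id z.2))

lemma thetaX_eq (hV : IsOpen V) (h : DifferentiableOn ℂ Φ V) (hz : z ∈ V) :
    thetaX Φ z = z.1 * fderiv ℂ Φ z (1, 0) := by
  rw [thetaX, (hasDerivAt_fst hV h hz).deriv]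

lemma thetaY_eq (hV : IsOpen V) (h : DifferentiableOn ℂ Φ V) (hz : z ∈ V) :
    thetaY Φ z = z.2 * fderiv ℂ Φ z (0, 1) := by
  rw [thetaY, (hasDerivAt_snd hV h hz).deriv]

lemma differentiableOn_thetaX (hV : IsOpen V) (h : DifferentiableOn ℂ Φ V) :
    DifferentiableOn ℂ (thetaX Φ) V :=
  (differentiableOn_fst.mul (differentiableOn_fderiv_apply hV h (1, 0))).congr
    fun _ hz => thetaX_eq hV h hz

lemma differentiableOn_thetaY (hV : IsOpen V) (h : DifferentiableOn ℂ Φ V) :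
    DifferentiableOn ℂ (thetaY Φ) V :=
  (differentiableOn_snd.mul (differentiableOn_fderiv_apply hV h (0, 1))).congr
    fun _ hz => thetaY_eq hV h hz

lemma thetaX_of_hasDerivAt {d : ℂ} (h : HasDerivAt (fun u => Φ (u, z.2)) d z.1) :
    thetaX Φ z = z.1 * d := by
  rw [thetaX, h.deriv]

lemma thetaY_of_hasDerivAt {d : ℂ} (h : HasDerivAt (fun v => Φ (z.1, v)) d z.2) :
    thetaY Φ z = z.2 * d := by
  rw [thetaY, h.deriv]

/-- The derivative of a function along a curve. -/
lemma hasDerivAt_comp_curve (hV : IsOpen V) (h : DifferentiableOn ℂ Φ V) {X Y : ℂ → ℂ}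
    {w k l c : ℂ} (hw : (X w, Y w) ∈ V) (hX : HasDerivAt X (c * (k * X w)) w)
    (hY : HasDerivAt Y (c * (l * Y w)) w) :
    HasDerivAt (fun w => Φ (X w, Y w))
      (c * (k * thetaX Φ (X w, Y w) + l * thetaY Φ (X w, Y w))) w := by
  have h1 := (h.differentiableAt (hV.mem_nhds hw)).hasFDerivAt.comp_hasDerivAt w
    (f := fun w => (X w, Y w)) (hX.prodMk hY)
  refine h1.congr_deriv ?_
  have e : ((c * (k * X w), c * (l * Y w)) : ℂ × ℂ) =
      (c * (k * X w)) • ((1, 0) : ℂ × ℂ) + (c * (l * Y w)) • ((0, 1) : ℂ × ℂ) := by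
    ext <;> simp
  rw [e, map_add, map_smul, map_smul, thetaX_eq hV h hw, thetaY_eq hV h hw, smul_eq_mul,
    smul_eq_mul]
  ring

lemma thetaY_thetaX (hV : IsOpen V) (h : DifferentiableOn ℂ Φ V) (hz : z ∈ V) :
    thetaY (thetaX Φ) z = thetaX (thetaY Φ) z := by
  set D1 : ℂ × ℂ → ℂ := fun p => fderiv ℂ Φ p (1, 0) with hD1
  set D2 : ℂ × ℂ → ℂ := fun p => fderiv ℂ Φ p (0, 1) with hD2
  have h1 : DifferentiableOn ℂ D1 V := differentiableOn_fderiv_apply hV h _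
  have h2 : DifferentiableOn ℂ D2 V := differentiableOn_fderiv_apply hV h _
  have hd1 := (h1.differentiableAt (hV.mem_nhds hz)).hasFDerivAt
  have hd2 := (h2.differentiableAt (hV.mem_nhds hz)).hasFDerivAt
  have e : fderiv ℂ Φ = fun p => D1 p • ContinuousLinearMap.fst ℂ ℂ ℂ +
      D2 p • ContinuousLinearMap.snd ℂ ℂ ℂ := by
    funext p
    ext <;> simp [hD1, hD2]
  have hF := (hd1.smul_const (ContinuousLinearMap.fst ℂ ℂ ℂ)).add
    (hd2.smul_const (ContinuousLinearMap.snd ℂ ℂ ℂ))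
  have hsymm := second_derivative_symmetric_of_eventually (f := Φ) (f' := fderiv ℂ Φ) (x := z)
    (by filter_upwards [hV.mem_nhds hz] with p hp using
      (h.differentiableAt (hV.mem_nhds hp)).hasFDerivAt) (by rw [e]; exact hF) (1, 0) (0, 1)
  have hmix : fderiv ℂ D2 z (1, 0) = fderiv ℂ D1 z (0, 1) := by simpa using hsymm
  have mem1 : ∀ᶠ u in 𝓝 z.1, ((u, z.2) : ℂ × ℂ) ∈ V :=
    (Continuous.prodMk continuous_id continuous_const).continuousAt.eventually
      (hV.mem_nhds (x := (z.1, z.2)) hz)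
  have mem2 : ∀ᶠ v in 𝓝 z.2, ((z.1, v) : ℂ × ℂ) ∈ V :=
    (Continuous.prodMk continuous_const continuous_id).continuousAt.eventually
      (hV.mem_nhds (x := (z.1, z.2)) hz)
  have k1 : HasDerivAt (fun u => thetaY Φ (u, z.2)) (z.2 * fderiv ℂ D2 z (1, 0)) z.1 :=
    ((hasDerivAt_fst hV h2 hz).const_mul z.2).congr_of_eventuallyEq
      (mem1.mono fun u hu => thetaY_eq hV h hu)
  have k2 : HasDerivAt (fun v => thetaX Φ (z.1, v)) (z.1 * fderiv ℂ D1 z (0, 1)) z.2 :=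
    ((hasDerivAt_snd hV h1 hz).const_mul z.1).congr_of_eventuallyEq
      (mem2.mono fun u hu => thetaX_eq hV h hu)
  rw [thetaX_of_hasDerivAt k1, thetaY_of_hasDerivAt k2, hmix]
  ring

/-- The left-hand side of the first equation. -/
def pde₁ (Φ : ℂ × ℂ → ℂ) (z : ℂ × ℂ) : ℂ :=
  -2 * z.1 * (2 * z.2 + 1) * Φ z - z.1 * (9 + 60 * z.2) * thetaX Φ z
    - 6 * z.1 * (1 - 4 * z.2) * thetaY Φ z
    + (9 - 9 * z.1 - 108 * z.1 * z.2) * thetaX (thetaX Φ) z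
    - (6 + 12 * z.1 * (1 - 4 * z.2)) * thetaX (thetaY Φ) z

/-- The left-hand side of the second equation. -/
def pde₂ (Φ : ℂ × ℂ → ℂ) (z : ℂ × ℂ) : ℂ :=
  3 * z.2 * thetaX Φ z - 2 * z.2 * thetaY Φ z - 9 * z.2 * thetaX (thetaX Φ) z
    + 12 * z.2 * thetaX (thetaY Φ) z + (1 - 4 * z.2) * thetaY (thetaY Φ) z

/-- `pde₁` is the operator with all coefficients moved to the left of θ_x and θ_y. Only θ_x is
applied from outside, so factors in y pass through. -/
lemma satisfiesPDE₁_iff (hV : IsOpen V) (h : DifferentiableOn ℂ Φ V) (hz : z ∈ V) :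
    SatisfiesPDE₁ Φ z ↔ pde₁ Φ z = 0 := by
  have h0 := hasDerivAt_fst hV h hz
  have hX := hasDerivAt_fst hV (differentiableOn_thetaX hV h) hz
  have hY := hasDerivAt_fst hV (differentiableOn_thetaY hV h) hz
  have eA := thetaX_of_hasDerivAt (Φ := fun w => 3 * thetaX Φ w - 2 * thetaY Φ w)
    ((hX.const_mul 3).sub (hY.const_mul 2))
  have eB := thetaX_of_hasDerivAt (Φ := fun w => 3 * thetaX Φ w + 2 * Φ w)
    ((hX.const_mul 3).add (h0.const_mul 2))
  have eC := thetaX_of_hasDerivAt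
    (Φ := fun w => (1 - 4 * w.2) * thetaY Φ w + 9 * w.2 * thetaX Φ w)
    ((hY.const_mul (1 - 4 * z.2)).add (hX.const_mul (9 * z.2)))
  rw [SatisfiesPDE₁, pde₁]
  dsimp only
  rw [eA, eB, eC, thetaX_of_hasDerivAt hX, thetaX_of_hasDerivAt hY, thetaX_of_hasDerivAt h0]
  refine Eq.congr_left ?_
  ring

/-- Here both orders of mixed derivatives occur, and commutation of θ_x and θ_y merges them. -/
lemma satisfiesPDE₂_iff (hV : IsOpen V) (h : DifferentiableOn ℂ Φ V) (hz : z ∈ V) :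
    SatisfiesPDE₂ Φ z ↔ pde₂ Φ z = 0 := by
  have hX0 := differentiableOn_thetaX hV h
  have hY0 := differentiableOn_thetaY hV h
  have h0 := hasDerivAt_fst hV h hz
  have hX := hasDerivAt_fst hV hX0 hz
  have hY := hasDerivAt_fst hV hY0 hz
  have k0 := hasDerivAt_snd hV h hz
  have kX := hasDerivAt_snd hV hX0 hz
  have kY := hasDerivAt_snd hV hY0 hz
  have eA := thetaX_of_hasDerivAt (Φ := fun w => 2 * thetaY Φ w - 3 * thetaX Φ w + Φ w)
    (((hY.const_mul 2).sub (hX.const_mul 3)).add h0)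
  have eB := thetaY_of_hasDerivAt (Φ := fun w => 2 * thetaY Φ w - 3 * thetaX Φ w + Φ w)
    (((kY.const_mul 2).sub (kX.const_mul 3)).add k0)
  have hs := thetaY_thetaX hV h hz
  rw [thetaX_of_hasDerivAt hY, thetaY_of_hasDerivAt kX] at hs
  rw [SatisfiesPDE₂, pde₂]
  rw [eA, eB, thetaX_of_hasDerivAt hX, thetaX_of_hasDerivAt hY, thetaX_of_hasDerivAt h0,
    thetaY_of_hasDerivAt k0, thetaY_of_hasDerivAt kY]
  refine Eq.congr_left ?_
  linear_combination 6 * z.2 * hs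

lemma continuousOn_pde₁ (hV : IsOpen V) (h : DifferentiableOn ℂ Φ V) :
    ContinuousOn (pde₁ Φ) V := by
  have h0 := h.continuousOn
  have hX := differentiableOn_thetaX hV h
  have hY := differentiableOn_thetaY hV h
  have hX' := hX.continuousOn
  have hY' := hY.continuousOn
  have hXX := (differentiableOn_thetaX hV hX).continuousOn
  have hXY := (differentiableOn_thetaX hV hY).continuousOn
  unfold pde₁
  fun_prop

lemma continuousOn_pde₂ (hV : IsOpen V) (h : DifferentiableOn ℂ Φ V) :
    ContinuousOn (pde₂ Φ) V := by
  have hX := differentiableOn_thetaX hV h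
  have hY := differentiableOn_thetaY hV h
  have hX' := hX.continuousOn
  have hY' := hY.continuousOn
  have hXX := (differentiableOn_thetaX hV hX).continuousOn
  have hXY := (differentiableOn_thetaX hV hY).continuousOn
  have hYY := (differentiableOn_thetaY hV hY).continuousOn
  unfold pde₂
  fun_prop

end Theta

end Bimodular

end

/-! ### From the Picard–Fuchs equation to the two partial differential equations -/

noncomputable section

namespace Bimodular

open Complex Filter Matrix

/-! ### Rational functions of `t₁` and `t₂` -/

/-- The function `t (1 - t³)`. -/
def ratE (t : ℂ) : ℂ := t * (1 - t ^ 3)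

/-- The numerator `t + s - 2 t² s²`. -/
def ratN (t s : ℂ) : ℂ := t + s - 2 * t ^ 2 * s ^ 2

/-- The denominator `1 + 4 t s (t + s)`. -/
def ratD (t s : ℂ) : ℂ := 1 + 4 * t * s * (t + s)

/-- The function `x` in terms of `t` and `s`. -/
def ratX (t s : ℂ) : ℂ := (ratN t s / ratD t s) ^ 3

/-- The function `y` in terms of `t` and `s`. -/
def ratY (t s : ℂ) : ℂ := t * s * (1 - t ^ 3) * (1 - s ^ 3) / ratN t s ^ 2

/-- The Jacobian factor of `x`. -/
def ratK (t s : ℂ) : ℂ := 1 - 4 * t ^ 2 * s - 12 * t * s ^ 2 - 4 * s ^ 3 - 8 * t ^ 2 * s ^ 4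

/-- The Jacobian factor of `y`. -/
def ratA (t s : ℂ) : ℂ := 1 + 2 * t ^ 3 + 6 * t ^ 2 * s

/-- The logarithmic derivative of `x` with respect to `t (1 - t³) d/dt`. -/
def logX (t s : ℂ) : ℂ := 3 * (ratE t * ratK t s) / (ratN t s * ratD t s)

/-- The logarithmic derivative of `y` with respect to `t (1 - t³) d/dt`. -/
def logY (t s : ℂ) : ℂ := (s - t) * ratA t s / ratN t s

/-- Half the logarithmic derivative of the denominator with respect to `t (1 - t³) d/dt`. -/
def logD (t s : ℂ) : ℂ := ratE t * (2 * s * (2 * t + s)) / ratD t s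

variable {t s : ℂ}

lemma hasDerivAt_ratN : HasDerivAt (fun t => ratN t s) (1 - 4 * t * s ^ 2) t := by
  have := ((hasDerivAt_id t).add_const s).sub
    ((((hasDerivAt_id t).pow 2).const_mul 2).mul_const (s ^ 2))
  refine this.congr_deriv ?_
  simp only [id, Nat.cast_ofNat]; ring

lemma hasDerivAt_ratD : HasDerivAt (fun t => ratD t s) (4 * s * (2 * t + s)) t := by
  have := ((((hasDerivAt_id t).const_mul 4).mul_const s).mul
    ((hasDerivAt_id t).add_const s)).const_add 1
  refine this.congr_deriv ?_
  simp only [id]; ring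

lemma hasDerivAt_ratE : HasDerivAt ratE (1 - 4 * t ^ 3) t := by
  have := (hasDerivAt_id t).mul (((hasDerivAt_id t).pow 3).const_sub 1)
  refine this.congr_deriv ?_
  simp only [id, Nat.cast_ofNat, Pi.pow_apply]; ring

lemma hasDerivAt_ratK :
    HasDerivAt (fun t => ratK t s) (-8 * t * s - 12 * s ^ 2 - 16 * t * s ^ 4) t := by
  have h2 := (hasDerivAt_id t).pow 2
  have := (((((h2.const_mul 4).mul_const s).const_sub 1).sub
    (((hasDerivAt_id t).const_mul 12).mul_const (s ^ 2))).sub_const (4 * s ^ 3)).sub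
      ((h2.const_mul 8).mul_const (s ^ 4))
  refine this.congr_deriv ?_
  simp only [id, Nat.cast_ofNat]; ring

lemma hasDerivAt_ratA : HasDerivAt (fun t => ratA t s) (6 * t ^ 2 + 12 * t * s) t := by
  have := ((((hasDerivAt_id t).pow 3).const_mul 2).const_add 1).add
    ((((hasDerivAt_id t).pow 2).const_mul 6).mul_const s)
  refine this.congr_deriv ?_
  simp only [id, Nat.cast_ofNat]; ring

/-- The derivation t(1 - t³) d/dt is what D₀ becomes on functions of t; the second clause says that
it multiplies x by `logX`. -/
lemma hasDerivAt_ratX (hD : ratD t s ≠ 0) (hN : ratN t s ≠ 0) : ∃ d,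
    HasDerivAt (fun t => ratX t s) d t ∧ d * ratE t = logX t s * ratX t s := by
  refine ⟨3 * (ratN t s / ratD t s) ^ 2 * (ratK t s / ratD t s ^ 2),
    ((hasDerivAt_ratN.fun_div hasDerivAt_ratD hD).fun_pow 3).congr_deriv ?_, ?_⟩
  · have : (1 - 4 * t * s ^ 2) * ratD t s - ratN t s * (4 * s * (2 * t + s)) = ratK t s := by
      rw [ratK, ratN, ratD]; ring
    rw [this]
    push_cast
    ring
  · rw [logX, ratX]
    field_simp

lemma hasDerivAt_ratY (hN : ratN t s ≠ 0) : ∃ d,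
    HasDerivAt (fun t => ratY t s) d t ∧ d * ratE t = logY t s * ratY t s := by
  have h1 : HasDerivAt (fun t => t * s * (1 - t ^ 3) * (1 - s ^ 3))
      ((1 - 4 * t ^ 3) * (s * (1 - s ^ 3))) t :=
    (hasDerivAt_ratE.mul_const (s * (1 - s ^ 3))).congr_of_eventuallyEq
      (Eventually.of_forall fun t => by simp only [ratE]; ring)
  refine ⟨_, h1.fun_div (hasDerivAt_ratN.fun_pow 2) (pow_ne_zero 2 hN), ?_⟩
  rw [logY, ratY, ratE]
  field_simp
  rw [ratA, ratN]
  push_cast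
  ring

/-- The derivative of `logX`. -/
def derivLogX (t s : ℂ) : ℂ :=
  (3 * ((1 - 4 * t ^ 3) * ratK t s + ratE t * (-8 * t * s - 12 * s ^ 2 - 16 * t * s ^ 4)) *
    (ratN t s * ratD t s) - 3 * (ratE t * ratK t s) *
      ((1 - 4 * t * s ^ 2) * ratD t s + ratN t s * (4 * s * (2 * t + s)))) /
    (ratN t s * ratD t s) ^ 2

/-- The derivative of `logY`. -/
def derivLogY (t s : ℂ) : ℂ :=
  ((-ratA t s + (s - t) * (6 * t ^ 2 + 12 * t * s)) * ratN t s -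
    (s - t) * ratA t s * (1 - 4 * t * s ^ 2)) / ratN t s ^ 2

/-- The derivative of `logD`. -/
def derivLogD (t s : ℂ) : ℂ :=
  (((1 - 4 * t ^ 3) * (2 * s * (2 * t + s)) + ratE t * (4 * s)) * ratD t s -
    ratE t * (2 * s * (2 * t + s)) * (4 * s * (2 * t + s))) / ratD t s ^ 2

lemma hasDerivAt_logX (hD : ratD t s ≠ 0) (hN : ratN t s ≠ 0) :
    HasDerivAt (fun t => logX t s) (derivLogX t s) t :=
  ((hasDerivAt_ratE.fun_mul hasDerivAt_ratK).const_mul 3).fun_div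
    (hasDerivAt_ratN.fun_mul hasDerivAt_ratD) (mul_ne_zero hN hD)

lemma hasDerivAt_logY (hN : ratN t s ≠ 0) :
    HasDerivAt (fun t => logY t s) (derivLogY t s) t := by
  refine ((((hasDerivAt_id t).const_sub s).fun_mul hasDerivAt_ratA).fun_div
    hasDerivAt_ratN hN).congr_deriv ?_
  simp only [id, derivLogY]; ring

lemma hasDerivAt_logD (hD : ratD t s ≠ 0) :
    HasDerivAt (fun t => logD t s) (derivLogD t s) t := by
  have h : HasDerivAt (fun t => 2 * s * (2 * t + s)) (4 * s) t :=
    ((((hasDerivAt_id t).const_mul 2).add_const s).const_mul (2 * s)).congr_deriv (by ring)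
  exact (hasDerivAt_ratE.fun_mul h).fun_div hasDerivAt_ratD hD

/-- This and the next five identities match, derivative by derivative, the equation in one variable
with `pde₁` times E·D/N plus `pde₂` times A²/D. The multipliers are forced: `pde₁` has no θ_y² term
and `pde₂` has no term of order zero. -/
lemma coeff_identity (hD : ratD t s ≠ 0) (hN : ratN t s ≠ 0) :
    logD t s ^ 2 - ratE t * derivLogD t s - 2 * t ^ 3 * (1 - t ^ 3) =
      ratE t * ratD t s / ratN t s * (-2 * ratX t s * (2 * ratY t s + 1)) := by
  rw [logD, derivLogD, ratX, ratY]
  field_simp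
  rw [ratE, ratD, ratN]
  ring

lemma coeffX_identity (hD : ratD t s ≠ 0) (hN : ratN t s ≠ 0) :
    ratE t * derivLogX t s - 2 * logD t s * logX t s =
      ratE t * ratD t s / ratN t s * (-ratX t s * (9 + 60 * ratY t s)) +
        ratA t s ^ 2 / ratD t s * (3 * ratY t s) := by
  rw [logD, derivLogX, logX, ratX, ratY]
  field_simp
  rw [ratE, ratD, ratN, ratA, ratK]
  ring

lemma coeffY_identity (hD : ratD t s ≠ 0) (hN : ratN t s ≠ 0) :
    ratE t * derivLogY t s - 2 * logD t s * logY t s =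
      ratE t * ratD t s / ratN t s * (-6 * ratX t s * (1 - 4 * ratY t s)) +
        ratA t s ^ 2 / ratD t s * (-2 * ratY t s) := by
  rw [logD, derivLogY, logY, ratX, ratY]
  field_simp
  rw [ratE, ratD, ratN, ratA]
  ring

lemma coeffXX_identity (hD : ratD t s ≠ 0) (hN : ratN t s ≠ 0) :
    logX t s ^ 2 = ratE t * ratD t s / ratN t s * (9 - 9 * ratX t s - 108 * ratX t s * ratY t s) +
        ratA t s ^ 2 / ratD t s * (-9 * ratY t s) := by
  rw [logX, ratX, ratY]
  field_simp
  rw [ratE, ratD, ratN, ratA, ratK]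
  ring

lemma coeffXY_identity (hD : ratD t s ≠ 0) (hN : ratN t s ≠ 0) :
    2 * logX t s * logY t s =
      ratE t * ratD t s / ratN t s * (-(6 + 12 * ratX t s * (1 - 4 * ratY t s))) +
        ratA t s ^ 2 / ratD t s * (12 * ratY t s) := by
  rw [logX, logY, ratX, ratY]
  field_simp
  rw [ratE, ratD, ratN, ratA, ratK]
  ring

lemma coeffYY_identity (hD : ratD t s ≠ 0) (hN : ratN t s ≠ 0) :
    logY t s ^ 2 = ratA t s ^ 2 / ratD t s * (1 - 4 * ratY t s) := by
  rw [logY, ratY]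
  field_simp
  rw [ratD, ratN]
  ring

/-! ### The equation in one variable -/

/-- The ordinary differential equation satisfied by `F` in one of the variables, in terms of the
two partial differential equations. -/
theorem combination_of_curve {V : Set (ℂ × ℂ)} (hV : IsOpen V) {Φ : ℂ × ℂ → ℂ}
    (hΦ : DifferentiableOn ℂ Φ V) {W : Set ℂ} (hW : IsOpen W) {s k : ℂ} (hk : k ≠ 0)
    (him : ∀ z ∈ W, 0 < z.im) (hL : ∀ z ∈ W, L z ≠ 0) (hN : ∀ z ∈ W, ratN (tC z) s ≠ 0)
    (hD : ∀ z ∈ W, ratD (tC z) s ≠ 0) (hmem : ∀ z ∈ W, (ratX (tC z) s, ratY (tC z) s) ∈ V)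
    (hsq : ∀ z ∈ W, Φ (ratX (tC z) s, ratY (tC z) s) ^ 2 = k * (ratD (tC z) s * L z ^ 2))
    {z : ℂ} (hz : z ∈ W) :
    ratE (tC z) * ratD (tC z) s ^ 2 * pde₁ Φ (ratX (tC z) s, ratY (tC z) s) +
      ratA (tC z) s ^ 2 * ratN (tC z) s * pde₂ Φ (ratX (tC z) s, ratY (tC z) s) = 0 := by
  have hΦX := differentiableOn_thetaX hV hΦ
  have hΦY := differentiableOn_thetaY hV hΦ
  have hc {z : ℂ} (hz : z ∈ W) : mu * L z ^ 2 ≠ 0 :=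
    mul_ne_zero mu_ne_zero (pow_ne_zero 2 (hL z hz))
  have ht {z : ℂ} (hz : z ∈ W) : HasDerivAt tC (mu * L z ^ 2 * ratE (tC z)) z :=
    hasDerivAt_tC (him z hz) (hL z hz)
  have hX {z : ℂ} (hz : z ∈ W) : HasDerivAt (fun z => ratX (tC z) s)
      (mu * L z ^ 2 * (logX (tC z) s * ratX (tC z) s)) z := by
    obtain ⟨d, h1, h2⟩ := hasDerivAt_ratX (hD z hz) (hN z hz)
    refine (h1.comp z (ht hz)).congr_deriv ?_
    rw [← h2]; ring
  have hY {z : ℂ} (hz : z ∈ W) : HasDerivAt (fun z => ratY (tC z) s)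
      (mu * L z ^ 2 * (logY (tC z) s * ratY (tC z) s)) z := by
    obtain ⟨d, h1, h2⟩ := hasDerivAt_ratY (hN z hz)
    refine (h1.comp z (ht hz)).congr_deriv ?_
    rw [← h2]; ring
  -- The equation D₀Φ = (½ D₀ log D + D₀ log a)Φ, obtained by differentiating the relation for Φ² so
  -- that no branch of the square root appears.
  have first {z : ℂ} (hz : z ∈ W) :
      logX (tC z) s * thetaX Φ (ratX (tC z) s, ratY (tC z) s) +
        logY (tC z) s * thetaY Φ (ratX (tC z) s, ratY (tC z) s) =
      (logD (tC z) s + alC z) * Φ (ratX (tC z) s, ratY (tC z) s) := by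
    have hG := hasDerivAt_comp_curve (X := fun z => ratX (tC z) s)
      (Y := fun z => ratY (tC z) s) hV hΦ (hmem z hz) (hX hz) (hY hz)
    have h1 := hG.fun_pow 2
    have h2 := ((((hasDerivAt_ratD (s := s)).comp z (ht hz)).fun_mul
      ((hasDerivAt_L (him z hz) (hL z hz)).fun_pow 2))).const_mul k
    have h3 := h1.unique (h2.congr_of_eventuallyEq
      (by filter_upwards [hW.mem_nhds hz] with w hw using hsq w hw))
    have h4 := hsq z hz
    have hG0 : Φ (ratX (tC z) s, ratY (tC z) s) ≠ 0 := by
      intro h0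
      rw [h0] at h4
      exact mul_ne_zero hk (mul_ne_zero (hD z hz) (pow_ne_zero 2 (hL z hz))) (by rw [← h4]; ring)
    have hD' := hD z hz
    have e : logD (tC z) s * ratD (tC z) s = ratE (tC z) * (2 * s * (2 * tC z + s)) := by
      rw [logD, div_mul_cancel₀ _ hD']
    refine mul_left_cancel₀ (mul_ne_zero (hc hz) hG0) ?_
    push_cast at h3
    simp only [Function.comp_apply] at h3
    linear_combination h3 / 2 - mu * L z ^ 2 * (logD (tC z) s + alC z) * h4
      - k * mu * L z ^ 4 * e
  have dX := (hasDerivAt_logX (hD z hz) (hN z hz)).comp z (ht hz)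
  have dY := (hasDerivAt_logY (hN z hz)).comp z (ht hz)
  have dD := (hasDerivAt_logD (hD z hz)).comp z (ht hz)
  have d0 := hasDerivAt_comp_curve (X := fun z => ratX (tC z) s)
    (Y := fun z => ratY (tC z) s) hV hΦ (hmem z hz) (hX hz) (hY hz)
  have d1 := hasDerivAt_comp_curve (X := fun z => ratX (tC z) s)
    (Y := fun z => ratY (tC z) s) hV hΦX (hmem z hz) (hX hz) (hY hz)
  have d2 := hasDerivAt_comp_curve (X := fun z => ratX (tC z) s)
    (Y := fun z => ratY (tC z) s) hV hΦY (hmem z hz) (hX hz) (hY hz)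
  have lhs := (dX.fun_mul d1).fun_add (dY.fun_mul d2)
  have rhs := (dD.fun_add (hasDerivAt_alC (him z hz) (hL z hz))).fun_mul d0
  -- The first-order relation is differentiated once more along the curve; the Riccati equation for
  -- `alC` enters here.
  have h5 := lhs.unique (rhs.congr_of_eventuallyEq
    (by filter_upwards [hW.mem_nhds hz] with w hw using first hw))
  simp only [Function.comp_apply] at h5
  rw [thetaY_thetaX hV hΦ (hmem z hz)] at h5
  have h1 := first hz
  have hD' := hD z hz
  have hN' := hN z hz
  rw [pde₁, pde₂]
  dsimp only
  have i0 := coeff_identity hD' hN'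
  have iX := coeffX_identity hD' hN'
  have iY := coeffY_identity hD' hN'
  have iXX := coeffXX_identity hD' hN'
  have iXY := coeffXY_identity hD' hN'
  have iYY := coeffYY_identity hD' hN'
  set f := Φ (ratX (tC z) s, ratY (tC z) s)
  set fx := thetaX Φ (ratX (tC z) s, ratY (tC z) s)
  set fy := thetaY Φ (ratX (tC z) s, ratY (tC z) s)
  set fxx := thetaX (thetaX Φ) (ratX (tC z) s, ratY (tC z) s)
  set fxy := thetaX (thetaY Φ) (ratX (tC z) s, ratY (tC z) s)
  set fyy := thetaY (thetaY Φ) (ratX (tC z) s, ratY (tC z) s)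
  set T := tC z
  -- Eliminating `alC` by means of the first-order relation leaves coefficients rational in t₁ and
  -- t₂.
  have ode : (logD T s ^ 2 - ratE T * derivLogD T s - 2 * T ^ 3 * (1 - T ^ 3)) * f +
      (ratE T * derivLogX T s - 2 * logD T s * logX T s) * fx +
      (ratE T * derivLogY T s - 2 * logD T s * logY T s) * fy +
      logX T s ^ 2 * fxx + 2 * logX T s * logY T s * fxy + logY T s ^ 2 * fyy = 0 := by
    refine mul_left_cancel₀ (hc hz) ?_
    linear_combination h5 + mu * L z ^ 2 * (alC z - logD T s) * h1
  rw [i0, iX, iY, iXX, iXY, iYY] at ode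
  have e1 : ratD T s * ratN T s * (ratE T * ratD T s / ratN T s) = ratE T * ratD T s ^ 2 := by
    field_simp
  have e2 : ratD T s * ratN T s * (ratA T s ^ 2 / ratD T s) = ratA T s ^ 2 * ratN T s := by
    field_simp
  rw [← e1, ← e2]
  linear_combination ratD T s * ratN T s * ode

end Bimodular

end

noncomputable section

namespace Bimodular

open Complex Filter Matrix

/-! ### The system of partial differential equations -/

lemma denQ_swap (p : ℍ × ℍ) : denQ p.swap = denQ p := by
  rw [denQ, denQ, Prod.fst_swap, Prod.snd_swap]; ring

lemma numP_swap (p : ℍ × ℍ) : numP p.swap = numP p := by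
  rw [numP, numP, Prod.fst_swap, Prod.snd_swap]; ring

lemma denQ_eq_ratD (p : ℍ × ℍ) : denQ p = ratD (tC p.1) (tC p.2) := by
  rw [denQ, ratD, t_eq, t_eq]

lemma numP_eq_ratN (p : ℍ × ℍ) : numP p = ratN (tC p.1) (tC p.2) := by
  rw [numP, ratN, t_eq, t_eq]

lemma x_eq_ratX (p : ℍ × ℍ) : x p = ratX (tC p.1) (tC p.2) := by
  rw [x, ratX, numP_eq_ratN, denQ_eq_ratD]

lemma y_eq_ratY (p : ℍ × ℍ) : y p = ratY (tC p.1) (tC p.2) := by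
  rw [y, ratY, numP_eq_ratN, t_eq, t_eq]

lemma swap_mem_regularSet {p : ℍ × ℍ} (h : p.swap ∈ regularSet) : p ∈ regularSet := by
  obtain ⟨h1, h2, h3, h4⟩ := h
  rw [denQ_swap] at h3
  rw [numP_swap] at h4
  exact ⟨h2, h1, h3, h4⟩

section

variable {U : Set (ℍ × ℍ)} {V : Set (ℂ × ℂ)} {w : ℍ × ℍ → ℂ} {Φ : ℂ × ℂ → ℂ}

lemma IsLocalExpression.swap (h : IsLocalExpression U V w Φ) :
    IsLocalExpression (Prod.swap ⁻¹' U) V (fun p => w p.swap) Φ where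
  isOpen_left := h.isOpen_left.preimage continuous_swap
  regular _ hp := swap_mem_regularSet (h.regular hp)
  isOpen_right := h.isOpen_right
  mapsTo p hp := by
    have : (x p.swap, y p.swap) ∈ V := h.mapsTo hp
    rwa [x_swap, y_swap] at this
  sqrt p hp := by rw [h.sqrt _ hp, denQ_swap]
  holo := h.holo
  eq p hp := by
    have := h.eq _ hp
    rw [x_swap, y_swap] at this
    rw [this, valF, valF, Prod.fst_swap, Prod.snd_swap]
    ring

lemma IsLocalExpression.combination (h : IsLocalExpression U V w Φ) {p : ℍ × ℍ} (hp : p ∈ U) :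
    ratE (t p.1) * denQ p ^ 2 * pde₁ Φ (x p, y p) +
      ratA (t p.1) (t p.2) ^ 2 * numP p * pde₂ Φ (x p, y p) = 0 := by
  -- The slice of `U` with τ₂ frozen; the constant a(τ₂)²/9 is the `k` of the one-variable
  -- statement.
  set W : Set ℂ := (↑) '' {τ : ℍ | (τ, p.2) ∈ U} with hW
  have hWo : IsOpen W := UpperHalfPlane.isOpenEmbedding_coe.isOpenMap _
    (h.isOpen_left.preimage (Continuous.prodMk continuous_id continuous_const))
  have hA := (h.regular hp).2.1
  have key := combination_of_curve (s := tC p.2) (k := thetaA p.2 ^ 2 / 9) (W := W)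
    (z := (p.1 : ℂ)) h.isOpen_right h.holo hWo (div_ne_zero (pow_ne_zero 2 hA) (by norm_num))
    (by rintro _ ⟨τ, -, rfl⟩; exact τ.im_pos)
    (by rintro _ ⟨τ, hτ, rfl⟩; exact (h.regular hτ).1)
    (by
      rintro _ ⟨τ, hτ, rfl⟩
      have := (h.regular hτ).2.2.2
      rwa [numP_eq_ratN] at this)
    (by
      rintro _ ⟨τ, hτ, rfl⟩
      have := (h.regular hτ).2.2.1
      rwa [denQ_eq_ratD] at this)
    (by
      rintro _ ⟨τ, hτ, rfl⟩
      have : (x (τ, p.2), y (τ, p.2)) ∈ V := h.mapsTo hτ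
      rwa [x_eq_ratX, y_eq_ratY] at this)
    (by
      rintro _ ⟨τ, hτ, rfl⟩
      have h1 := h.eq _ hτ
      have h2 := h.sqrt _ hτ
      rw [x_eq_ratX, y_eq_ratY] at h1
      rw [denQ_eq_ratD] at h2
      rw [h1, ← h2, valF, coe_thetaA τ]
      ring)
    ⟨p.1, hp, rfl⟩
  rwa [← denQ_eq_ratD, ← numP_eq_ratN, ← x_eq_ratX, ← y_eq_ratY, ← t_eq, ← t_eq] at key

open Polynomial in
open scoped Polynomial.Bivariate in
lemma dense_resultant : Dense {p : ℍ × ℍ |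
    ratE (t p.1) * ratA (t p.2) (t p.1) ^ 2 - ratE (t p.2) * ratA (t p.1) (t p.2) ^ 2 ≠ 0} := by
  set q : ℂ[X][Y] := C X * (1 - C X ^ 3) * (1 + 2 * Y ^ 3 + 6 * Y ^ 2 * C X) ^ 2 -
    Y * (1 - Y ^ 3) * (1 + 2 * C X ^ 3 + 6 * C X ^ 2 * Y) ^ 2 with hq
  have e (a b : ℂ) : q.evalEval a b = ratE a * ratA b a ^ 2 - ratE b * ratA a b ^ 2 := by
    simp [hq, evalEval, ratE, ratA]; ring
  have h0 : q ≠ 0 := by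
    intro h
    -- At (2, 0) the determinant equals E(2) = -14.
    have := e 2 0
    rw [h] at this
    simp [ratE, ratA] at this
    norm_num at this
  refine (dense_bivariate h0).mono ?_
  rintro p ⟨-, -, h3⟩
  rwa [e] at h3

lemma continuousAt_t {τ : ℍ} (h : thetaA τ ≠ 0) : ContinuousAt t τ :=
  continuous_thetaB.continuousAt.div continuous_thetaA.continuousAt h

lemma continuousAt_xy {p : ℍ × ℍ} (hp : p ∈ regularSet) :
    ContinuousAt (fun p => (x p, y p)) p := by
  obtain ⟨h1, h2, h3, h4⟩ := hp
  have c1 : ContinuousAt (fun p : ℍ × ℍ => t p.1) p :=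
    ContinuousAt.comp (continuousAt_t h1) continuous_fst.continuousAt
  have c2 : ContinuousAt (fun p : ℍ × ℍ => t p.2) p :=
    ContinuousAt.comp (continuousAt_t h2) continuous_snd.continuousAt
  have cN : ContinuousAt numP p := by unfold numP; fun_prop
  have cD : ContinuousAt denQ p := by unfold denQ; fun_prop
  refine ContinuousAt.prodMk ((cN.div cD h3).pow 3) (ContinuousAt.div ?_ (cN.pow 2)
    (pow_ne_zero 2 h4))
  fun_prop

lemma eq_zero_of_dense {f : ℍ × ℍ → ℂ} {S : Set (ℍ × ℍ)} (hU : IsOpen U) (hS : Dense S)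
    (h : ∀ q ∈ U, q ∈ S → f q = 0) {p : ℍ × ℍ} (hp : p ∈ U) (hf : ContinuousAt f p) :
    f p = 0 := by
  by_contra h0
  obtain ⟨q, hq, hqS⟩ := (mem_closure_iff_nhds.mp (hS p)) _
    (inter_mem (hU.mem_nhds hp) (hf.eventually_ne h0))
  exact hq.2 (h q hq.1 hqS)

theorem IsLocalExpression.pde (h : IsLocalExpression U V w Φ) {p : ℍ × ℍ} (hp : p ∈ U) :
    pde₁ Φ (x p, y p) = 0 ∧ pde₂ Φ (x p, y p) = 0 := by
  have generic : ∀ q ∈ U, q ∈ {p : ℍ × ℍ | ratE (t p.1) * ratA (t p.2) (t p.1) ^ 2 -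
      ratE (t p.2) * ratA (t p.1) (t p.2) ^ 2 ≠ 0} →
      pde₁ Φ (x q, y q) = 0 ∧ pde₂ Φ (x q, y q) = 0 := by
    intro q hq hdet
    have e1 := h.combination hq
    have e2 := h.swap.combination (p := q.swap) (by simpa using hq)
    rw [denQ_swap, numP_swap, x_swap, y_swap, Prod.fst_swap, Prod.snd_swap] at e2
    obtain ⟨-, -, hD, hN⟩ := h.regular hq
    refine ⟨mul_left_cancel₀ (mul_ne_zero hdet (pow_ne_zero 2 hD)) ?_,
      mul_left_cancel₀ (mul_ne_zero hdet hN) ?_⟩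
    -- Cramer's rule for the two combinations obtained from τ₁ and from τ₂.
    · linear_combination ratA (t q.2) (t q.1) ^ 2 * e1 - ratA (t q.1) (t q.2) ^ 2 * e2
    · linear_combination ratE (t q.1) * e2 - ratE (t q.2) * e1
  have hc := continuousAt_xy (h.regular hp)
  have hV := h.isOpen_right.mem_nhds (h.mapsTo hp)
  exact ⟨eq_zero_of_dense h.isOpen_left dense_resultant (fun q hq hS => (generic q hq hS).1) hp
      (ContinuousAt.comp (f := fun p => (x p, y p))
        ((continuousOn_pde₁ h.isOpen_right h.holo).continuousAt hV) hc),
    eq_zero_of_dense h.isOpen_left dense_resultant (fun q hq hS => (generic q hq hS).2) hp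
      (ContinuousAt.comp (f := fun p => (x p, y p))
        ((continuousOn_pde₂ h.isOpen_right h.holo).continuousAt hV) hc)⟩

theorem IsLocalExpression.satisfiesPDE (h : IsLocalExpression U V w Φ) {p : ℍ × ℍ}
    (hp : p ∈ U) : SatisfiesPDE₁ Φ (x p, y p) ∧ SatisfiesPDE₂ Φ (x p, y p) :=
  ⟨(satisfiesPDE₁_iff h.isOpen_right h.holo (h.mapsTo hp)).mpr (h.pde hp).1,
    (satisfiesPDE₂_iff h.isOpen_right h.holo (h.mapsTo hp)).mpr (h.pde hp).2⟩

end

end Bimodular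

end

/-! ### The Jacobian of (x, y) and the local branches of F -/

noncomputable section

namespace Bimodular

open Complex Filter Matrix

/-! ### Local coordinates -/

/-- A differentiable map of `ℂ²` whose partial derivatives are linearly independent is a local
homeomorphism with differentiable inverse. -/
lemma exists_localInverse {f : ℂ × ℂ → ℂ × ℂ} {z : ℂ × ℂ} (hf : ContDiffAt ℂ 1 f z)
    {a b c d : ℂ} (h1 : HasDerivAt (fun u => f (u, z.2)) (a, b) z.1)
    (h2 : HasDerivAt (fun v => f (z.1, v)) (c, d) z.2) (hdet : a * d - b * c ≠ 0) :
    ∃ e : OpenPartialHomeomorph (ℂ × ℂ) (ℂ × ℂ), ⇑e = f ∧ z ∈ e.source ∧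
      ∀ᶠ v in 𝓝 (f z), DifferentiableAt ℂ e.symm v := by
  have hd := (hf.differentiableAt one_ne_zero).hasFDerivAt
  set A := fderiv ℂ f z with hA
  have e1 : A (1, 0) = (a, b) := (hd.comp_hasDerivAt z.1 (f := fun u => (u, z.2))
    ((hasDerivAt_id z.1).prodMk (hasDerivAt_const z.1 z.2))).unique h1
  have e2 : A (0, 1) = (c, d) := (hd.comp_hasDerivAt z.2 (f := fun v => (z.1, v))
    ((hasDerivAt_const z.2 z.1).prodMk (hasDerivAt_id z.2))).unique h2
  have happ (v : ℂ × ℂ) : A v = (v.1 * a + v.2 * c, v.1 * b + v.2 * d) := by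
    have : v = v.1 • ((1, 0) : ℂ × ℂ) + v.2 • ((0, 1) : ℂ × ℂ) := by ext <;> simp
    conv_lhs => rw [this]
    rw [map_add, map_smul, map_smul, e1, e2]
    ext <;> simp
  have hinj : Function.Injective (A : ℂ × ℂ →ₗ[ℂ] ℂ × ℂ) := by
    rw [← LinearMap.ker_eq_bot, LinearMap.ker_eq_bot']
    intro v hv
    have hv' : A v = 0 := hv
    rw [happ, Prod.mk_eq_zero] at hv'
    obtain ⟨k1, k2⟩ := hv'
    ext
    · exact mul_left_cancel₀ hdet (by simp only [Prod.fst_zero]; linear_combination d * k1 - c * k2)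
    · exact mul_left_cancel₀ hdet (by simp only [Prod.snd_zero]; linear_combination a * k2 - b * k1)
  have hsurj := LinearMap.injective_iff_surjective.mp hinj
  set E := ContinuousLinearEquiv.ofBijective A (LinearMap.ker_eq_bot.mpr hinj)
    (LinearMap.range_eq_top.mpr hsurj) with hE
  have hd' : HasFDerivAt f (E : ℂ × ℂ →L[ℂ] ℂ × ℂ) z := by
    rw [hE, ContinuousLinearEquiv.coe_ofBijective]
    exact hd
  refine ⟨hf.toOpenPartialHomeomorph f hd' one_ne_zero, rfl,
    hf.mem_toOpenPartialHomeomorph_source hd' one_ne_zero, ?_⟩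
  have hi : ContDiffAt ℂ 1 (hf.toOpenPartialHomeomorph f hd' one_ne_zero).symm (f z) :=
    hf.to_localInverse hd' one_ne_zero
  filter_upwards [hi.eventually (by norm_num)] with v hv using hv.differentiableAt one_ne_zero

lemma contDiffAt_of_upperHalfPlane {f : ℂ → ℂ} (hf : ∀ z : ℂ, 0 < z.im → DifferentiableAt ℂ f z)
    {z : ℂ} (hz : 0 < z.im) : ContDiffAt ℂ 1 f z := by
  have h : DifferentiableOn ℂ f {z : ℂ | 0 < z.im} :=
    fun w hw => (hf w hw).differentiableWithinAt
  exact (h.contDiffOn (isOpen_lt continuous_const continuous_im)).contDiffAt (im_pos_mem_nhds hz)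

lemma contDiffAt_L {z : ℂ} (hz : 0 < z.im) : ContDiffAt ℂ 1 L z :=
  contDiffAt_of_upperHalfPlane (fun _ => differentiableAt_L) hz

lemma contDiffAt_tC {z : ℂ} (hz : 0 < z.im) (hL : L z ≠ 0) : ContDiffAt ℂ 1 tC z :=
  (contDiffAt_of_upperHalfPlane (fun _ => differentiableAt_thetaB) hz).div (contDiffAt_L hz) hL

/-- The functions `x` and `y` as functions on `ℂ²`. -/
def coordXY (z : ℂ × ℂ) : ℂ × ℂ := (ratX (tC z.1) (tC z.2), ratY (tC z.1) (tC z.2))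

lemma coordXY_coe (p : ℍ × ℍ) : coordXY ((p.1 : ℂ), (p.2 : ℂ)) = (x p, y p) := by
  rw [coordXY, x_eq_ratX, y_eq_ratY]

/-- The points at which `x`, `y` and `F` are regular. -/
def IsRegularPoint (z : ℂ × ℂ) : Prop := 0 < z.1.im ∧ 0 < z.2.im ∧ L z.1 ≠ 0 ∧ L z.2 ≠ 0 ∧
  ratD (tC z.1) (tC z.2) ≠ 0 ∧ ratN (tC z.1) (tC z.2) ≠ 0

section

variable {z : ℂ × ℂ}

lemma IsRegularPoint.contDiffAt_fst (h : IsRegularPoint z) :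
    ContDiffAt ℂ 1 (fun z : ℂ × ℂ => tC z.1) z :=
  (contDiffAt_tC h.1 h.2.2.1).comp z (f := Prod.fst) _root_.contDiffAt_fst

lemma IsRegularPoint.contDiffAt_snd (h : IsRegularPoint z) :
    ContDiffAt ℂ 1 (fun z : ℂ × ℂ => tC z.2) z :=
  (contDiffAt_tC h.2.1 h.2.2.2.1).comp z (f := Prod.snd) _root_.contDiffAt_snd

lemma IsRegularPoint.contDiffAt_ratD (h : IsRegularPoint z) :
    ContDiffAt ℂ 1 (fun z : ℂ × ℂ => ratD (tC z.1) (tC z.2)) z := by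
  have h1 := h.contDiffAt_fst
  have h2 := h.contDiffAt_snd
  unfold ratD
  fun_prop

lemma IsRegularPoint.contDiffAt_ratN (h : IsRegularPoint z) :
    ContDiffAt ℂ 1 (fun z : ℂ × ℂ => ratN (tC z.1) (tC z.2)) z := by
  have h1 := h.contDiffAt_fst
  have h2 := h.contDiffAt_snd
  unfold ratN
  fun_prop

lemma IsRegularPoint.contDiffAt_coordXY (h : IsRegularPoint z) : ContDiffAt ℂ 1 coordXY z := by
  have h1 := h.contDiffAt_fst
  have h2 := h.contDiffAt_snd
  have hD := h.contDiffAt_ratD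
  have hN := h.contDiffAt_ratN
  refine ContDiffAt.prodMk ((hN.div hD h.2.2.2.2.1).pow 3) (ContDiffAt.div ?_ (hN.pow 2)
    (pow_ne_zero 2 h.2.2.2.2.2))
  fun_prop

lemma IsRegularPoint.eventually (h : IsRegularPoint z) : ∀ᶠ w in 𝓝 z, IsRegularPoint w := by
  obtain ⟨h1, h2, h3, h4, h5, h6⟩ := id h
  have c1 : ContinuousAt (fun w : ℂ × ℂ => L w.1) z :=
    ContinuousAt.comp (contDiffAt_L h1).continuousAt continuous_fst.continuousAt
  have c2 : ContinuousAt (fun w : ℂ × ℂ => L w.2) z :=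
    ContinuousAt.comp (contDiffAt_L h2).continuousAt continuous_snd.continuousAt
  filter_upwards [(continuous_im.comp continuous_fst).continuousAt.eventually_const_lt h1,
    (continuous_im.comp continuous_snd).continuousAt.eventually_const_lt h2,
    c1.eventually_ne h3, c2.eventually_ne h4,
    h.contDiffAt_ratD.continuousAt.eventually_ne h5,
    h.contDiffAt_ratN.continuousAt.eventually_ne h6] with w k1 k2 k3 k4 k5 k6
    using ⟨k1, k2, k3, k4, k5, k6⟩

lemma ratX_comm (t s : ℂ) : ratX t s = ratX s t := by
  rw [ratX, ratX, ratN, ratN, ratD, ratD]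
  congr 2 <;> ring

lemma ratY_comm (t s : ℂ) : ratY t s = ratY s t := by
  rw [ratY, ratY, ratN, ratN]
  congr 1 <;> ring

lemma hasDerivAt_coordXY {z s : ℂ} (hz : 0 < z.im) (hL : L z ≠ 0) (hD : ratD (tC z) s ≠ 0)
    (hN : ratN (tC z) s ≠ 0) : HasDerivAt (fun z => (ratX (tC z) s, ratY (tC z) s))
      (mu * L z ^ 2 * (logX (tC z) s * ratX (tC z) s),
        mu * L z ^ 2 * (logY (tC z) s * ratY (tC z) s)) z := by
  have ht : HasDerivAt tC (mu * L z ^ 2 * ratE (tC z)) z := hasDerivAt_tC hz hL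
  obtain ⟨d, h1, h2⟩ := hasDerivAt_ratX hD hN
  obtain ⟨d', h3, h4⟩ := hasDerivAt_ratY (s := s) hN
  refine HasDerivAt.prodMk ((h1.comp z ht).congr_deriv ?_) ((h3.comp z ht).congr_deriv ?_)
  · rw [← h2]; ring
  · rw [← h4]; ring

lemma ratD_comm (t s : ℂ) : ratD t s = ratD s t := by rw [ratD, ratD]; ring

lemma ratN_comm (t s : ℂ) : ratN t s = ratN s t := by rw [ratN, ratN]; ring

/-- The Jacobian determinant of `x` and `y`, up to nonzero factors. -/
def ratJ (t s : ℂ) : ℂ :=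
  (t - s) * (ratE t * ratK t s * ratA s t + ratE s * ratK s t * ratA t s)

lemma jacobian_eq {t s : ℂ} (hD : ratD t s ≠ 0) (hN : ratN t s ≠ 0) :
    logX t s * logY s t - logY t s * logX s t = 3 * ratJ t s / (ratN t s ^ 2 * ratD t s) := by
  rw [logX, logX, logY, logY, ratD_comm s t, ratN_comm s t, ratJ]
  field_simp
  ring

lemma ratX_ne_zero {t s : ℂ} (hD : ratD t s ≠ 0) (hN : ratN t s ≠ 0) : ratX t s ≠ 0 :=
  pow_ne_zero 3 (div_ne_zero hN hD)

lemma ratY_ne_zero {t s : ℂ} (ht : ratE t ≠ 0) (hs : ratE s ≠ 0) (hN : ratN t s ≠ 0) :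
    ratY t s ≠ 0 := by
  rw [ratY, show t * s * (1 - t ^ 3) * (1 - s ^ 3) = ratE t * ratE s by rw [ratE, ratE]; ring]
  exact div_ne_zero (mul_ne_zero ht hs) (pow_ne_zero 2 hN)

/-- By symmetry of x and y, the derivatives in τ₂ are those in τ₁ with the variables exchanged. The
Jacobian is `ratJ` times factors in a, x, y, N, D that do not vanish at regular points; y ≠ 0
because t(1 - t³) has no zero where a ≠ 0. -/
lemma IsRegularPoint.exists_localInverse (h : IsRegularPoint z)
    (hJ : ratJ (tC z.1) (tC z.2) ≠ 0) :
    ∃ e : OpenPartialHomeomorph (ℂ × ℂ) (ℂ × ℂ), ⇑e = coordXY ∧ z ∈ e.source ∧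
      ∀ᶠ v in 𝓝 (coordXY z), DifferentiableAt ℂ e.symm v := by
  obtain ⟨h1, h2, h3, h4, h5, h6⟩ := id h
  have d1 := hasDerivAt_coordXY h1 h3 h5 h6
  have d2 := hasDerivAt_coordXY h2 h4 (by rwa [ratD_comm]) (by rwa [ratN_comm])
  refine Bimodular.exists_localInverse h.contDiffAt_coordXY d1
    (d2.congr_of_eventuallyEq (Eventually.of_forall fun v => ?_)) ?_
  · simp only [coordXY]
    rw [ratX_comm, ratY_comm]
  · rw [ratX_comm (tC z.2), ratY_comm (tC z.2)]
    have j := jacobian_eq h5 h6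
    have hx := ratX_ne_zero h5 h6
    have hy : ratY (tC z.1) (tC z.2) ≠ 0 :=
      ratY_ne_zero (tC_mul_ne_zero h1 h3) (tC_mul_ne_zero h2 h4) h6
    have hne : mu * L z.1 ^ 2 * (mu * L z.2 ^ 2) * ratX (tC z.1) (tC z.2) *
        ratY (tC z.1) (tC z.2) * (logX (tC z.1) (tC z.2) * logY (tC z.2) (tC z.1) -
          logY (tC z.1) (tC z.2) * logX (tC z.2) (tC z.1)) ≠ 0 := by
      rw [j]
      have hmu := mu_ne_zero
      simp [hmu, h3, h4, h5, h6, hx, hy, hJ]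
    refine fun h0 => hne ?_
    rw [← h0]
    ring

end

/-- Near a point at which the Jacobian determinant does not vanish, `F` is a holomorphic function
of `x` and `y`. -/
theorem exists_isLocalExpression {p : ℍ × ℍ} (hp : p ∈ regularSet)
    (hJ : ratJ (t p.1) (t p.2) ≠ 0) :
    ∃ (U : Set (ℍ × ℍ)) (V : Set (ℂ × ℂ)) (w : ℍ × ℍ → ℂ) (Φ : ℂ × ℂ → ℂ),
      p ∈ U ∧ IsLocalExpression U V w Φ ∧ Set.BijOn (fun q => (x q, y q)) U V := by
  set ι : ℍ × ℍ → ℂ × ℂ := fun q => ((q.1 : ℂ), (q.2 : ℂ)) with hι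
  have hιc : Continuous ι := by fun_prop
  have hιi : Function.Injective ι := fun q r hqr => by
    rw [hι, Prod.mk.injEq, UpperHalfPlane.coe_inj, UpperHalfPlane.coe_inj] at hqr
    exact Prod.ext hqr.1 hqr.2
  have hreg : IsRegularPoint (ι p) := by
    obtain ⟨h1, h2, h3, h4⟩ := hp
    rw [denQ_eq_ratD] at h3
    rw [numP_eq_ratN] at h4
    exact ⟨p.1.im_pos, p.2.im_pos, h1, h2, h3, h4⟩
  obtain ⟨e, he, hsource, hsymm⟩ := hreg.exists_localInverse hJ
  set d₀ := ratD (tC p.1) (tC p.2) with hd₀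
  have hd₀' : d₀ ≠ 0 := hreg.2.2.2.2.1
  set D : ℂ × ℂ → ℂ := fun z => ratD (tC z.1) (tC z.2) with hD
  -- Dividing by the value at p puts D near 1, so the principal square root of the quotient, times a
  -- square root of that value, is a holomorphic branch.
  have hslit : ∀ᶠ z in 𝓝 (ι p), D z / d₀ ∈ slitPlane := by
    refine (hreg.contDiffAt_ratD.continuousAt.div_const d₀).eventually
      (isOpen_slitPlane.mem_nhds ?_)
    change d₀ / d₀ ∈ slitPlane
    rw [div_self hd₀']
    exact one_mem_slitPlane
  have hpull : ∀ᶠ z in 𝓝 (ι p), DifferentiableAt ℂ e.symm (e z) := by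
    rw [he]
    exact hreg.contDiffAt_coordXY.continuousAt.eventually hsymm
  obtain ⟨O, hO, hOo, hpO⟩ := mem_nhds_iff.mp (inter_mem (e.open_source.mem_nhds hsource)
    (hreg.eventually.and (hslit.and hpull)))
  obtain ⟨s₀, hs₀⟩ := IsAlgClosed.exists_pow_nat_eq d₀ two_pos
  set r : ℂ × ℂ → ℂ := fun z => s₀ * (D z / d₀) ^ (((2 : ℕ) : ℂ)⁻¹) with hr
  have hr2 (z : ℂ × ℂ) : r z ^ 2 = D z := by
    rw [hr, mul_pow, cpow_nat_inv_pow _ two_ne_zero, hs₀, mul_div_cancel₀ _ hd₀']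
  set g : ℂ × ℂ → ℂ := fun z => 1 / 3 * r z * L z.1 * L z.2 with hg
  have hgd : ∀ z ∈ O, DifferentiableAt ℂ g z := by
    intro z hz
    obtain ⟨hzr, hzs, -⟩ := (hO hz).2
    have k1 : DifferentiableAt ℂ (fun z : ℂ × ℂ => L z.1) z :=
      DifferentiableAt.comp z (differentiableAt_L hzr.1) differentiableAt_fst
    have k2 : DifferentiableAt ℂ (fun z : ℂ × ℂ => L z.2) z :=
      DifferentiableAt.comp z (differentiableAt_L hzr.2.1) differentiableAt_snd
    have kD : DifferentiableAt ℂ D z := hzr.contDiffAt_ratD.differentiableAt one_ne_zero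
    have k3 : DifferentiableAt ℂ r z := by
      have hzs' : D z / d₀ ∈ slitPlane := hzs
      have kD' : DifferentiableAt ℂ (fun z => D z / d₀) z := by
        simp only [div_eq_mul_inv]
        exact kD.mul_const _
      exact (kD'.cpow_const hzs').const_mul s₀
    exact ((k3.const_mul _).mul k1).mul k2
  have hval (q : ℍ × ℍ) : g (ι q) = valF (r (ι q)) q := by rw [hg, valF]; rfl
  have hcoord (q : ℍ × ℍ) : e (ι q) = (x q, y q) := by rw [he, ← coordXY_coe]
  have hOs : O ⊆ e.source := fun z hz => (hO hz).1
  have hbij : Set.BijOn (fun q => (x q, y q)) (ι ⁻¹' O) (e '' O) := by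
    refine ⟨fun q hq => ⟨ι q, hq, hcoord q⟩, fun q hq q' hq' hqq => ?_, ?_⟩
    · refine hιi (e.injOn (hOs hq) (hOs hq') ?_)
      rw [hcoord, hcoord]
      exact hqq
    · rintro _ ⟨z, hz, rfl⟩
      obtain ⟨h1, h2, -⟩ := (hO hz).2.1
      exact ⟨(⟨z.1, h1⟩, ⟨z.2, h2⟩), hz, (hcoord (⟨z.1, h1⟩, ⟨z.2, h2⟩)).symm⟩
  refine ⟨ι ⁻¹' O, e '' O, fun q => r (ι q), fun v => g (e.symm v), hpO,
    ⟨hOo.preimage hιc, fun q hq => ?_, e.isOpen_image_of_subset_source hOo hOs, hbij.mapsTo,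
      fun q _ => ?_, ?_, fun q hq => ?_⟩, hbij⟩
  · obtain ⟨-, -, h3, h4, h5, h6⟩ := (hO hq).2.1
    refine ⟨h3, h4, ?_, ?_⟩
    · rw [denQ_eq_ratD]; exact h5
    · rw [numP_eq_ratN]; exact h6
  · rw [hr2, denQ_eq_ratD]
  · rintro _ ⟨z, hz, rfl⟩
    refine DifferentiableAt.differentiableWithinAt ?_
    refine DifferentiableAt.comp (g := g) (e z) ?_ (hO hz).2.2.2
    rw [e.left_inv (hOs hz)]
    exact hgd z hz
  · rw [← hcoord, e.left_inv (hOs hq), hval]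

open Polynomial in
open scoped Polynomial.Bivariate in
lemma dense_ratJ_ne_zero : Dense {p : ℍ × ℍ | ratJ (t p.1) (t p.2) ≠ 0 ∧ p ∈ regularSet} := by
  set X' : ℂ[X][Y] := C X with hX
  set q : ℂ[X][Y] := ((X' - Y) * (X' * (1 - X' ^ 3) *
      (1 - 4 * X' ^ 2 * Y - 12 * X' * Y ^ 2 - 4 * Y ^ 3 - 8 * X' ^ 2 * Y ^ 4) *
        (1 + 2 * Y ^ 3 + 6 * Y ^ 2 * X') + Y * (1 - Y ^ 3) *
      (1 - 4 * Y ^ 2 * X' - 12 * Y * X' ^ 2 - 4 * X' ^ 3 - 8 * Y ^ 2 * X' ^ 4) *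
        (1 + 2 * X' ^ 3 + 6 * X' ^ 2 * Y))) * ((1 + 4 * X' * Y * (X' + Y)) *
          (X' + Y - 2 * X' ^ 2 * Y ^ 2)) with hq
  have e (a b : ℂ) : q.evalEval a b = ratJ a b * (ratD a b * ratN a b) := by
    simp [hq, hX, evalEval, ratJ, ratE, ratK, ratA, ratD, ratN, -mul_eq_mul_right_iff]
    ring
  have h0 : q ≠ 0 := by
    intro h
    -- At (2, 0) the three factors are J = -28, D = 1 and N = 2.
    have := e 2 0
    rw [h] at this
    simp [ratJ, ratE, ratK, ratA, ratD, ratN] at this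
    norm_num at this
  refine (dense_bivariate h0).mono ?_
  rintro p ⟨h1, h2, h3⟩
  rw [e] at h3
  have h4 := right_ne_zero_of_mul h3
  exact ⟨left_ne_zero_of_mul h3, h1, h2, left_ne_zero_of_mul h4, right_ne_zero_of_mul h4⟩

end Bimodular

end

theorem mainTheorem12 :
    Bimodular.IsBimodularFunction (CongruenceSubgroup.Gamma0 9)
        (Bimodular.normalizerReal (CongruenceSubgroup.Gamma0 9)) Bimodular.x ∧
    Bimodular.IsBimodularFunction (CongruenceSubgroup.Gamma0 9)
        (Bimodular.normalizerReal (CongruenceSubgroup.Gamma0 9)) Bimodular.y ∧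
    -- `F ^ 2`, which is independent of the branch `w` and extends holomorphically to the zeros of
    -- `a(τ₁) a(τ₂)` (the poles of `t₁` and `t₂`), is a bimodular form
    (∃ F2 : UpperHalfPlane × UpperHalfPlane → ℂ,
      Bimodular.IsBimodularForm 2 (CongruenceSubgroup.Gamma0 9)
        (Bimodular.normalizerReal (CongruenceSubgroup.Gamma0 9)) 1 1 F2 ∧
      ∀ p : UpperHalfPlane × UpperHalfPlane,
        Bimodular.thetaA p.1 ≠ 0 → Bimodular.thetaA p.2 ≠ 0 →
        ∀ w : ℂ, w ^ 2 = Bimodular.denQ p → F2 p = Bimodular.valF w p ^ 2) ∧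
    -- near the points of a dense set, `x` and `y` are local coordinates
    -- and `F` is a holomorphic function of them
    Dense {p : UpperHalfPlane × UpperHalfPlane |
      ∃ (U : Set (UpperHalfPlane × UpperHalfPlane)) (V : Set (ℂ × ℂ))
        (w : UpperHalfPlane × UpperHalfPlane → ℂ) (Φ : ℂ × ℂ → ℂ),
        p ∈ U ∧ Bimodular.IsLocalExpression U V w Φ ∧
        Set.BijOn (fun q => (Bimodular.x q, Bimodular.y q)) U V} ∧
    -- `F`, as a function of `x` and `y`, satisfies the system
    (∀ (U : Set (UpperHalfPlane × UpperHalfPlane)) (V : Set (ℂ × ℂ))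
        (w : UpperHalfPlane × UpperHalfPlane → ℂ) (Φ : ℂ × ℂ → ℂ),
        Bimodular.IsLocalExpression U V w Φ →
        ∀ p ∈ U, Bimodular.SatisfiesPDE₁ Φ (Bimodular.x p, Bimodular.y p) ∧
          Bimodular.SatisfiesPDE₂ Φ (Bimodular.x p, Bimodular.y p)) := by
  refine ⟨Bimodular.isBimodularFunction_x, Bimodular.isBimodularFunction_y,
    ⟨Bimodular.formF2, Bimodular.isBimodularForm_formF2,
      fun p h1 h2 w hw => Bimodular.formF2_eq h1 h2 hw⟩, ?_, ?_⟩
  · refine Bimodular.dense_ratJ_ne_zero.mono ?_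
    rintro p ⟨hJ, hp⟩
    exact Bimodular.exists_isLocalExpression hp hJ
  · intro U V w Φ h p hp
    exact h.satisfiesPDE hp
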